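/- Let $a,b,c\ge 2$ be integers with $\frac1a+\frac1b+\frac1c\le 1$, and let $E$ be the universal orbifold cover of the orbifold sphere $\mathbb P^1_{a,b,c}$ (so $E$ is $\mathbb R^2$ or $\mathbb H^2$), tessellated by the base triangles, with vertices labelled $A,B,C$ and angles $\pi/a,\pi/b,\pi/c$. The base triangles are colored white and black so that adjacent triangles have different colors, and $A,B,C$ occur in counterclockwise order around each white triangle. The middle triangle (or minimal $xyz$ triangle) of a base triangle is the triangle whose vertices are the midpoints of the sides of the base triangle. Let $L_E$ be the union of the sides of all middle triangles; it is the preimage of the Seidel Lagrangian. It divides $E$ into the middle triangles and one polygonal region around each vertex of the tessellation. It is oriented so that middle triangles of white base triangles lie on its left and middle triangles of black base triangles on its right. A Seidel Lagrangian in $E$ is a branch of $L_E$, that is, a curve obtained by following $L_E$ and going straight at each of its crossings (the midpoints of the sides of base triangles). A polygon for the potential is an embedded closed disk $U\subset E$ with boundary in $L_E$, such that at each crossing of $L_E$ on $\partial U$ either $\partial U$ goes straight along a branch of $L_E$, or $U$ has a convex corner which is locally the middle triangle of the white base triangle at this crossing (equivalently: an embedded polygon with convex corners at the immersed generators of odd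 degree, whose boundary orientation agrees with that of $L_E$). Let $Z$ be the tessellation of $E$ by hexagons whose vertices are the vertices of the base triangles and one white vertex in the middle triangle of each white base triangle, and whose edges join each white vertex to the three vertices of its base triangle. The $(a,b,c)$-diagram of $U$ is the cellulation of $U$ by $Z\cap U$; its underlying set is $U$, and diagrams are compared by inclusion of their underlying sets. A basic diagram is a diagram with exactly one interior vertex; it is the diagram of the middle triangle of a white base triangle, and it is unique up to the action of the orbifold fundamental group of $\mathbb P^1_{a,b,c}$ on $E$. Let $X$ be a diagram, let $L$ be a Seidel Lagrangian in $E$ that meets the interior of $X$, and let $X_0$ be the part of $X$ in the closed half-space on the left of $L$. If $X_0$ is a diagram and there is no diagram $X'$ with $X_0\subsetneq X'\subsetneq X$, then $X$ is said to be obtained from $X_0$ by an elementary move along $L$. **Theorem.** Every (non-empty) $(a,b,c)$-diagram $X$ can be obtained from a basic diagram by a finite sequence of elementary moves along Seidel Lagrangians: there are a middle triangle $X_0$ of a white base triangle and diagrams $X_0, X_1,\dots,X_n=X$ with $n\ge0$ such that each $X_{i+1}$ is obtained from $X_i$ by an elementary move. -/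

import Mathlib

/-!
# The orbifold sphere with cone points of orders `a, b, c`: combinatorics of its universal cover

The universal orbifold cover `E` of the orbifold sphere with cone points `A, B, C` of orders
`a, b, c` is tessellated by base triangles with angles `π/a, π/b, π/c`.  The labels `A, B, C` are
the indices `0, 1, 2 : Fin 3`.  The reflections in the sides of one base triangle opposite to its
vertices `A, B, C` are the generators `M.simple 0, M.simple 1, M.simple 2` of the reflection
group `H` of the tessellation, which is the Coxeter group of `triangleMatrix a b c`.

* The base triangles are the elements `h` of `H`; the base triangle adjacent to `h` across its
  side opposite to the vertex labelled `i` is `h * M.simple i` (the dual graph of the tessellation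
  is the Cayley graph of `H`).
* The vertices of the tessellation labelled `j` are the left cosets of the subgroup generated by
  the two reflections that fix the vertex `j` of the triangle `1`.

Everything below (the curve system `L_E`, its branches, their left sides, the polygons bounded by
`L_E`, the hexagon tessellation `Z`) is built on this cell structure.
-/

/-- The Coxeter matrix of the group `H` generated by the reflections `τ_a, τ_b, τ_c` in the sides
of a triangle with angles `π/a, π/b, π/c`:
`τ_a² = τ_b² = τ_c² = (τ_a τ_b)^c = (τ_b τ_c)^a = (τ_c τ_a)^b = 1`. -/
def triangleMatrix (a b c : ℕ) (ha : 2 ≤ a) (hb : 2 ≤ b) (hc : 2 ≤ c) :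
    CoxeterMatrix (Fin 3) where
  M := !![1, c, b; c, 1, a; b, a, 1]
  isSymm := by
    apply Matrix.IsSymm.ext
    intro i j
    fin_cases i <;> fin_cases j <;> rfl
  diagonal := by
    intro i
    fin_cases i <;> rfl
  off_diagonal := by
    intro i j hij
    fin_cases i <;> fin_cases j <;> simp at hij ⊢ <;> omega

namespace SeidelDiagram

variable (M : CoxeterMatrix (Fin 3))

/-- The subgroup generated by the two reflections that fix the vertex labelled `j` of the base
triangle `1`. -/
def vertexGroup (j : Fin 3) : Subgroup M.Group :=
  Subgroup.closure {M.simple (j + 1), M.simple (j + 2)}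

/-- The vertices of the triangle tessellation labelled `j` (`A`-, `B`- and `C`-vertices). -/
abbrev ColoredVertex (j : Fin 3) : Type := M.Group ⧸ vertexGroup M j

variable {M}

/-- The vertex labelled `j` of the base triangle `h`. -/
def vertexOf (h : M.Group) (j : Fin 3) : ColoredVertex M j := QuotientGroup.mk h

/-- The base triangle adjacent to `h` across the side opposite to its vertex labelled `i`. -/
def across (h : M.Group) (i : Fin 3) : M.Group := h * M.simple i

/-- The checkerboard coloring of the base triangles: `1` is white, and adjacent triangles have
different colors.  Going around a white triangle counterclockwise one meets `A, B, C` in this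
order, and around a black one `A, C, B`. -/
def IsWhite (h : M.Group) : Prop := Even (M.toCoxeterSystem.length h)

variable (M)

/-- The preimage `L_E` of the Seidel Lagrangian contains in every base triangle the three sides of
its middle triangle (the minimal `xyz` triangle), which join the midpoints of the sides of the
base triangle.  So `L_E` cuts `E` into the following closed regions: one middle triangle in each
base triangle `h`, and around each vertex `v` of the tessellation, of cone order `m` say, one
`2m`-gon made of the `2m` small corner triangles at `v`. -/
inductive Region : Type
  | middle (h : M.Group) : Region
  | corner (j : Fin 3) (v : ColoredVertex M j) : Region

/-- The segments of `L_E`: the segment `(h, j)` is the side of the middle triangle of `h` which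
cuts off the corner `j` of `h`; it ends on the two sides of `h` adjacent to the vertex `j`. -/
abbrev Segment : Type := M.Group × Fin 3

variable {M}

/-- The region around the vertex `j` of the base triangle `h`. -/
def cornerOf (h : M.Group) (j : Fin 3) : Region M := Region.corner j (vertexOf h j)

/-- The regions `r` and `s` are the two regions on the two sides of the segment `σ`. -/
def Separates (σ : Segment M) (r s : Region M) : Prop :=
  (r = Region.middle σ.1 ∧ s = cornerOf σ.1 σ.2) ∨
    (s = Region.middle σ.1 ∧ r = cornerOf σ.1 σ.2)

variable (M)

/-- Following `L_E` without turning.  `L_E` is oriented so that the middle triangle lies on its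
left in white base triangles and on its right in black ones.  In both colors `L_E` runs along
`(h, j)` towards the midpoint of the side of `h` opposite to the vertex `j + 2 = j - 1`, crosses
that side, and cuts off the other endpoint of the side, labelled `j + 1`, in the base triangle on
the other side.  (At this midpoint the four regions are, in cyclic order, the middle triangle of
`h`, the region at the endpoint `j`, the middle triangle of the next base triangle, and the region
at the endpoint `j + 1`; so the branch passes from one segment to the opposite one.) -/
def next : Equiv.Perm (Segment M) where
  toFun σ := (across σ.1 (σ.2 + 2), σ.2 + 1)
  invFun σ := (across σ.1 (σ.2 + 1), σ.2 + 2)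
  left_inv := by
    rintro ⟨h, j⟩
    have hs := M.toCoxeterSystem.simple_mul_simple_cancel_right (w := h) (j + 2)
    rw [M.toCoxeterSystem_simple] at hs
    have h1 : j + 1 + 1 = j + 2 := by rw [add_assoc]; rfl
    have h2 : j + 1 + 2 = j := by rw [add_assoc]; simp [show (1 : Fin 3) + 2 = 0 from rfl]
    simp only [across, h1, h2, hs]
  right_inv := by
    rintro ⟨h, j⟩
    have hs := M.toCoxeterSystem.simple_mul_simple_cancel_right (w := h) (j + 1)
    rw [M.toCoxeterSystem_simple] at hs
    have h1 : j + 2 + 2 = j + 1 := by rw [add_assoc]; rfl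
    have h2 : j + 2 + 1 = j := by rw [add_assoc]; simp [show (2 : Fin 3) + 1 = 0 from rfl]
    simp only [across, h1, h2, hs]

/-- A Seidel Lagrangian in `E` is a branch of `L_E`, given here as the set of its segments. -/
def IsSeidelLagrangian (L : Set (Segment M)) : Prop :=
  ∃ σ : Segment M, L = {τ | (next M).SameCycle σ τ}

variable {M}

open Classical in
/-- The region immediately on the left of a segment of `L_E`. -/
noncomputable def leftRegion (σ : Segment M) : Region M :=
  if IsWhite σ.1 then Region.middle σ.1 else cornerOf σ.1 σ.2

/-- The left side of `L`, as a set of regions: all the regions that can be reached from the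
regions immediately on the left of `L` without crossing `L`. -/
def leftSide (L : Set (Segment M)) : Set (Region M) :=
  {r | ∃ σ ∈ L,
    Relation.ReflTransGen (fun p q => ∃ τ : Segment M, τ ∉ L ∧ Separates τ p q) (leftRegion σ) r}

/-- A set of regions is connected through segments of `L_E`. -/
def IsConnected (S : Set (Region M)) : Prop :=
  ∀ r ∈ S, ∀ s ∈ S, Relation.ReflTransGen
    (fun p q => p ∈ S ∧ q ∈ S ∧ ∃ σ : Segment M, Separates σ p q) r s

/-- The shape of a union `U` of regions at the midpoint of the side opposite to the vertex `i` of
a white base triangle `h`.  The four regions at this point are, in cyclic order, the middle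
triangle of `h`, the region at one endpoint of the side, the middle triangle of the adjacent black
triangle, and the region at the other endpoint.  The point may be interior to `U` or outside `U`;
`∂U` may follow one branch of `L_E` without turning (two neighboring regions belong to `U`); or
`U` has a convex corner there that is mapped to the immersed generator of odd degree and whose two
sides are oriented as `L_E` (the middle triangle of the white base triangle `h` alone). -/
def LocallyAdmissible (U : Set (Region M)) (h : M.Group) (i : Fin 3) : Prop :=
  let white := Region.middle h ∈ U
  let black := Region.middle (across h i) ∈ U
  let end₁ := cornerOf h (i + 1) ∈ U
  let end₂ := cornerOf h (i + 2) ∈ U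
  (white ∧ black ∧ end₁ ∧ end₂) ∨
  (¬ white ∧ ¬ black ∧ ¬ end₁ ∧ ¬ end₂) ∨
  (Xor white black ∧ Xor end₁ end₂) ∨
  (white ∧ ¬ black ∧ ¬ end₁ ∧ ¬ end₂)

/-- The polygons for the potential in `E`, that is, the `(a,b,c)`-diagrams: a polygon `U` bounded
by `L_E` is a union of regions and is recorded as the set of these regions, and its diagram, the
cellulation of `U` by the tessellation `Z`, has `U` as its underlying set.

A finite nonempty union of regions of the plane `E` whose boundary is a `1`-manifold
(`admissible`) is a closed disk if and only if it is connected with connected complement.  An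
embedded polygon with convex odd corners has Maslov index two. -/
structure IsDiagram (U : Set (Region M)) : Prop where
  finite : U.Finite
  nonempty : U.Nonempty
  connected : IsConnected U
  connected_compl : IsConnected Uᶜ
  admissible : ∀ h : M.Group, IsWhite h → ∀ i : Fin 3, LocallyAdmissible U h i

variable (M)

/-- The vertices of the hexagon tessellation `Z`: the centers of the middle triangles of the white
base triangles (white vertices), and the `A`-, `B`- and `C`-vertices. -/
inductive ZVertex : Type
  | white (h : M.Group) (hh : IsWhite h) : ZVertex
  | colored (j : Fin 3) (v : ColoredVertex M j) : ZVertex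

variable {M}

/-- The region that contains a given vertex of `Z` (in its interior). -/
def ZVertex.region : ZVertex M → Region M
  | .white h _ => Region.middle h
  | .colored j v => Region.corner j v

/-- The interior vertices of the diagram of `U`. -/
def interiorVertices (U : Set (Region M)) : Set (ZVertex M) := {v | v.region ∈ U}

/-- A basic diagram: a diagram with exactly one interior vertex. -/
def IsBasic (U : Set (Region M)) : Prop :=
  IsDiagram U ∧ ∃ v : ZVertex M, interiorVertices U = {v}

/-- `L` intersects the interior of `U`: some segment of `L` has both its sides in `U`. -/
def MeetsInterior (L : Set (Segment M)) (U : Set (Region M)) : Prop :=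
  ∃ σ ∈ L, Region.middle σ.1 ∈ U ∧ cornerOf σ.1 σ.2 ∈ U

/-- The diagram `X` is obtained from the diagram `X₀` by an elementary move along the Seidel
Lagrangian `L`. -/
def IsElementaryMoveAlong (L : Set (Segment M)) (X₀ X : Set (Region M)) : Prop :=
  IsDiagram X₀ ∧ IsDiagram X ∧ IsSeidelLagrangian M L ∧ MeetsInterior L X ∧
    X₀ = X ∩ leftSide L ∧ ¬ ∃ X' : Set (Region M), IsDiagram X' ∧ X₀ ⊂ X' ∧ X' ⊂ X

/-- The diagram `X` is obtained from the diagram `X₀` by an elementary move. -/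
def ElementaryMove (X₀ X : Set (Region M)) : Prop :=
  ∃ L : Set (Segment M), IsElementaryMoveAlong L X₀ X

end SeidelDiagram

/-!
# Diagrams in the universal cover of an orbifold sphere arise by elementary moves

Let `X` be a diagram which is not a single middle triangle, and let `Y` be a maximal one among the
diagrams properly contained in `X` (a white middle triangle in `X` is one of them, so `Y` exists).
Some boundary segment of `Y` is interior to `X`; let `L` be the branch of `L_E` through it. The
claim is that `Y` is the whole part of `X` on the left of `L`. Then `X` is obtained from `Y` by an
elementary move, and the theorem follows by induction on the number of regions
(`IsDiagram.exists_elementaryMove`, `IsDiagram.exists_reflTransGen`).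

*Branches.* The reflection representation of the Coxeter group provides linear functions on the
tessellation, given by their values at the vertices. Along the strip of base triangles that a
branch follows, the values at the crossing points satisfy a linear recurrence whose trace is at
least `2`, by the inequality `IsNonspherical.four_le` which expresses that the plane is not a
sphere. Hence a strip that has crossed a wall never returns (`IsNonspherical.strip_beyond_wall`),
so a branch has at most one segment in each base triangle, and two branches cross at most once,
except at the sides opposite to a vertex of cone order two (`IsNonspherical.coneOrder_eq_two`).

*Topology of the plane.* The relations of the Coxeter group say that the plane is simply
connected: a covering, given by fibers over the regions that are glued along the segments with
trivial monodromy at the crossings, has sections (`exists_section`). The double covering that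
changes sheets along a branch shows that the branch has two sides (`mem_leftOf`).

*A connected region lies on the left of the branches along its boundary*
(`LeftAdmissible.subset_leftOf`). Boundaries of diagrams have the orientation of `L_E`, for a
wrongly oriented boundary could never turn and would be infinite (`IsDiagram.leftAdmissible`). At
a corner `p` of such a region `Y`, the straight continuation of one edge and the next edge bound
together a part `Q p` of the plane. Gluing `Y` and all the `Q p` along the edges and their
continuations yields a covering of the plane in which `Y` is embedded. By simple connectedness it
has a section that extends `Y`, and this section sends the continuation of an edge to some `Q p`,
so the continuation never meets `Y` again (`LeftAdmissible.left_beyond_corner`).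

*Cutting.* The components of the left part of a diagram, cut along any branch, are
diagrams (`IsDiagram.component`). In the situation above `Y` lies on the left of `L` by the
previous paragraph, so by maximality it is a component of the left part of `X`. If there were other components, then `L`
would leave `X` and come back (`IsDiagram.exists_reentry`), and it would cross twice the branch
`N` along the boundary of `X` where it leaves. Then the crossing lies on a side opposite to a
vertex of cone order two, and `L` and `N` bound a chain of bigons. `Y` is contained in one of
them, and a branch that crosses `N` along the neighboring bigon cuts off from `X` a
diagram which contains `Y` properly (`IsDiagram.exists_between`). This contradicts the maximality
of `Y`.
-/

namespace SeidelDiagram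

/-! ### The cone orders and the reflection representation -/

/-- The order of the cone point labelled `i`, so that the base triangle has angle
`π / coneOrder M i` at its vertex `i`. -/
def coneOrder (M : CoxeterMatrix (Fin 3)) (i : Fin 3) : ℕ := M (i + 1) (i + 2)

/-- The tessellation by base triangles lives in the Euclidean or the hyperbolic plane. -/
structure IsNonspherical (M : CoxeterMatrix (Fin 3)) : Prop where
  two_le : ∀ i, 2 ≤ coneOrder M i
  sum_le : (1 : ℚ) / coneOrder M 0 + 1 / coneOrder M 1 + 1 / coneOrder M 2 ≤ 1

/-- The weight `2 cos (π / a)` of a vertex of cone order `a`. -/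
noncomputable def cosWeight (M : CoxeterMatrix (Fin 3)) (i : Fin 3) : ℝ :=
  2 * Real.cos (Real.pi / coneOrder M i)

/-- The values of a linear function at the vertices of a base triangle determine its values at the
vertices of the adjacent triangles: only the value at the vertex `i` changes across the side
opposite to `i`. -/
def reflect (t : Fin 3 → ℝ) (i : Fin 3) (v : Fin 3 → ℝ) : Fin 3 → ℝ :=
  Function.update v i (-v i + t (i + 2) * v (i + 1) + t (i + 1) * v (i + 2))

lemma reflect_same (t : Fin 3 → ℝ) (i : Fin 3) (v : Fin 3 → ℝ) :
    reflect t i v i = -v i + t (i + 2) * v (i + 1) + t (i + 1) * v (i + 2) := by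
  simp [reflect]

lemma reflect_of_ne (t : Fin 3 → ℝ) {i j : Fin 3} (hij : j ≠ i) (v : Fin 3 → ℝ) :
    reflect t i v j = v j := by
  simp [reflect, hij]

lemma reflect_eq (t : Fin 3 → ℝ) {i j k : Fin 3} (hij : i ≠ j) (hik : i ≠ k) (hjk : j ≠ k)
    (v : Fin 3 → ℝ) : reflect t i v i = -v i + t k * v j + t j * v k := by
  rw [reflect_same]
  have : (j = i + 1 ∧ k = i + 2) ∨ (j = i + 2 ∧ k = i + 1) := by
    revert i j k; decide
  obtain ⟨rfl, rfl⟩ | ⟨rfl, rfl⟩ := this <;> ring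

/-- The product of two affine reflections of the plane whose axes meet at the angle `π / m` has
order `m`. -/
lemma iterate_dihedral {m : ℕ} (hm : 2 ≤ m) {k : ℝ} (hk : k = 2 * Real.cos (Real.pi / m))
    (d e : ℝ) (f : ℝ × ℝ → ℝ × ℝ)
    (hf : ∀ x y, f (x, y) = (-x + k * (-y + k * x + e) + d, -y + k * x + e)) (q : ℝ × ℝ) :
    f^[m] q = q := by
  set θ := Real.pi / m with hθ
  have hm0 : (0 : ℝ) < m := by positivity
  have hmθ : m * θ = Real.pi := by rw [hθ]; field_simp
  have hs : 0 < Real.sin θ := by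
    apply Real.sin_pos_of_pos_of_lt_pi
    · positivity
    · rw [hθ, div_lt_iff₀ hm0]
      have : (2 : ℝ) ≤ m := by exact_mod_cast hm
      nlinarith [Real.pi_pos]
  have hsc : Real.cos θ ^ 2 = 1 - Real.sin θ ^ 2 := by
    linarith [Real.sin_sq_add_cos_sq θ]
  set S := Real.sin θ with hS
  set C := Real.cos θ with hC
  -- the common fixed point of the two reflections
  set x₀ := (d + C * e) / (2 * S ^ 2) with hx₀
  set y₀ := (e + C * d) / (2 * S ^ 2) with hy₀
  have hx : 2 * S ^ 2 * x₀ = d + C * e := by rw [hx₀]; field_simp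
  have hy : 2 * S ^ 2 * y₀ = e + C * d := by rw [hy₀]; field_simp
  have fix1 : 2 * x₀ = 2 * C * y₀ + d := by
    have : S ^ 2 * (2 * x₀) = S ^ 2 * (2 * C * y₀ + d) := by
      linear_combination hx - C * hy - d * hsc
    exact mul_left_cancel₀ (by positivity) this
  have fix2 : 2 * y₀ = 2 * C * x₀ + e := by
    have : S ^ 2 * (2 * y₀) = S ^ 2 * (2 * C * x₀ + e) := by
      linear_combination hy - C * hx - e * hsc
    exact mul_left_cancel₀ (by positivity) this
  obtain ⟨x, y⟩ := q
  have key : ∀ n : ℕ,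
      S * ((f^[n] (x, y)).1 - x₀) =
          (x - x₀) * Real.sin ((2 * n + 1) * θ) - (y - y₀) * Real.sin (2 * n * θ) ∧
      S * ((f^[n] (x, y)).2 - y₀) =
          (x - x₀) * Real.sin (2 * n * θ) - (y - y₀) * Real.sin ((2 * n - 1) * θ) := by
    have rec_sin : ∀ z : ℝ, Real.sin (z + θ) = 2 * C * Real.sin z - Real.sin (z - θ) := by
      intro z; rw [Real.sin_add, Real.sin_sub]; ring
    intro n
    induction n with
    | zero =>
      constructor
      · simp [hS]; ring
      · have : ((2 : ℝ) * (0 : ℕ) - 1) * θ = -θ := by push_cast; ring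
        rw [this, Real.sin_neg]; simp [hS]; ring
    | succ n ih =>
      obtain ⟨h1, h2⟩ := ih
      rw [Function.iterate_succ_apply']
      generalize f^[n] (x, y) = q at h1 h2 ⊢
      obtain ⟨X, Y⟩ := q
      rw [hf]
      simp only at h1 h2 ⊢
      have e1 := rec_sin (2 * n * θ)
      have e2 := rec_sin ((2 * n + 1) * θ)
      have e3 := rec_sin ((2 * n + 2) * θ)
      rw [show 2 * (n : ℝ) * θ + θ = (2 * n + 1) * θ by ring,
        show 2 * (n : ℝ) * θ - θ = (2 * n - 1) * θ by ring] at e1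
      rw [show (2 * (n : ℝ) + 1) * θ + θ = (2 * n + 2) * θ by ring,
        show (2 * (n : ℝ) + 1) * θ - θ = 2 * n * θ by ring] at e2
      rw [show (2 * (n : ℝ) + 2) * θ + θ = (2 * n + 3) * θ by ring,
        show (2 * (n : ℝ) + 2) * θ - θ = (2 * n + 1) * θ by ring] at e3
      push_cast
      rw [show (2 * ((n : ℝ) + 1) + 1) * θ = (2 * n + 3) * θ by ring,
        show (2 * ((n : ℝ) + 1)) * θ = (2 * n + 2) * θ by ring,
        show (2 * ((n : ℝ) + 1) - 1) * θ = (2 * n + 1) * θ by ring]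
      have hy' : S * (-Y + k * X + e - y₀) = (x - x₀) * Real.sin ((2 * n + 2) * θ)
          - (y - y₀) * Real.sin ((2 * n + 1) * θ) := by
        rw [hk]
        linear_combination 2 * C * h1 - h2 - (x - x₀) * e2 + (y - y₀) * e1 - S * fix2
      refine ⟨?_, hy'⟩
      rw [hk] at hy' ⊢
      linear_combination 2 * C * hy' - h1 - (x - x₀) * e3 + (y - y₀) * e2 - S * fix1
  obtain ⟨h1, h2⟩ := key m
  have s1 : Real.sin ((2 * m + 1) * θ) = S := by
    rw [show (2 * (m : ℝ) + 1) * θ = θ + 2 * (m * θ) by ring, hmθ, Real.sin_add_two_pi]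
  have s2 : Real.sin (2 * m * θ) = 0 := by
    rw [show 2 * (m : ℝ) * θ = 2 * (m * θ) by ring, hmθ, Real.sin_two_pi]
  have s3 : Real.sin ((2 * m - 1) * θ) = -S := by
    rw [show (2 * (m : ℝ) - 1) * θ = -θ + 2 * (m * θ) by ring, hmθ, Real.sin_add_two_pi,
      Real.sin_neg]
  rw [s1, s2] at h1
  rw [s2, s3] at h2
  ext
  · have := mul_left_cancel₀ hs.ne' (h1.trans (by ring : _ = S * (x - x₀)))
    simpa using this
  · have := mul_left_cancel₀ hs.ne' (h2.trans (by ring : _ = S * (y - y₀)))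
    simpa using this

variable {M : CoxeterMatrix (Fin 3)}

lemma IsNonspherical.iterate_reflect (hM : IsNonspherical M) (i j : Fin 3) (hij : i ≠ j)
    (v : Fin 3 → ℝ) :
    (reflect (cosWeight M) i ∘ reflect (cosWeight M) j)^[M i j] v = v := by
  obtain ⟨k, hki, hkj⟩ : ∃ k : Fin 3, k ≠ i ∧ k ≠ j := by
    revert i j; decide
  have hall : ∀ l : Fin 3, l = i ∨ l = j ∨ l = k := by revert i j k; decide
  have hMij : M i j = coneOrder M k := by
    have : (i = k + 1 ∧ j = k + 2) ∨ (i = k + 2 ∧ j = k + 1) := by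
      clear hall
      revert i j k; decide
    obtain ⟨rfl, rfl⟩ | ⟨rfl, rfl⟩ := this
    · rfl
    · exact M.symmetric _ _
  set t := cosWeight M with ht
  set F := reflect t i ∘ reflect t j with hF
  let f : ℝ × ℝ → ℝ × ℝ := fun q =>
    (-q.1 + t k * (-q.2 + t k * q.1 + t i * v k) + t j * v k, -q.2 + t k * q.1 + t i * v k)
  have hstep : ∀ u : Fin 3 → ℝ, u k = v k →
      F u k = v k ∧ (F u i, F u j) = f (u i, u j) := by
    intro u hu
    have hj : reflect t j u j = -u j + t k * u i + t i * v k := by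
      rw [reflect_eq t hij.symm hkj.symm hki.symm, hu]
    have hi : reflect t j u i = u i := reflect_of_ne t hij u
    have hk : reflect t j u k = v k := by rw [reflect_of_ne t hkj, hu]
    refine ⟨by simp only [hF, Function.comp_apply]; rw [reflect_of_ne t hki, hk], ?_⟩
    simp only [hF, Function.comp_apply, f, Prod.mk.injEq]
    rw [reflect_eq t hij hki.symm hkj.symm, reflect_of_ne t hij.symm, hi, hj, hk]
    exact ⟨rfl, rfl⟩
  have hiter : ∀ n : ℕ, F^[n] v k = v k ∧ (F^[n] v i, F^[n] v j) = f^[n] (v i, v j) := by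
    intro n
    induction n with
    | zero => exact ⟨rfl, rfl⟩
    | succ n ih =>
      rw [Function.iterate_succ_apply', Function.iterate_succ_apply', ← ih.2]
      exact hstep _ ih.1
  have hfin := (hiter (M i j)).2
  rw [hMij, iterate_dihedral (hM.two_le k) rfl (t j * v k) (t i * v k) f (fun x y => rfl)] at hfin
  rw [Prod.mk.injEq] at hfin
  rw [hMij]
  funext l
  obtain rfl | rfl | rfl := hall l
  · exact hfin.1
  · exact hfin.2
  · exact (hiter _).1

/-- A linear function on the universal cover, given by its values at the three vertices of each
base triangle. -/
def IsLinear (Φ : M.Group → Fin 3 → ℝ) : Prop :=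
  ∀ h i, Φ (across h i) = reflect (cosWeight M) i (Φ h)

lemma across_across (h : M.Group) (i : Fin 3) : across (across h i) i = h := by
  have := M.toCoxeterSystem.simple_mul_simple_cancel_right (w := h) i
  rwa [M.toCoxeterSystem_simple] at this

/-- Every property that passes to adjacent base triangles holds for all base triangles once it holds
for one. -/
lemma across_induction {P : M.Group → Prop} (g : M.Group) (hg : P g)
    (hP : ∀ h i, P h → P (across h i)) (h : M.Group) : P h := by
  have key : ∀ w : M.Group, ∀ g, P g → P (g * w) := by
    intro w
    refine M.toCoxeterSystem.simple_induction (p := fun w => ∀ g, P g → P (g * w)) w ?_ ?_ ?_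
    · intro i g hg
      have := hP g i hg
      rwa [across, ← M.toCoxeterSystem_simple] at this
    · intro g hg; simpa using hg
    · intro w₁ w₂ h1 h2 g hg
      rw [← mul_assoc]
      exact h2 _ (h1 _ hg)
  have := key (g⁻¹ * h) g hg
  rwa [mul_inv_cancel_left] at this

/-- The universal property of the tessellation: commuting "moves across the sides", one for each
label and consistent around each vertex, extend to an equivariant family. -/
lemma exists_equivariant {α : Type*} (f : Fin 3 → α → α)
    (hf : ∀ i j v, (f i ∘ f j)^[M i j] v = v) (g : M.Group) (v : α) :
    ∃ Φ : M.Group → α, Φ g = v ∧ ∀ h i, Φ (across h i) = f i (Φ h) := by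
  let F : Fin 3 → Function.End α := f
  have hpow : ∀ (u : Function.End α) (n : ℕ), (u ^ n : Function.End α) = (u : α → α)^[n] := by
    intro u n
    induction n with
    | zero => rfl
    | succ n ih =>
      rw [pow_succ', ih]
      exact (Function.iterate_succ' (u : α → α) n).symm
  have hF : M.IsLiftable F := by
    intro i j
    funext x
    rw [hpow]
    exact hf i j x
  let R : M.Group →* Function.End α := M.toCoxeterSystem.lift ⟨F, hF⟩
  have hR : ∀ i, R (M.simple i) = F i := by
    intro i
    rw [← M.toCoxeterSystem_simple]
    exact M.toCoxeterSystem.lift_apply_simple hF i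
  refine ⟨fun h => (R (h⁻¹ * g) : α → α) v, ?_, ?_⟩
  · simp only [inv_mul_cancel, map_one]; rfl
  · intro h i
    have hs : (M.simple i)⁻¹ = M.simple i := by
      rw [← M.toCoxeterSystem_simple]; exact M.toCoxeterSystem.inv_simple i
    simp only [across, mul_inv_rev, hs, mul_assoc]
    rw [map_mul, hR]; rfl

lemma IsNonspherical.exists_isLinear (hM : IsNonspherical M) (g : M.Group) (v : Fin 3 → ℝ) :
    ∃ Φ : M.Group → Fin 3 → ℝ, IsLinear Φ ∧ Φ g = v := by
  obtain ⟨Φ, h1, h2⟩ := exists_equivariant (M := M) (reflect (cosWeight M)) (fun i j v => by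
    by_cases hij : i = j
    · subst hij
      rw [M.diagonal]
      funext l
      by_cases hl : l = i
      · subst hl
        simp only [Function.iterate_one, Function.comp_apply]
        rw [reflect_same, reflect_same, reflect_of_ne _ (by simp), reflect_of_ne _ (by simp)]
        ring
      · simp only [Function.iterate_one, Function.comp_apply]
        rw [reflect_of_ne _ hl, reflect_of_ne _ hl]
    · exact hM.iterate_reflect i j hij v) g v
  exact ⟨Φ, h2, h1⟩

lemma IsLinear.eq_zero {Φ : M.Group → Fin 3 → ℝ} (hΦ : IsLinear Φ) {h : M.Group} (h0 : Φ h = 0)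
    (g : M.Group) : Φ g = 0 := by
  refine across_induction (P := fun g => Φ g = 0) h h0 (fun g i hg => ?_) g
  rw [hΦ, hg]
  funext l
  by_cases hl : l = i
  · subst hl; simp [reflect_same]
  · simp [reflect_of_ne _ hl]

lemma IsLinear.neg {Φ : M.Group → Fin 3 → ℝ} (hΦ : IsLinear Φ) : IsLinear (fun h => -Φ h) := by
  intro h i
  dsimp only
  rw [hΦ]
  funext l
  by_cases hl : l = i
  · subst hl; simp [reflect_same]; ring
  · simp [reflect_of_ne _ hl]

/-! ### The trigonometric inequality -/

lemma cosWeight_nonneg {i : Fin 3} (hM : IsNonspherical M) : 0 ≤ cosWeight M i := by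
  have h2 : (2 : ℝ) ≤ coneOrder M i := by exact_mod_cast hM.two_le i
  have : Real.pi / coneOrder M i ≤ Real.pi / 2 :=
    div_le_div_of_nonneg_left Real.pi_pos.le (by norm_num) h2
  have h0 : 0 ≤ Real.pi / coneOrder M i := by positivity
  have := Real.cos_nonneg_of_mem_Icc (x := Real.pi / coneOrder M i)
    ⟨by linarith [Real.pi_pos], this⟩
  unfold cosWeight; linarith

lemma one_le_cosWeight {i : Fin 3} (hM : IsNonspherical M) (hi : coneOrder M i ≠ 2) :
    1 ≤ cosWeight M i := by
  have h3 : 3 ≤ coneOrder M i := by have := hM.two_le i; omega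
  have h3 : (3 : ℝ) ≤ coneOrder M i := by exact_mod_cast h3
  have h1 : Real.pi / coneOrder M i ≤ Real.pi / 3 :=
    div_le_div_of_nonneg_left Real.pi_pos.le (by norm_num) h3
  have h0 : 0 ≤ Real.pi / coneOrder M i := by positivity
  have := Real.cos_le_cos_of_nonneg_of_le_pi h0 (by linarith [Real.pi_pos]) h1
  rw [Real.cos_pi_div_three] at this
  unfold cosWeight; linarith

lemma IsNonspherical.sum_le' (hM : IsNonspherical M) (i j k : Fin 3) (hij : i ≠ j) (hik : i ≠ k)
    (hjk : j ≠ k) :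
    (1 : ℚ) / coneOrder M i + 1 / coneOrder M j + 1 / coneOrder M k ≤ 1 := by
  have := hM.sum_le
  fin_cases i <;> fin_cases j <;> fin_cases k <;> simp at hij hik hjk <;>
    simp at this ⊢ <;> linarith

/-- At most one cone point has order two. -/
lemma IsNonspherical.ne_two (hM : IsNonspherical M) {i j : Fin 3} (hij : i ≠ j)
    (hi : coneOrder M i = 2) : coneOrder M j ≠ 2 := by
  intro hj
  obtain ⟨k, hki, hkj⟩ : ∃ k : Fin 3, i ≠ k ∧ j ≠ k := by
    clear hi hj; revert i j; decide
  have h1 := hM.sum_le' i j k hij hki hkj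
  have hk : (0 : ℚ) < coneOrder M k := by
    have := hM.two_le k
    exact_mod_cast (by omega : 0 < coneOrder M k)
  have : (0 : ℚ) < 1 / coneOrder M k := by positivity
  rw [hi, hj] at h1
  norm_num at h1 this
  linarith

/-- The angle sum of a base triangle is at most `π`, in terms of the weights. -/
lemma IsNonspherical.four_le (hM : IsNonspherical M) {i j k : Fin 3} (hij : i ≠ j) (hik : i ≠ k)
    (hjk : j ≠ k) :
    4 ≤ cosWeight M i ^ 2 + cosWeight M j ^ 2 + cosWeight M k ^ 2 +
      cosWeight M i * cosWeight M j * cosWeight M k := by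
  have hsum := hM.sum_le' i j k hij hik hjk
  have hsum : (1 : ℝ) / coneOrder M i + 1 / coneOrder M j + 1 / coneOrder M k ≤ 1 := by
    have := (Rat.cast_le (K := ℝ)).2 hsum
    push_cast at this
    exact this
  have hpos : ∀ l, 0 ≤ Real.pi / coneOrder M l := fun l => by positivity
  have hle : ∀ l, Real.pi / coneOrder M l ≤ Real.pi / 2 := fun l => by
    have h2 : (2 : ℝ) ≤ coneOrder M l := by exact_mod_cast hM.two_le l
    exact div_le_div_of_nonneg_left Real.pi_pos.le (by norm_num) h2
  have hangle : Real.pi / coneOrder M i + Real.pi / coneOrder M j + Real.pi / coneOrder M k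
      ≤ Real.pi := by
    have := mul_le_mul_of_nonneg_left hsum Real.pi_pos.le
    calc _ = Real.pi * (1 / coneOrder M i + 1 / coneOrder M j + 1 / coneOrder M k) := by ring
      _ ≤ _ := by simpa using this
  unfold cosWeight
  set α := Real.pi / coneOrder M i
  set β := Real.pi / coneOrder M j
  set γ := Real.pi / coneOrder M k
  have h1 : -Real.cos (α + β) ≤ Real.cos γ := by
    rw [← Real.cos_pi_sub]
    exact Real.cos_le_cos_of_nonneg_of_le_pi (hpos k) (by linarith [hpos i, hpos j]) (by linarith)
  have h2 : 0 ≤ Real.cos (α - β) := by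
    apply Real.cos_nonneg_of_mem_Icc
    constructor <;> linarith [hpos i, hpos j, hle i, hle j]
  have hc : 0 ≤ Real.cos γ := by
    apply Real.cos_nonneg_of_mem_Icc
    constructor <;> linarith [hpos k, hle k, Real.pi_pos]
  rw [Real.cos_add] at h1
  rw [Real.cos_sub] at h2
  have sα := Real.sin_sq_add_cos_sq α
  have sβ := Real.sin_sq_add_cos_sq β
  set a := Real.cos α
  set b := Real.cos β
  set c := Real.cos γ
  set x := Real.sin α
  set y := Real.sin β
  -- the difference is the product of two nonnegative factors, the first of which vanishes if the
  -- angle sum is exactly `π`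
  have key : 0 ≤ (c + (a * b - x * y)) * (c - (a * b - x * y) + 2 * (a * b)) :=
    mul_nonneg (by linarith) (by linarith)
  nlinarith [key, sα, sβ]

/-! ### Sequences of values along a strip of base triangles -/

/-- A solution of `x (k + 2) = τ x (k + 1) - x k` with `τ ≥ 2` that starts nonnegative and
nondecreasing stays so. -/
lemma nonneg_and_le_of_recurrence {x : ℕ → ℝ} {τ : ℝ} (hτ : 2 ≤ τ)
    (hx : ∀ k, x (k + 2) = τ * x (k + 1) - x k) (h0 : 0 ≤ x 0) (h1 : x 0 ≤ x 1) (k : ℕ) :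
    0 ≤ x k ∧ x k ≤ x (k + 1) := by
  induction k with
  | zero => exact ⟨h0, h1⟩
  | succ k ih =>
    refine ⟨ih.1.trans ih.2, ?_⟩
    rw [hx k]
    nlinarith [ih.1, ih.2]

/-- `y n` are the values of a linear function at the consecutive vertices of a strip of base
triangles, the vertices having the weights `θ n`, and `D n` is its value at the point where a
branch of `L_E` that follows the strip crosses the edge between the vertices `n` and `n + 1`. -/
structure IsStrip (θ y D : ℕ → ℝ) : Prop where
  periodic : ∀ n, θ (n + 3) = θ n
  vertex : ∀ n, y (n + 3) = -y n + θ (n + 2) * y (n + 1) + θ (n + 1) * y (n + 2)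
  edge : ∀ n, D n = θ (n + 1) * y n + θ n * y (n + 1)

/-- The translation along the strip acts on the values at the crossing points through a unimodular
matrix with a trace `≥ 2`. -/
lemma IsStrip.recurrence {θ y D : ℕ → ℝ} (hS : IsStrip θ y D) (n : ℕ) :
    D (n + 6) = (θ 0 ^ 2 + θ 1 ^ 2 + θ 2 ^ 2 + θ 0 * θ 1 * θ 2 - 2) * D (n + 3) - D n := by
  obtain ⟨hθ, hy, hD⟩ := hS
  have hinv : ∀ n, θ n ^ 2 + θ (n + 1) ^ 2 + θ (n + 2) ^ 2 + θ n * θ (n + 1) * θ (n + 2) =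
      θ 0 ^ 2 + θ 1 ^ 2 + θ 2 ^ 2 + θ 0 * θ 1 * θ 2 := by
    intro n
    induction n with
    | zero => rfl
    | succ n ih =>
      rw [← ih, show n + 1 + 1 = n + 2 by rfl, show n + 1 + 2 = n + 3 by rfl, hθ]
      ring
  rw [← hinv n]
  have t4 : θ (n + 4) = θ (n + 1) := hθ (n + 1)
  have t5 : θ (n + 5) = θ (n + 2) := hθ (n + 2)
  have t6 : θ (n + 6) = θ n := by rw [← hθ n]; exact hθ (n + 3)
  have t7 : θ (n + 7) = θ (n + 1) := by rw [← t4]; exact hθ (n + 4)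
  have y3 := hy n
  have y4 : y (n + 4) = -y (n + 1) + θ n * y (n + 2) + θ (n + 2) * y (n + 3) := by
    rw [← hθ n]; exact hy (n + 1)
  have y5 : y (n + 5) = -y (n + 2) + θ (n + 1) * y (n + 3) + θ n * y (n + 4) := by
    rw [← hθ n, ← t4]; exact hy (n + 2)
  have y6 : y (n + 6) = -y (n + 3) + θ (n + 2) * y (n + 4) + θ (n + 1) * y (n + 5) := by
    rw [← t4, ← t5]; exact hy (n + 3)
  have y7 : y (n + 7) = -y (n + 4) + θ n * y (n + 5) + θ (n + 2) * y (n + 6) := by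
    rw [← t6, ← t5]; exact hy (n + 4)
  have d6 : D (n + 6) = θ (n + 1) * y (n + 6) + θ n * y (n + 7) := by
    rw [← t7, ← t6]; exact hD (n + 6)
  have d3 : D (n + 3) = θ (n + 1) * y (n + 3) + θ n * y (n + 4) := by
    rw [← t4, ← hθ n]; exact hD (n + 3)
  rw [d6, d3, hD n, y7, y6, y5, y4, y3]
  ring

/-- A wall crossed by a strip between its first two triangles is never crossed again. -/
lemma IsStrip.nonneg {θ y D : ℕ → ℝ} (hS : IsStrip θ y D) (h0 : 0 ≤ θ 0) (h1 : 0 ≤ θ 1)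
    (h2 : 0 ≤ θ 2) (h12 : 1 ≤ θ 1 ∨ 1 ≤ θ 2)
    (h4 : 4 ≤ θ 0 ^ 2 + θ 1 ^ 2 + θ 2 ^ 2 + θ 0 * θ 1 * θ 2)
    (y0 : y 0 = -1) (y1 : y 1 = 0) (y2 : y 2 = 0) (n : ℕ) : 0 ≤ y (n + 1) := by
  set τ := θ 0 ^ 2 + θ 1 ^ 2 + θ 2 ^ 2 + θ 0 * θ 1 * θ 2 - 2 with hτ
  have hτ2 : 2 ≤ τ := by linarith
  have hrec : ∀ n, D (n + 6) = τ * D (n + 3) - D n := hS.recurrence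
  obtain ⟨hθ, hy, hD⟩ := hS
  have t3 : θ 3 = θ 0 := hθ 0
  have t4 : θ 4 = θ 1 := hθ 1
  have t5 : θ 5 = θ 2 := hθ 2
  have m01 := mul_nonneg h0 h1
  have m02 := mul_nonneg h0 h2
  have m12 := mul_nonneg h1 h2
  have m012 := mul_nonneg m01 h2
  have y3 : y 3 = 1 := by rw [hy 0]; simp [y0, y1, y2]
  have y4 : y 4 = θ 2 := by rw [hy 1]; simp [y1, y2, y3]
  have y5 : y 5 = θ 1 + θ 0 * θ 2 := by rw [hy 2]; simp [y2, y3, y4, t3, t4]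
  have y6 : y 6 = -1 + θ 2 ^ 2 + θ 1 ^ 2 + θ 0 * θ 1 * θ 2 := by
    rw [hy 3]; simp [y3, y4, y5, t4, t5]; ring
  have d0 : D 0 = -θ 1 := by rw [hD]; simp [y0, y1]
  have d1 : D 1 = 0 := by rw [hD]; simp [y1, y2]
  have d2 : D 2 = θ 2 := by rw [hD]; simp [y2, y3]
  have d3 : D 3 = θ 1 + θ 0 * θ 2 := by rw [hD]; simp [y3, y4, t3, t4]
  have d4 : D 4 = θ 2 ^ 2 + θ 1 ^ 2 + θ 0 * θ 1 * θ 2 := by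
    rw [hD]; simp [y4, y5, t4, t5]; ring
  have d5 : D 5 = θ 0 * (y 5) + θ 2 * (y 6) := by
    rw [hD]; simp only [show 5 + 1 = 6 from rfl, show θ 6 = θ 0 by rw [← t3]; exact hθ 3, t5]
  have d6 : D 6 = τ * D 3 - D 0 := hrec 0
  have hmono : ∀ n, 1 ≤ n → 0 ≤ D n ∧ D n ≤ D (n + 3) := by
    have key : ∀ r, 0 ≤ D r → D r ≤ D (r + 3) → ∀ k, 0 ≤ D (r + 3 * k) ∧
        D (r + 3 * k) ≤ D (r + 3 * (k + 1)) := by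
      intro r hr0 hr1 k
      exact nonneg_and_le_of_recurrence (x := fun k => D (r + 3 * k)) hτ2
        (fun k => hrec (r + 3 * k)) hr0 hr1 k
    have k1 := key 1 (by rw [d1]) (by rw [d1]; change 0 ≤ D 4; rw [d4]; positivity)
    have k2 := key 2 (by rw [d2]; exact h2) (by
      change D 2 ≤ D 5
      rw [d5, d2, y5, y6]
      nlinarith [mul_nonneg h2 (by linarith : 0 ≤ τ - 2), mul_nonneg m02 h0])
    have k3 := key 3 (by rw [d3]; positivity) (by
      change D 3 ≤ D 6
      rw [d6, d3, d0]
      nlinarith [mul_nonneg (add_nonneg h1 m02) (by linarith : 0 ≤ τ - 2)])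
    intro n hn
    obtain ⟨k, rfl | rfl | rfl⟩ : ∃ k, n = 1 + 3 * k ∨ n = 2 + 3 * k ∨ n = 3 + 3 * k :=
      ⟨(n - 1) / 3, by omega⟩
    · exact k1 k
    · exact k2 k
    · exact k3 k
  have hy6 : ∀ n, 1 ≤ n → y n ≤ y (n + 6) := by
    intro n hn
    have e1 : y (n + 3) = -y n + D (n + 1) := by rw [hy, hD]; ring
    have e2 : y (n + 6) = -y (n + 3) + D (n + 4) := by
      rw [hD]; have := hy (n + 3); rw [this]; ring
    have := (hmono (n + 1) (by omega)).2
    rw [e2, e1]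
    linarith
  have base : ∀ n, 1 ≤ n → n ≤ 6 → 0 ≤ y n := by
    intro n hn1 hn2
    interval_cases n
    · rw [y1]
    · rw [y2]
    · rw [y3]; norm_num
    · rw [y4]; exact h2
    · rw [y5]; positivity
    · rw [y6]
      rcases h12 with h | h
      · have : 1 ≤ θ 1 ^ 2 := one_le_pow₀ h
        linarith [sq_nonneg (θ 2)]
      · have : 1 ≤ θ 2 ^ 2 := one_le_pow₀ h
        linarith [sq_nonneg (θ 1)]
  induction n using Nat.strong_induction_on with
  | _ n ih =>
    by_cases hn : n < 6
    · exact base (n + 1) (by omega) (by omega)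
    · obtain ⟨m, rfl⟩ : ∃ m, n = m + 6 := ⟨n - 6, by omega⟩
      exact (ih m (by omega)).trans (hy6 (m + 1) (by omega))

/-- The linear function of the line which crosses a strip at its first edge does not vanish at
the crossing points of the strip after the second one. -/
lemma IsStrip.neg {θ y D : ℕ → ℝ} (hS : IsStrip θ y D) (h0 : 0 < θ 0) (h1 : 0 ≤ θ 1)
    (h2 : 0 ≤ θ 2) (h12 : 0 < θ 1 ∨ 0 < θ 2)
    (h4 : 4 ≤ θ 0 ^ 2 + θ 1 ^ 2 + θ 2 ^ 2 + θ 0 * θ 1 * θ 2)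
    (y0 : y 0 = θ 0) (y1 : y 1 = θ 1) (y2 : y 2 = -θ 2) (n : ℕ) : D (n + 3) < 0 := by
  set τ := θ 0 ^ 2 + θ 1 ^ 2 + θ 2 ^ 2 + θ 0 * θ 1 * θ 2 - 2 with hτ
  have hτ2 : 2 ≤ τ := by linarith
  have hrec : ∀ n, D (n + 6) = τ * D (n + 3) - D n := hS.recurrence
  obtain ⟨hθ, hy, hD⟩ := hS
  have t3 : θ 3 = θ 0 := hθ 0
  have t4 : θ 4 = θ 1 := hθ 1
  have t5 : θ 5 = θ 2 := hθ 2
  have m01 := mul_nonneg h0.le h1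
  have m02 := mul_nonneg h0.le h2
  have m012 := mul_nonneg m01 h2
  have y3 : y 3 = -θ 0 := by rw [hy 0]; simp [y0, y1, y2]; ring
  have y4 : y 4 = -θ 1 - 2 * (θ 0 * θ 2) := by rw [hy 1]; simp [y1, y2, y3, t3]; ring
  have y5 : y 5 = θ 2 - 2 * (θ 0 * θ 1) - 2 * θ 0 ^ 2 * θ 2 := by
    rw [hy 2]; simp [y2, y3, y4, t3, t4]; ring
  have y6 : y 6 = -y 3 + θ 2 * y 4 + θ 1 * y 5 := by rw [hy 3]; simp [t4, t5]
  have d0 : D 0 = 2 * (θ 0 * θ 1) := by rw [hD]; simp [y0, y1]; ring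
  have d1 : D 1 = 0 := by rw [hD]; simp [y1, y2]; ring
  have d2 : D 2 = -2 * (θ 0 * θ 2) := by rw [hD]; simp [y2, y3, t3]; ring
  have d3 : D 3 = -2 * (θ 0 * (θ 1 + θ 0 * θ 2)) := by rw [hD]; simp [y3, y4, t3, t4]; ring
  have d4 : D 4 = -2 * (θ 0 * (θ 1 ^ 2 + θ 2 ^ 2 + θ 0 * θ 1 * θ 2)) := by
    rw [hD]; simp [y4, y5, t4, t5]; ring
  have d5 : D 5 = τ * D 2 - 2 * (θ 0 * (θ 2 + θ 0 * θ 1)) := by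
    rw [hD, d2]
    simp only [show 5 + 1 = 6 from rfl, show θ 6 = θ 0 by rw [← t3]; exact hθ 3, t5, y6, y5, y4, y3]
    rw [hτ]; ring
  have s1 : 0 < θ 1 + θ 0 * θ 2 := by
    rcases h12 with h | h
    · positivity
    · have := mul_pos h0 h; linarith
  have s2 : 0 < θ 2 + θ 0 * θ 1 := by
    rcases h12 with h | h
    · have := mul_pos h0 h; linarith
    · positivity
  have s3 : 0 < θ 1 ^ 2 + θ 2 ^ 2 + θ 0 * θ 1 * θ 2 := by
    rcases h12 with h | h <;> positivity
  have p1 := mul_pos h0 s1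
  have p2 := mul_pos h0 s2
  have p3 := mul_pos h0 s3
  have key : ∀ r, D r ≤ 0 → D (r + 3) < 0 → D (r + 3) ≤ D r → ∀ k, D (r + 3 * (k + 1)) < 0 := by
    intro r hr0 hr1 hr2 k
    have := nonneg_and_le_of_recurrence (x := fun k => -D (r + 3 * (k + 1))) hτ2
      (fun k => by
        have := hrec (r + 3 * (k + 1))
        change -D (r + 3 * (k + 1) + 6) = τ * -D (r + 3 * (k + 1) + 3) - -D (r + 3 * (k + 1))
        linarith) (by change 0 ≤ -D (r + 3); linarith)
        (by
          change -D (r + 3) ≤ -D (r + 6)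
          rw [hrec]
          linarith [mul_nonneg (by linarith : 0 ≤ τ - 2) (by linarith : 0 ≤ -D (r + 3))])
    have hk : ∀ k, D (r + 3 * (k + 1)) ≤ D (r + 3) := by
      intro k
      induction k with
      | zero => exact le_rfl
      | succ k ih => have := (this k).2; linarith
    exact (hk k).trans_lt hr1
  have d6 : D 6 = τ * D 3 - D 0 := hrec 0
  have k1 := key 1 d1.le (by change D 4 < 0; rw [d4]; linarith)
    (by change D 4 ≤ D 1; rw [d4, d1]; linarith)
  have hD2 : D 2 ≤ 0 := by rw [d2]; linarith
  have hD5 : D 5 < D 2 := by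
    rw [d5]
    linarith [mul_nonneg (by linarith : 0 ≤ τ - 1) (by linarith : 0 ≤ -D 2)]
  have k2 := key 2 hD2 (by change D 5 < 0; linarith) hD5.le
  have hD3 : D 3 < 0 := by rw [d3]; linarith
  have hD6 : D 6 < D 3 := by
    rw [d6, d0]
    linarith [mul_pos (by linarith : 0 < τ - 1) (by linarith : 0 < -D 3)]
  have k3 := key 3 hD3.le (by change D 6 < 0; linarith) hD6.le
  obtain ⟨k, hk | hk | hk⟩ : ∃ k, n + 3 = 1 + 3 * (k + 1) ∨ n + 3 = 2 + 3 * (k + 1) ∨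
      n + 3 = 3 * (k + 1) := ⟨n / 3, by omega⟩
  · rw [hk]; exact k1 k
  · rw [hk]; exact k2 k
  · rw [hk]
    rcases k with _ | k
    · exact hD3
    · rw [show 3 * (k + 1 + 1) = 3 + 3 * (k + 1) by ring]; exact k3 k

/-! ### Arithmetic of the labels -/

lemma eq_one_or_two {e : Fin 3} (he : e ≠ 0) : e = 1 ∨ e = 2 := by revert e; decide

lemma sub_ne {e : Fin 3} (he : e ≠ 0) (j : Fin 3) : j - e ≠ j := by revert e j; decide

lemma add_ne {e : Fin 3} (he : e ≠ 0) (j : Fin 3) : j + e ≠ j := by revert e j; decide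

lemma add_ne_sub {e : Fin 3} (he : e ≠ 0) (j : Fin 3) : j + e ≠ j - e := by revert e j; decide

lemma add_add_self (e j : Fin 3) : j + e + e = j - e := by revert e j; decide

lemma sub_sub_self' (e j : Fin 3) : j - e - e = j + e := by revert e j; decide

lemma eq_of_ne_zero {e : Fin 3} (he : e ≠ 0) (j l : Fin 3) : l = j - e ∨ l = j ∨ l = j + e := by
  revert e j l; decide

lemma eq_add_one_or_two {j k : Fin 3} (h : k ≠ j) : k = j + 1 ∨ k = j + 2 := by
  revert j k; decide

lemma add_one_add_one (i : Fin 3) : i + 1 + 1 = i + 2 := by revert i; decide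

/-! ### Following the branches of `L_E` in both directions -/

/-- Follow `L_E` by one segment without turning, forwards for `e = 1` and backwards for `e = 2`. -/
def step (e : Fin 3) (σ : Segment M) : Segment M := (across σ.1 (σ.2 - e), σ.2 + e)

lemma next_apply (σ : Segment M) : next M σ = step 1 σ := by
  obtain ⟨h, j⟩ := σ
  have : j + 2 = j - 1 := by revert j; decide
  change (across h (j + 2), j + 1) = (across h (j - 1), j + 1)
  rw [this]

lemma next_symm_apply (σ : Segment M) : (next M).symm σ = step 2 σ := by
  obtain ⟨h, j⟩ := σ
  have : j + 1 = j - 2 := by revert j; decide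
  change (across h (j + 1), j + 2) = (across h (j - 2), j + 2)
  rw [this]

lemma step_neg_step (e : Fin 3) (σ : Segment M) : step (-e) (step e σ) = σ := by
  obtain ⟨h, j⟩ := σ
  have h1 : j + e - -e = j - e := by revert j e; decide
  have h2 : j + e + -e = j := by revert j e; decide
  simp only [step, h1, h2, across_across]

lemma step_injective (e : Fin 3) : Function.Injective (step (M := M) e) :=
  Function.LeftInverse.injective (step_neg_step e)

lemma iterate_step_neg (e : Fin 3) (n : ℕ) (σ : Segment M) :
    (step (-e))^[n] ((step e)^[n] σ) = σ :=
  Function.LeftInverse.iterate (step_neg_step e) n σ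

/-- The segments `σ` and `τ` lie on the same branch of `L_E`. -/
def SameBranch (σ τ : Segment M) : Prop := (next M).SameCycle σ τ

lemma SameBranch.refl (σ : Segment M) : SameBranch σ σ := Equiv.Perm.SameCycle.refl _ _

lemma SameBranch.symm {σ τ : Segment M} (h : SameBranch σ τ) : SameBranch τ σ :=
  Equiv.Perm.SameCycle.symm h

lemma SameBranch.trans {σ τ ρ : Segment M} (h : SameBranch σ τ) (h' : SameBranch τ ρ) :
    SameBranch σ ρ := Equiv.Perm.SameCycle.trans h h'

lemma sameBranch_step {e : Fin 3} (he : e ≠ 0) (σ : Segment M) : SameBranch σ (step e σ) := by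
  obtain rfl | rfl := eq_one_or_two he
  · rw [← next_apply]
    exact Equiv.Perm.sameCycle_apply_right.2 (SameBranch.refl σ)
  · rw [← next_symm_apply]
    exact Equiv.Perm.sameCycle_symm_apply_right.2 (SameBranch.refl σ)

lemma sameBranch_iterate {e : Fin 3} (he : e ≠ 0) (n : ℕ) (σ : Segment M) :
    SameBranch σ ((step e)^[n] σ) := by
  induction n with
  | zero => exact SameBranch.refl σ
  | succ n ih =>
    rw [Function.iterate_succ_apply']
    exact ih.trans (sameBranch_step he _)

lemma SameBranch.exists_iterate {σ τ : Segment M} (h : SameBranch σ τ) :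
    ∃ e : Fin 3, e ≠ 0 ∧ ∃ n : ℕ, (step e)^[n] σ = τ := by
  obtain ⟨k, hk⟩ := h
  have hfun1 : (next M : Segment M → Segment M) = step 1 := funext next_apply
  have hfun2 : ((next M).symm : Segment M → Segment M) = step 2 := funext next_symm_apply
  obtain ⟨n, rfl | rfl⟩ := k.eq_nat_or_neg
  · refine ⟨1, by decide, n, ?_⟩
    rw [← hfun1, ← hk, zpow_natCast, Equiv.Perm.iterate_eq_pow]
  · refine ⟨2, by decide, n, ?_⟩
    rw [← hfun2, ← hk, zpow_neg, zpow_natCast, ← inv_pow]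
    exact congrFun (Equiv.Perm.iterate_eq_pow _ n) σ

lemma SameBranch.induction {P : Segment M → Prop} {σ τ : Segment M} (h : SameBranch σ τ)
    (hσ : P σ) (hP : ∀ e, e ≠ 0 → ∀ ρ, SameBranch σ ρ → P ρ → P (step e ρ)) : P τ := by
  obtain ⟨e, he, n, rfl⟩ := h.exists_iterate
  clear h
  induction n with
  | zero => exact hσ
  | succ n ih =>
    rw [Function.iterate_succ_apply']
    exact hP e he _ (sameBranch_iterate he n σ) ih

/-- The segment of the base triangle of `σ` that meets `σ` at its endpoint in the direction `e`;
it lies on the branch that crosses `L_E` there. -/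
def crossing (e : Fin 3) (σ : Segment M) : Segment M := (σ.1, σ.2 + e)

lemma step_crossing {e : Fin 3} (h : M.Group) (j : Fin 3) :
    step e (across h (j - e), j) = (h, j + e) := by
  simp only [step, across_across]

/-! ### Branches do not return to a base triangle, and rarely cross twice -/

/-- The values of a linear function along the strip of base triangles that a branch follows. -/
lemma exists_isStrip {Φ : M.Group → Fin 3 → ℝ} (hΦ : IsLinear Φ) {e : Fin 3} (he : e ≠ 0)
    (s : ℕ → Segment M) (hs : ∀ n, s (n + 1) = step e (s n)) :
    ∃ θ y D : ℕ → ℝ, IsStrip θ y D ∧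
      (∀ n, y n = Φ (s n).1 ((s n).2 - e) ∧ y (n + 1) = Φ (s n).1 (s n).2 ∧
        y (n + 2) = Φ (s n).1 ((s n).2 + e)) ∧
      ∀ n, θ n = cosWeight M ((s n).2 - e) ∧ θ (n + 1) = cosWeight M (s n).2 ∧
        θ (n + 2) = cosWeight M ((s n).2 + e) := by
  have hs : ∀ n, s (n + 1) = (across (s n).1 ((s n).2 - e), (s n).2 + e) := hs
  let y : ℕ → ℝ := fun n => Φ (s n).1 ((s n).2 - e)
  let θ : ℕ → ℝ := fun n => cosWeight M ((s n).2 - e)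
  have y1 : ∀ n, y (n + 1) = Φ (s n).1 (s n).2 := fun n => by
    simp only [y, hs, add_sub_cancel_right]
    rw [hΦ, reflect_of_ne _ (sub_ne he _).symm]
  have y2 : ∀ n, y (n + 2) = Φ (s n).1 ((s n).2 + e) := fun n => by
    rw [y1 (n + 1), hs]
    simp only
    rw [hΦ, reflect_of_ne _ (add_ne_sub he _)]
  have t1 : ∀ n, θ (n + 1) = cosWeight M (s n).2 := fun n => by
    simp only [θ, hs, add_sub_cancel_right]
  have t2 : ∀ n, θ (n + 2) = cosWeight M ((s n).2 + e) := fun n => by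
    rw [t1 (n + 1), hs]
  refine ⟨θ, y, fun n => θ (n + 1) * y n + θ n * y (n + 1),
    ⟨fun n => ?_, fun n => ?_, fun n => rfl⟩, fun n => ⟨rfl, y1 n, y2 n⟩,
    fun n => ⟨rfl, t1 n, t2 n⟩⟩
  · rw [t2 (n + 1), hs]
    simp only [θ, add_add_self]
  · rw [y2 (n + 1), y1 n, y2 n, t2 n, t1 n, hs]
    simp only [y, add_add_self]
    rw [hΦ, reflect_eq _ (sub_ne he _) (add_ne_sub he _).symm (add_ne he _).symm]

lemma IsNonspherical.four_le' (hM : IsNonspherical M) {e : Fin 3} (he : e ≠ 0) (j : Fin 3) :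
    4 ≤ cosWeight M (j - e) ^ 2 + cosWeight M j ^ 2 + cosWeight M (j + e) ^ 2 +
      cosWeight M (j - e) * cosWeight M j * cosWeight M (j + e) :=
  hM.four_le (sub_ne he j) (add_ne_sub he j).symm (add_ne he j).symm

/-- A strip of base triangles which has crossed the wall of a side stays beyond this wall: a linear
function which vanishes on the wall and is negative before it is nonnegative from then on. -/
lemma IsNonspherical.strip_beyond_wall (hM : IsNonspherical M) {Φ : M.Group → Fin 3 → ℝ}
    (hΦ : IsLinear Φ) {e : Fin 3} (he : e ≠ 0) (σ : Segment M)
    (h0 : Φ σ.1 (σ.2 - e) = -1) (h1 : Φ σ.1 σ.2 = 0) (h2 : Φ σ.1 (σ.2 + e) = 0)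
    {n : ℕ} (hn : 1 ≤ n) (l : Fin 3) : 0 ≤ Φ ((step e)^[n] σ).1 l := by
  obtain ⟨θ, y, D, hS, hy, hθ⟩ := exists_isStrip hΦ he (fun n => (step e)^[n] σ)
    (fun n => Function.iterate_succ_apply' _ _ _)
  have hne : σ.2 ≠ σ.2 + e := (add_ne he _).symm
  obtain ⟨t0, t1, t2⟩ := hθ 0
  obtain ⟨y0, y1, y2⟩ := hy 0
  simp only [Function.iterate_zero, id_eq, zero_add] at t0 t1 t2 y0 y1 y2
  have h12 : 1 ≤ cosWeight M σ.2 ∨ 1 ≤ cosWeight M (σ.2 + e) := by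
    by_cases hc : coneOrder M σ.2 = 2
    · exact Or.inr (one_le_cosWeight hM (hM.ne_two hne hc))
    · exact Or.inl (one_le_cosWeight hM hc)
  have key := hS.nonneg (by rw [t0]; exact cosWeight_nonneg hM)
    (by rw [t1]; exact cosWeight_nonneg hM) (by rw [t2]; exact cosWeight_nonneg hM)
    (by rw [t1, t2]; exact h12) (by rw [t0, t1, t2]; exact hM.four_le' he _)
    (by rw [y0, h0]) (by rw [y1, h1]) (by rw [y2, h2])
  obtain ⟨m, rfl⟩ : ∃ m, n = m + 1 := ⟨n - 1, by omega⟩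
  obtain rfl | rfl | rfl := eq_of_ne_zero he ((step e)^[m + 1] σ).2 l
  · rw [← (hy (m + 1)).1]; exact key m
  · rw [← (hy (m + 1)).2.1]; exact key (m + 1)
  · rw [← (hy (m + 1)).2.2]; exact key (m + 2)

lemma exists_wall (hM : IsNonspherical M) (h : M.Group) {e : Fin 3} (he : e ≠ 0) (j : Fin 3) :
    ∃ Φ : M.Group → Fin 3 → ℝ, IsLinear Φ ∧ Φ h (j - e) = -1 ∧ Φ h j = 0 ∧ Φ h (j + e) = 0 := by
  obtain ⟨Φ, hΦ, hh⟩ := hM.exists_isLinear h (fun l => if l = j - e then -1 else 0)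
  have a2 : j ≠ j - e := (sub_ne he j).symm
  have a3 : j + e ≠ j - e := add_ne_sub he j
  exact ⟨Φ, hΦ, by simp [hh], by simp [hh, a2], by simp [hh, a3]⟩

/-- A branch never returns to a base triangle. -/
lemma IsNonspherical.fst_iterate_ne (hM : IsNonspherical M) {e : Fin 3} (he : e ≠ 0)
    (σ : Segment M) {n : ℕ} (hn : 1 ≤ n) : ((step e)^[n] σ).1 ≠ σ.1 := by
  intro heq
  obtain ⟨Φ, hΦ, h0, h1, h2⟩ := exists_wall hM σ.1 he σ.2
  have := hM.strip_beyond_wall hΦ he σ h0 h1 h2 hn (σ.2 - e)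
  rw [heq, h0] at this
  linarith

lemma IsNonspherical.fst_iterate_injective (hM : IsNonspherical M) {e : Fin 3} (he : e ≠ 0)
    (σ : Segment M) : Function.Injective fun n : ℕ => ((step e)^[n] σ).1 := by
  have key : ∀ m n : ℕ, m < n → ((step e)^[m] σ).1 ≠ ((step e)^[n] σ).1 := by
    intro m n hmn heq
    apply hM.fst_iterate_ne he ((step e)^[m] σ) (n := n - m) (by omega)
    rw [← Function.iterate_add_apply, show n - m + m = n by omega, heq]
  intro m n hmn
  by_contra hne
  rcases Nat.lt_or_gt_of_ne hne with h | h
  · exact key m n h hmn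
  · exact key n m h hmn.symm

/-- A branch has at most one segment in each base triangle. -/
lemma IsNonspherical.sameBranch_eq (hM : IsNonspherical M) {σ τ : Segment M}
    (h : SameBranch σ τ) (h1 : σ.1 = τ.1) : σ = τ := by
  obtain ⟨e, he, n, rfl⟩ := h.exists_iterate
  rcases n with _ | n
  · rfl
  · exact absurd h1.symm (hM.fst_iterate_ne he σ (by omega))

/-- The two rays of `L_E` that leave a crossing point in the direction `e` lie on different sides
of the wall through this point, and so share no base triangle. -/
lemma IsNonspherical.fst_rays_ne (hM : IsNonspherical M) {e : Fin 3} (he : e ≠ 0) (h : M.Group)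
    (i : Fin 3) {m : ℕ} (hm : 1 ≤ m) (n : ℕ) :
    ((step e)^[m] (h, i + e)).1 ≠ ((step e)^[n] (h, i - e)).1 := by
  intro heq
  have b1 : i + e - e = i := add_sub_cancel_right i e
  have b2 : i + e + e = i - e := add_add_self e i
  have b3 : i + e ≠ i := add_ne he i
  have b4 : i - e ≠ i := sub_ne he i
  obtain ⟨Φ, hΦ, h0, h1, h2⟩ := exists_wall hM h he (i + e)
  rw [b1] at h0
  rw [b2] at h2
  have hpos := hM.strip_beyond_wall hΦ he (h, i + e) (by rw [b1, h0]) h1 (by rw [b2, h2]) hm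
  have hstep : step e (across h i, i + e) = (h, i - e) := by
    have := step_crossing (e := e) h (i + e)
    rwa [b1, b2] at this
  have hneg := hM.strip_beyond_wall hΦ.neg he (across h i, i + e) (n := n + 1)
    (by simp only [Pi.neg_apply, b1]; rw [hΦ, reflect_eq _ b3.symm b4.symm (add_ne_sub he i), h0]
        rw [h1, h2]; ring)
    (by simp only [Pi.neg_apply]; rw [hΦ, reflect_of_ne _ b3, h1, neg_zero])
    (by simp only [Pi.neg_apply, b2]; rw [hΦ, reflect_of_ne _ b4, h2, neg_zero]) (by omega)
  rw [Function.iterate_succ_apply, hstep, ← heq] at hneg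
  have hzero : Φ ((step e)^[m] (h, i + e)).1 = 0 := by
    funext l
    have := hneg l
    simp only [Pi.neg_apply] at this
    exact le_antisymm (show _ ≤ (0 : ℝ) by linarith) (hpos l)
  have := hΦ.eq_zero hzero h
  rw [this] at h0
  norm_num at h0

/-- The linear function `Ψ` vanishes at the two endpoints of the segment `σ`, which are the weighted
midpoints of two sides of its base triangle, and is normalized up to sign.  This property passes to
the whole branch. -/
def IsAligned (Ψ : M.Group → Fin 3 → ℝ) (σ : Segment M) : Prop :=
  ∃ ε : ℝ, (ε = 1 ∨ ε = -1) ∧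
    ∀ l, Ψ σ.1 l = ε * (if l = σ.2 then -cosWeight M l else cosWeight M l)

lemma IsAligned.step {Ψ : M.Group → Fin 3 → ℝ} (hΨ : IsLinear Ψ) {σ : Segment M}
    (h : IsAligned Ψ σ) {e : Fin 3} (he : e ≠ 0) : IsAligned Ψ (step e σ) := by
  obtain ⟨g, j⟩ := σ
  obtain ⟨ε, hε, hl⟩ := h
  have a1 : j - e ≠ j := sub_ne he j
  have a2 : j - e ≠ j + e := (add_ne_sub he j).symm
  have a3 : j ≠ j + e := (add_ne he j).symm
  refine ⟨-ε, by rcases hε with rfl | rfl <;> simp, fun l => ?_⟩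
  simp only [SeidelDiagram.step] at hl ⊢
  rw [hΨ]
  obtain rfl | rfl | rfl := eq_of_ne_zero he j l
  · rw [reflect_eq _ a1 a2 a3, hl, hl, hl]
    simp [a1, a2, a3.symm]
    ring
  · rw [reflect_of_ne _ a1.symm, hl]
    simp [a3]
  · rw [reflect_of_ne _ a2.symm, hl]
    simp [a3.symm]

/-- Two branches cross at most once, except if they cross at sides opposite to a vertex of cone
order two.  A linear function that vanishes along one branch would otherwise have a fixed sign
at all later crossing points of the other branch. -/
lemma IsNonspherical.coneOrder_eq_two (hM : IsNonspherical M) {e : Fin 3} (he : e ≠ 0)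
    (σ : Segment M) {n : ℕ} (hn : 1 ≤ n)
    (h : SameBranch (crossing e σ) (crossing e ((step e)^[n] σ))) :
    coneOrder M (σ.2 - e) = 2 := by
  by_contra h2
  obtain ⟨g, j⟩ := σ
  simp only [crossing] at h h2
  have a1 : j - e ≠ j := sub_ne he j
  have a2 : j - e ≠ j + e := (add_ne_sub he j).symm
  have a3 : j ≠ j + e := (add_ne he j).symm
  have a4 : j + e + e = j - e := add_add_self e j
  rcases Nat.lt_or_ge 1 n with hn2 | hn1
  -- the linear function that vanishes along the branch crossing at the start
  · obtain ⟨Ψ, hΨ, hg⟩ := hM.exists_isLinear g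
      (fun l => if l = j + e then -cosWeight M l else cosWeight M l)
    have hal : IsAligned Ψ (g, j + e) := ⟨1, Or.inl rfl, fun l => by rw [hg]; simp⟩
    have hal' := h.induction (P := IsAligned Ψ) hal (fun e he ρ _ hρ => hρ.step hΨ he)
    obtain ⟨θ, y, D, hS, hy, hθ⟩ := exists_isStrip hΨ he
      (fun n => (SeidelDiagram.step e)^[n] (g, j)) (fun n => Function.iterate_succ_apply' _ _ _)
    obtain ⟨t0, t1, t2⟩ := hθ 0
    obtain ⟨y0, y1, y2⟩ := hy 0
    simp only [Function.iterate_zero, id_eq, zero_add] at t0 t1 t2 y0 y1 y2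
    have p0 : 0 < cosWeight M (j - e) := lt_of_lt_of_le one_pos (one_le_cosWeight hM h2)
    have h12 : 0 < cosWeight M j ∨ 0 < cosWeight M (j + e) := by
      by_cases hc : coneOrder M j = 2
      · exact Or.inr (lt_of_lt_of_le one_pos (one_le_cosWeight hM (hM.ne_two a3 hc)))
      · exact Or.inl (lt_of_lt_of_le one_pos (one_le_cosWeight hM hc))
    have key := hS.neg (by rwa [t0]) (by rw [t1]; exact cosWeight_nonneg hM)
      (by rw [t2]; exact cosWeight_nonneg hM)
      (by rw [t1, t2]; exact h12) (by rw [t0, t1, t2]; exact hM.four_le' he _)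
      (by rw [y0, t0]; simp [hg, a2]) (by rw [y1, t1]; simp [hg, a3]) (by rw [y2, t2]; simp [hg])
      (n - 2)
    obtain ⟨ε, -, hε⟩ := hal'
    obtain ⟨m, rfl⟩ : ∃ m, n = m + 2 := ⟨n - 2, by omega⟩
    rw [show m + 2 - 2 + 3 = (m + 2) + 1 by omega, hS.edge,
      show m + 2 + 1 + 1 = (m + 2) + 2 by omega, (hθ (m + 2)).2.1,
      (hθ (m + 2)).2.2, (hy (m + 2)).2.1, (hy (m + 2)).2.2] at key
    dsimp only at key hε
    rw [hε, hε, if_neg (add_ne he _).symm, if_pos rfl] at key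
    apply lt_irrefl (0 : ℝ)
    calc (0 : ℝ) = _ := by ring
      _ < 0 := key
  · obtain rfl : n = 1 := by omega
    have h3 : SameBranch (across g (j - e), j) (g, j + e) := by
      have := sameBranch_step he (across g (j - e), j)
      rwa [step_crossing] at this
    have := hM.sameBranch_eq (h3.trans h) rfl
    simp [step, a4] at this
    exact a1 this.symm

/-! ### Colors, sides and crossings -/

lemma isWhite_across (h : M.Group) (i : Fin 3) : IsWhite (across h i) ↔ ¬ IsWhite h := by
  unfold IsWhite across
  rw [← M.toCoxeterSystem_simple]
  rcases M.toCoxeterSystem.length_mul_simple h i with hl | hl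
  · rw [hl, Nat.even_add_one]
  · rw [← hl, Nat.even_add_one, not_not]

lemma isWhite_step (e : Fin 3) (σ : Segment M) : IsWhite (step e σ).1 ↔ ¬ IsWhite σ.1 :=
  isWhite_across _ _

lemma cornerOf_across (h : M.Group) {j k : Fin 3} (hk : k ≠ j) :
    cornerOf (across h k) j = cornerOf h j := by
  unfold cornerOf vertexOf
  congr 1
  rw [QuotientGroup.eq]
  have hs : (M.simple k)⁻¹ = M.simple k := by
    rw [← M.toCoxeterSystem_simple]; exact M.toCoxeterSystem.inv_simple k
  rw [across, mul_inv_rev, inv_mul_cancel_right, hs]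
  apply Subgroup.subset_closure
  rcases eq_add_one_or_two hk with rfl | rfl <;> simp

/-- The base triangles at a vertex are connected around this vertex. -/
lemma cornerOf_induction {P : M.Group → Prop} {j : Fin 3} {g h : M.Group}
    (hgh : cornerOf g j = cornerOf h j) (hg : P g)
    (hP : ∀ h k, k ≠ j → P h → P (across h k)) : P h := by
  have hmem : g⁻¹ * h ∈ vertexGroup M j := by
    unfold cornerOf vertexOf at hgh
    simp only [Region.corner.injEq, heq_eq_eq, true_and] at hgh
    exact QuotientGroup.eq.1 hgh
  have hstep : ∀ u, ∀ x ∈ ({M.simple (j + 1), M.simple (j + 2)} : Set M.Group),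
      P u → P (u * x) := by
    rintro u x (rfl | rfl) hu
    · exact hP u _ (add_ne (by decide) j) hu
    · exact hP u _ (add_ne (by decide) j) hu
  have hinv : ∀ x ∈ ({M.simple (j + 1), M.simple (j + 2)} : Set M.Group), x⁻¹ = x := by
    rintro x (rfl | rfl) <;> rw [← M.toCoxeterSystem_simple] <;>
      exact M.toCoxeterSystem.inv_simple _
  have key : ∀ w ∈ vertexGroup M j, P (g * w) := by
    intro w hw
    induction hw using Subgroup.closure_induction_right with
    | one => rwa [mul_one]
    | mul_right x _ y hy ih => rw [← mul_assoc]; exact hstep _ y hy ih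
    | mul_inv_cancel x _ y hy ih => rw [← mul_assoc, hinv y hy]; exact hstep _ y hy ih
  have := key _ hmem
  rwa [mul_inv_cancel_left] at this

open Classical in
/-- The region immediately on the right of a segment of `L_E`. -/
noncomputable def rightRegion (σ : Segment M) : Region M :=
  if IsWhite σ.1 then cornerOf σ.1 σ.2 else Region.middle σ.1

lemma leftRegion_white {σ : Segment M} (h : IsWhite σ.1) : leftRegion σ = Region.middle σ.1 :=
  if_pos h

lemma leftRegion_black {σ : Segment M} (h : ¬ IsWhite σ.1) : leftRegion σ = cornerOf σ.1 σ.2 :=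
  if_neg h

lemma rightRegion_white {σ : Segment M} (h : IsWhite σ.1) : rightRegion σ = cornerOf σ.1 σ.2 :=
  if_pos h

lemma rightRegion_black {σ : Segment M} (h : ¬ IsWhite σ.1) :
    rightRegion σ = Region.middle σ.1 :=
  if_neg h

lemma separates_iff {σ : Segment M} {p q : Region M} : Separates σ p q ↔
    (p = leftRegion σ ∧ q = rightRegion σ) ∨ (q = leftRegion σ ∧ p = rightRegion σ) := by
  unfold Separates leftRegion rightRegion
  split_ifs <;> tauto

lemma separates_left_right (σ : Segment M) : Separates σ (leftRegion σ) (rightRegion σ) :=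
  separates_iff.2 (Or.inl ⟨rfl, rfl⟩)

lemma separates_right_left (σ : Segment M) : Separates σ (rightRegion σ) (leftRegion σ) :=
  separates_iff.2 (Or.inr ⟨rfl, rfl⟩)

lemma Separates.symm {σ : Segment M} {p q : Region M} (h : Separates σ p q) : Separates σ q p := by
  unfold Separates at *; tauto

lemma separates_middle (h : M.Group) (j : Fin 3) :
    Separates (h, j) (Region.middle h) (cornerOf h j) := Or.inl ⟨rfl, rfl⟩

lemma separates_across (h : M.Group) {j k : Fin 3} (hk : k ≠ j) :
    Separates (across h k, j) (cornerOf h j) (Region.middle (across h k)) := by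
  rw [← cornerOf_across h hk]; exact Or.inr ⟨rfl, rfl⟩

/-- The plane is connected: a property of regions that passes from one side of each segment to the
other holds everywhere once it holds somewhere. -/
lemma region_induction {P : Region M → Prop} {r : Region M} (hr : P r)
    (hP : ∀ σ p q, Separates σ p q → P p → P q) (s : Region M) : P s := by
  have hmid : ∀ g, P (Region.middle g) → ∀ h, P (Region.middle h) := fun g hg h => by
    refine across_induction (P := fun h => P (Region.middle h)) g hg (fun h i hh => ?_) h
    have h1 := hP _ _ _ (separates_middle h (i + 1)) hh
    exact hP _ _ _ (separates_across h (j := i + 1) (add_ne (by decide) i).symm) h1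
  have hcor : ∀ j (v : ColoredVertex M j), ∃ g, Region.corner j v = cornerOf g j := fun j v => by
    obtain ⟨g, rfl⟩ := QuotientGroup.mk_surjective v
    exact ⟨g, rfl⟩
  have hstart : ∃ g, P (Region.middle g) := by
    cases r with
    | middle g => exact ⟨g, hr⟩
    | corner j v =>
      obtain ⟨g, hg⟩ := hcor j v
      rw [hg] at hr
      exact ⟨g, hP _ _ _ (separates_middle g j).symm hr⟩
  obtain ⟨g, hg⟩ := hstart
  cases s with
  | middle h => exact hmid g hg h
  | corner j v =>
    obtain ⟨h, hh⟩ := hcor j v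
    rw [hh]
    exact hP _ _ _ (separates_middle h j) (hmid g hg h)

lemma not_sameBranch_crossing (hM : IsNonspherical M) {e : Fin 3} (he : e ≠ 0) (σ : Segment M) :
    ¬ SameBranch σ (crossing e σ) := by
  intro h
  have := congrArg Prod.snd (hM.sameBranch_eq h rfl)
  exact add_ne he _ this.symm

/-- The segment beyond the end of `σ` on the branch that crosses there. -/
lemma sameBranch_crossing' {e : Fin 3} (he : e ≠ 0) (σ : Segment M) :
    SameBranch (crossing e σ) (across σ.1 (σ.2 - e), σ.2) := by
  have := sameBranch_step he (across σ.1 (σ.2 - e), σ.2)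
  rw [step_crossing] at this
  exact this.symm

/-- Two consecutive segments of a branch have neighboring left sides, which are separated by the
branch that crosses between them. -/
lemma exists_separates_left {e : Fin 3} (he : e ≠ 0) (σ : Segment M) :
    ∃ ρ, SameBranch (crossing e σ) ρ ∧
      (ρ.1 = σ.1 ∧ ρ ≠ σ ∨ ρ.1 = (step e σ).1 ∧ ρ ≠ step e σ) ∧
      Separates ρ (leftRegion σ) (leftRegion (step e σ)) := by
  obtain ⟨h, j⟩ := σ
  by_cases hw : IsWhite h
  · refine ⟨(h, j + e), SameBranch.refl _,
      Or.inl ⟨rfl, fun heq => add_ne he j (congrArg Prod.snd heq)⟩, ?_⟩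
    rw [leftRegion_white hw, leftRegion_black (by rw [isWhite_step]; simpa using hw)]
    simp only [step]
    rw [cornerOf_across h (add_ne_sub he j).symm]
    exact separates_middle h _
  · refine ⟨_, sameBranch_crossing' he _,
      Or.inr ⟨rfl, fun heq => add_ne he j (congrArg Prod.snd heq).symm⟩, ?_⟩
    rw [leftRegion_black hw, leftRegion_white (by rw [isWhite_step]; simpa using hw)]
    exact separates_across h (sub_ne he j)

lemma exists_separates_right {e : Fin 3} (he : e ≠ 0) (σ : Segment M) :
    ∃ ρ, SameBranch (crossing e σ) ρ ∧
      (ρ.1 = σ.1 ∧ ρ ≠ σ ∨ ρ.1 = (step e σ).1 ∧ ρ ≠ step e σ) ∧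
      Separates ρ (rightRegion σ) (rightRegion (step e σ)) := by
  obtain ⟨h, j⟩ := σ
  by_cases hw : IsWhite h
  · refine ⟨_, sameBranch_crossing' he _,
      Or.inr ⟨rfl, fun heq => add_ne he j (congrArg Prod.snd heq).symm⟩, ?_⟩
    rw [rightRegion_white hw, rightRegion_black (by rw [isWhite_step]; simpa using hw)]
    exact separates_across h (sub_ne he j)
  · refine ⟨(h, j + e), SameBranch.refl _,
      Or.inl ⟨rfl, fun heq => add_ne he j (congrArg Prod.snd heq)⟩, ?_⟩
    rw [rightRegion_black hw, rightRegion_white (by rw [isWhite_step]; simpa using hw)]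
    simp only [step]
    rw [cornerOf_across h (add_ne_sub he j).symm]
    exact separates_middle h _

/-- A branch leaves every finite set of middle triangles, even among those of one color. -/
lemma exists_middle_notMem (hM : IsNonspherical M) {e : Fin 3} (he : e ≠ 0) (σ : Segment M)
    {Y : Set (Region M)} (hY : Y.Finite) (white : Prop) :
    ∃ n, (IsWhite ((step e)^[n] σ).1 ↔ white) ∧ Region.middle ((step e)^[n] σ).1 ∉ Y := by
  by_contra! hcon
  obtain ⟨c, hc⟩ : ∃ c : ℕ, IsWhite ((step e)^[c] σ).1 ↔ white := by
    by_cases h : IsWhite σ.1 ↔ white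
    · exact ⟨0, h⟩
    · refine ⟨1, ?_⟩
      rw [Function.iterate_one, isWhite_step]; tauto
  have hall : ∀ n : ℕ, IsWhite ((step e)^[2 * n + c] σ).1 ↔ white := by
    intro n
    induction n with
    | zero => simpa using hc
    | succ n ih =>
      rw [show 2 * (n + 1) + c = (2 * n + c) + 1 + 1 by ring, Function.iterate_succ_apply',
        Function.iterate_succ_apply', isWhite_step, isWhite_step, not_not, ih]
  refine Set.infinite_of_injective_forall_mem (s := Y)
    (f := fun n : ℕ => Region.middle ((step e)^[2 * n + c] σ).1) ?_ (fun n => hcon _ (hall n)) hY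
  intro m n hmn
  simp only [Region.middle.injEq] at hmn
  have := hM.fst_iterate_injective he σ hmn
  omega

lemma exists_left_notMem (hM : IsNonspherical M) {e : Fin 3} (he : e ≠ 0) (σ : Segment M)
    {Y : Set (Region M)} (hY : Y.Finite) : ∃ n, leftRegion ((step e)^[n] σ) ∉ Y := by
  obtain ⟨n, hw, hn⟩ := exists_middle_notMem hM he σ hY True
  exact ⟨n, by rwa [leftRegion_white (by simpa using hw)]⟩

lemma exists_right_notMem (hM : IsNonspherical M) {e : Fin 3} (he : e ≠ 0) (σ : Segment M)
    {Y : Set (Region M)} (hY : Y.Finite) : ∃ n, rightRegion ((step e)^[n] σ) ∉ Y := by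
  obtain ⟨n, hw, hn⟩ := exists_middle_notMem hM he σ hY False
  exact ⟨n, by rwa [rightRegion_black (by simpa using hw)]⟩

/-! ### The plane is simply connected -/

/-- Every covering of the plane has a section through each point.  A covering has fibers `In r`
over the regions `r`, is glued along the segments by `T`, and has trivial monodromy around the
midpoint of each side of a base triangle. -/
theorem exists_section {Λ : Type*} (In : Region M → Set Λ) (T : Segment M → Λ → Λ)
    (hmid : ∀ h j, ∀ x ∈ In (Region.middle h),
      T (h, j) x ∈ In (cornerOf h j) ∧ T (h, j) (T (h, j) x) = x)
    (hcor : ∀ h j, ∀ x ∈ In (cornerOf h j),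
      T (h, j) x ∈ In (Region.middle h) ∧ T (h, j) (T (h, j) x) = x)
    (hol : ∀ h i, IsWhite h → ∀ x ∈ In (Region.middle h),
      T (across h i, i + 1) (T (h, i + 1) x) = T (across h i, i + 2) (T (h, i + 2) x))
    (g : M.Group) {x₀ : Λ} (hx₀ : x₀ ∈ In (Region.middle g)) :
    ∃ s : Region M → Λ, (∀ r, s r ∈ In r) ∧ s (Region.middle g) = x₀ ∧
      ∀ h j, s (cornerOf h j) = T (h, j) (s (Region.middle h)) := by
  have ne1 : ∀ i : Fin 3, i ≠ i + 1 := by decide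
  have ne2 : ∀ i : Fin 3, i ≠ i + 2 := by decide
  -- crossing a side of a base triangle via one of its endpoints
  have hin : ∀ h i j, i ≠ j → ∀ x ∈ In (Region.middle h),
      T (across h i, j) (T (h, j) x) ∈ In (Region.middle (across h i)) := by
    intro h i j hij x hx
    refine (hcor _ _ _ ?_).1
    rw [cornerOf_across h hij]
    exact (hmid h j x hx).1
  have hback : ∀ h i j, i ≠ j → ∀ x ∈ In (Region.middle h),
      T (h, j) (T (across h i, j) (T (across h i, j) (T (h, j) x))) = x := by
    intro h i j hij x hx
    rw [(hcor (across h i) j (T (h, j) x) ?_).2, (hmid h j x hx).2]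
    rw [cornerOf_across h hij]
    exact (hmid h j x hx).1
  have hol' : ∀ h i, ∀ x ∈ In (Region.middle h),
      T (across h i, i + 1) (T (h, i + 1) x) = T (across h i, i + 2) (T (h, i + 2) x) := by
    intro h i x hx
    by_cases hw : IsWhite h
    · exact hol h i hw x hx
    · have hw' : IsWhite (across h i) := (isWhite_across h i).2 hw
      set y := T (across h i, i + 1) (T (h, i + 1) x) with hy
      have hyin : y ∈ In (Region.middle (across h i)) := hin h i _ (ne1 i) x hx
      have h1 := hol (across h i) i hw' y hyin
      rw [across_across, hback h i _ (ne1 i) x hx] at h1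
      have h2 := hback (across h i) i _ (ne2 i) y hyin
      rw [across_across, ← h1] at h2
      exact h2.symm
  have hcross : ∀ h i j, i ≠ j → ∀ x ∈ In (Region.middle h),
      T (across h i, i + 1) (T (h, i + 1) x) = T (across h i, j) (T (h, j) x) := by
    intro h i j hij x hx
    have : j = i + 1 ∨ j = i + 2 := by revert i j; decide
    rcases this with rfl | rfl
    · rfl
    · exact hol' h i x hx
  -- a region is reached along a gallery of base triangles; the relation around a vertex holds as
  -- the fiber over the region at this vertex does not change on the way
  let α := {q : M.Group × Λ // q.2 ∈ In (Region.middle q.1)}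
  let f : Fin 3 → α → α := fun i q =>
    ⟨(across q.1.1 i, T (across q.1.1 i, i + 1) (T (q.1.1, i + 1) q.1.2)),
      hin _ _ _ (ne1 i) _ q.2⟩
  have hf1 : ∀ i (q : α), (f i q).1.1 = across q.1.1 i := fun i q => rfl
  have hf2 : ∀ i k (q : α), i ≠ k → T ((f i q).1.1, k) (f i q).1.2 = T (q.1.1, k) q.1.2 := by
    intro i k q hik
    have : (f i q).1.2 = T (across q.1.1 i, k) (T (q.1.1, k) q.1.2) :=
      hcross _ _ _ hik _ q.2
    rw [this, hf1]
    refine (hcor _ _ _ ?_).2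
    rw [cornerOf_across _ hik]
    exact (hmid _ _ _ q.2).1
  have hext : ∀ (q q' : α) k, q.1.1 = q'.1.1 → T (q.1.1, k) q.1.2 = T (q'.1.1, k) q'.1.2 →
      q = q' := by
    rintro ⟨⟨h, x⟩, hx⟩ ⟨⟨h', x'⟩, hx'⟩ k h1 h2
    simp only at h1 h2 hx hx'
    subst h1
    have h3 := congrArg (T (h, k)) h2
    rw [(hmid h k x hx).2, (hmid h k x' hx').2] at h3
    subst h3
    rfl
  have hrel : ∀ i j (q : α), (f i ∘ f j)^[M i j] q = q := by
    intro i j q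
    obtain ⟨k, hik, hjk⟩ : ∃ k : Fin 3, i ≠ k ∧ j ≠ k := by revert i j; decide
    have hiter : ∀ n : ℕ, ((f i ∘ f j)^[n] q).1.1 = q.1.1 * (M.simple j * M.simple i) ^ n ∧
        T (((f i ∘ f j)^[n] q).1.1, k) ((f i ∘ f j)^[n] q).1.2 = T (q.1.1, k) q.1.2 := by
      intro n
      induction n with
      | zero => simp
      | succ n ih =>
        rw [Function.iterate_succ_apply']
        simp only [Function.comp_apply]
        rw [hf2 i k _ hik, hf2 j k _ hjk]
        refine ⟨?_, ih.2⟩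
        rw [hf1, hf1, ih.1, pow_succ]
        simp only [across, mul_assoc]
    apply hext _ _ k
    · rw [(hiter _).1, ← M.toCoxeterSystem_simple, M.symmetric i j,
        M.toCoxeterSystem.simple_mul_simple_pow, mul_one]
    · exact (hiter _).2
  obtain ⟨Φ, hg, hΦ⟩ := exists_equivariant f hrel g ⟨(g, x₀), hx₀⟩
  have hfst : ∀ h, (Φ h).1.1 = h := by
    refine across_induction (P := fun h => (Φ h).1.1 = h) g (by rw [hg]) (fun h i hh => ?_)
    rw [hΦ, hf1, hh]
  have hconst : ∀ h h' j, cornerOf h j = cornerOf h' j →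
      T ((Φ h).1.1, j) (Φ h).1.2 = T ((Φ h').1.1, j) (Φ h').1.2 := by
    intro h h' j hhh
    refine cornerOf_induction (P := fun u =>
      T ((Φ h).1.1, j) (Φ h).1.2 = T ((Φ u).1.1, j) (Φ u).1.2) hhh rfl (fun u k hk hu => ?_)
    rw [hΦ, hf2 k j _ hk, hu]
  let s : Region M → Λ := fun r => match r with
    | .middle h => (Φ h).1.2
    | .corner j v => T ((Φ (Quotient.out v)).1.1, j) (Φ (Quotient.out v)).1.2
  have hs : ∀ h j, s (cornerOf h j) = T (h, j) (s (Region.middle h)) := by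
    intro h j
    have h1 : T ((Φ h).1.1, j) (Φ h).1.2 = T (h, j) (s (Region.middle h)) := by
      rw [hfst]
    rw [← h1]
    refine hconst _ _ _ ?_
    unfold cornerOf vertexOf
    congr 1
    exact Quotient.out_eq _
  have hsm : ∀ h, s (Region.middle h) ∈ In (Region.middle h) := by
    intro h
    have := (Φ h).2
    rwa [hfst] at this
  refine ⟨s, ?_, by change (Φ g).1.2 = x₀; rw [hg], hs⟩
  intro r
  cases r with
  | middle h => exact hsm h
  | corner j v =>
    obtain ⟨h, rfl⟩ := QuotientGroup.mk_surjective v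
    change s (cornerOf h j) ∈ In (cornerOf h j)
    rw [hs]
    exact (hmid h j _ (hsm h)).1

/-- A set of segments with an even number of ends at each crossing of `L_E` is the frontier of a set
of regions. -/
theorem exists_frontier_eq (B : Set (Segment M))
    (hB : ∀ h i, IsWhite h → (((h, i + 1) ∈ B ↔ (across h i, i + 1) ∈ B) ↔
      ((h, i + 2) ∈ B ↔ (across h i, i + 2) ∈ B))) :
    ∃ S : Set (Region M), ∀ σ, σ ∈ B ↔ (leftRegion σ ∈ S ↔ rightRegion σ ∉ S) := by
  classical
  let T : Segment M → Prop → Prop := fun σ x => (x ↔ σ ∉ B)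
  have hTT : ∀ σ x, T σ (T σ x) = x := fun σ x => by
    apply propext; simp only [T]; tauto
  obtain ⟨s, -, -, hs⟩ := exists_section (fun _ => Set.univ) T
    (fun h j x _ => ⟨trivial, hTT _ _⟩) (fun h j x _ => ⟨trivial, hTT _ _⟩)
    (fun h i hw x _ => by
      apply propext
      have := hB h i hw
      simp only [T]
      tauto) (1 : M.Group) (x₀ := True) trivial
  refine ⟨{r | s r}, fun σ => ?_⟩
  have := hs σ.1 σ.2
  have h2 : s (cornerOf σ.1 σ.2) ↔ (s (Region.middle σ.1) ↔ σ ∉ B) := by rw [this]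
  unfold leftRegion rightRegion
  split_ifs <;> simp only [Set.mem_ofPred_eq] <;> tauto

/-- The left side of the branch through `σ`. -/
def leftOf (σ : Segment M) : Set (Region M) := leftSide {τ | SameBranch σ τ}

/-- A branch of `L_E` separates the plane: its left side lies on its left only. -/
lemma mem_leftOf (hM : IsNonspherical M) (σ τ : Segment M) :
    (SameBranch σ τ → leftRegion τ ∈ leftOf σ ∧ rightRegion τ ∉ leftOf σ) ∧
      (¬ SameBranch σ τ → (leftRegion τ ∈ leftOf σ ↔ rightRegion τ ∈ leftOf σ)) := by
  obtain ⟨S, hS⟩ := exists_frontier_eq {τ | SameBranch σ τ} (fun h i _ => by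
    have e1 : SameBranch (h, i + 1) (across h i, i + 2) := by
      have := sameBranch_step (e := 1) (by decide) (h, i + 1)
      simp only [step] at this
      rwa [add_sub_cancel_right, add_one_add_one]
        at this
    have e2 : SameBranch (across h i, i + 1) (h, i + 2) := by
      have := sameBranch_step (e := 1) (by decide) (across h i, i + 1)
      simp only [step] at this
      rwa [add_sub_cancel_right, add_one_add_one,
        across_across] at this
    have f1 : SameBranch σ (h, i + 1) ↔ SameBranch σ (across h i, i + 2) :=
      ⟨fun h => h.trans e1, fun h => h.trans e1.symm⟩
    have f2 : SameBranch σ (across h i, i + 1) ↔ SameBranch σ (h, i + 2) :=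
      ⟨fun h => h.trans e2, fun h => h.trans e2.symm⟩
    simp only [Set.mem_ofPred_eq]
    tauto)
  simp only [Set.mem_ofPred_eq] at hS
  wlog hσ : leftRegion σ ∈ S generalizing S
  · refine this Sᶜ (fun τ => ?_) hσ
    rw [hS]; simp only [Set.mem_compl_iff]; tauto
  have hcross : ∀ ρ p q, Separates ρ p q → ¬ SameBranch σ ρ → (p ∈ S ↔ q ∈ S) := by
    intro ρ p q hpq hρ
    have := hS ρ
    rcases separates_iff.1 hpq with ⟨rfl, rfl⟩ | ⟨rfl, rfl⟩ <;> tauto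
  have hleft : ∀ τ, SameBranch σ τ → leftRegion τ ∈ S := by
    intro τ hτ
    refine hτ.induction (P := fun τ => leftRegion τ ∈ S) hσ (fun e he ρ hρ hmem => ?_)
    obtain ⟨π, hπ, -, hsep⟩ := exists_separates_left he ρ
    exact (hcross π _ _ hsep
      (fun h => not_sameBranch_crossing hM he ρ (hρ.symm.trans (h.trans hπ.symm)))).1 hmem
  have hright : ∀ τ, SameBranch σ τ → rightRegion τ ∉ S := fun τ hτ =>
    ((hS τ).1 hτ).1 (hleft τ hτ)
  have hsub : ∀ r ∈ leftOf σ, r ∈ S := by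
    rintro r ⟨τ, hτ, hr⟩
    induction hr with
    | refl => exact hleft τ hτ
    | tail _ hbc ih =>
      obtain ⟨ρ, hρ, hsep⟩ := hbc
      exact (hcross ρ _ _ hsep hρ).1 ih
  have hsup : ∀ r, r ∈ S → r ∈ leftOf σ := by
    refine region_induction (P := fun r => r ∈ S → r ∈ leftOf σ) (r := leftRegion σ)
      (fun _ => ⟨σ, SameBranch.refl σ, .refl⟩) (fun ρ p q hsep hp hq => ?_)
    by_cases hρ : SameBranch σ ρ
    · rcases separates_iff.1 hsep with ⟨rfl, rfl⟩ | ⟨rfl, rfl⟩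
      · exact absurd hq (hright ρ hρ)
      · exact ⟨ρ, hρ, .refl⟩
    · obtain ⟨τ, hτ, hr⟩ := hp ((hcross ρ p q hsep hρ).2 hq)
      exact ⟨τ, hτ, hr.tail ⟨ρ, hρ, hsep⟩⟩
  have heq : leftOf σ = S := Set.ext fun r => ⟨hsub r, hsup r⟩
  rw [heq]
  refine ⟨fun h => ⟨hleft τ h, hright τ h⟩, fun h => hcross τ _ _ (separates_left_right τ) h⟩

lemma left_mem_leftOf (hM : IsNonspherical M) {σ τ : Segment M} (h : SameBranch σ τ) :
    leftRegion τ ∈ leftOf σ := ((mem_leftOf hM σ τ).1 h).1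

lemma right_notMem_leftOf (hM : IsNonspherical M) {σ τ : Segment M} (h : SameBranch σ τ) :
    rightRegion τ ∉ leftOf σ := ((mem_leftOf hM σ τ).1 h).2

lemma mem_leftOf_iff (hM : IsNonspherical M) {σ τ : Segment M} (h : ¬ SameBranch σ τ)
    {p q : Region M} (hpq : Separates τ p q) : p ∈ leftOf σ ↔ q ∈ leftOf σ := by
  have := (mem_leftOf hM σ τ).2 h
  rcases separates_iff.1 hpq with ⟨rfl, rfl⟩ | ⟨rfl, rfl⟩
  · exact this
  · exact this.symm

/-! ### Regions whose boundary is oriented as `L_E` -/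

/-- A union of regions whose boundary has the orientation of `L_E` and whose corners, if any, are
convex and of odd degree. -/
structure LeftAdmissible (Y : Set (Region M)) : Prop where
  left_mem : ∀ σ, rightRegion σ ∈ Y → leftRegion σ ∈ Y
  fill : ∀ h, ¬ IsWhite h → ∀ j k, j ≠ k → cornerOf h j ∈ Y → cornerOf h k ∈ Y →
    Region.middle h ∈ Y

lemma LeftAdmissible.middle_mem {Y : Set (Region M)} (hY : LeftAdmissible Y) {h : M.Group}
    (hw : IsWhite h) {j : Fin 3} (hj : cornerOf h j ∈ Y) : Region.middle h ∈ Y := by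
  have := hY.left_mem (h, j)
  rw [rightRegion_white (by exact hw), leftRegion_white (by exact hw)] at this
  exact this hj

lemma LeftAdmissible.corner_mem {Y : Set (Region M)} (hY : LeftAdmissible Y) {h : M.Group}
    (hb : ¬ IsWhite h) (hm : Region.middle h ∈ Y) (j : Fin 3) : cornerOf h j ∈ Y := by
  have := hY.left_mem (h, j)
  rw [rightRegion_black (by exact hb), leftRegion_black (by exact hb)] at this
  exact this hm

lemma LeftAdmissible.locallyAdmissible {Y : Set (Region M)} (hY : LeftAdmissible Y) (h : M.Group)
    (hw : IsWhite h) (i : Fin 3) : LocallyAdmissible Y h i := by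
  have hb : ¬ IsWhite (across h i) := by rw [isWhite_across]; exact not_not.2 hw
  have n1 : i ≠ i + 1 := (add_ne (by decide) i).symm
  have n2 : i ≠ i + 2 := (add_ne (by decide) i).symm
  have n3 : i + 1 ≠ i + 2 := by simp
  have h1 := hY.middle_mem hw (j := i + 1)
  have h2 := hY.middle_mem hw (j := i + 2)
  have h3 := fun hm => hY.corner_mem hb hm (i + 1)
  have h4 := fun hm => hY.corner_mem hb hm (i + 2)
  have h5 := hY.fill _ hb (i + 1) (i + 2) n3
  rw [cornerOf_across h n1] at h3 h5
  rw [cornerOf_across h n2] at h4 h5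
  unfold LocallyAdmissible
  dsimp only
  generalize (Region.middle h ∈ Y) = a at *
  generalize (Region.middle (across h i) ∈ Y) = b at *
  generalize (cornerOf h (i + 1) ∈ Y) = c at *
  generalize (cornerOf h (i + 2) ∈ Y) = d at *
  clear hw hb n1 n2 n3
  by_cases a <;> by_cases b <;> by_cases c <;> by_cases d <;> simp_all

/-- The local shapes of a polygon at the side of `h` opposite to `i`, for both colors. -/
lemma LocallyAdmissible.shape {Y : Set (Region M)}
    (hY : ∀ h : M.Group, IsWhite h → ∀ i : Fin 3, LocallyAdmissible Y h i) (g : M.Group) {e : Fin 3}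
    (he : e ≠ 0) (i : Fin 3) (hg : IsWhite g) :
    (Region.middle g ∈ Y ∧ Region.middle (across g i) ∈ Y ∧ cornerOf g (i + e) ∈ Y ∧
      cornerOf g (i - e) ∈ Y) ∨
    (Region.middle g ∉ Y ∧ Region.middle (across g i) ∉ Y ∧ cornerOf g (i + e) ∉ Y ∧
      cornerOf g (i - e) ∉ Y) ∨
    (Xor (Region.middle g ∈ Y) (Region.middle (across g i) ∈ Y) ∧
      Xor (cornerOf g (i + e) ∈ Y) (cornerOf g (i - e) ∈ Y)) ∨
    (Region.middle g ∈ Y ∧ Region.middle (across g i) ∉ Y ∧ cornerOf g (i + e) ∉ Y ∧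
      cornerOf g (i - e) ∉ Y) := by
  have h := hY g hg i
  unfold LocallyAdmissible at h
  dsimp only at h
  have a1 : i + 1 = i - 2 := by clear h; revert i; decide
  have a2 : i - 1 = i + 2 := by clear h; revert i; decide
  obtain rfl | rfl := eq_one_or_two he
  · rw [a2]; exact h
  · rw [← a1]
    have hcomm : ∀ P Q : Prop, Xor P Q ↔ Xor Q P := fun P Q => by simp only [Xor]; tauto
    rw [hcomm (cornerOf g (i + 2) ∈ Y), and_comm (a := cornerOf g (i + 2) ∈ Y),
      and_comm (a := cornerOf g (i + 2) ∉ Y)]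
    exact h

/-- If the boundary of a finite union of regions ran against the orientation of `L_E` somewhere,
it would do so forever, as it could not turn. -/
lemma IsDiagram.leftAdmissible (hM : IsNonspherical M) {Y : Set (Region M)} (hY : IsDiagram Y) :
    LeftAdmissible Y := by
  have hs := fun g i hg => LocallyAdmissible.shape hY.admissible g (e := 1) (by decide) i hg
  constructor
  · intro σ hr
    by_contra hl
    have key : ∀ n, rightRegion ((step 1)^[n] σ) ∈ Y ∧ leftRegion ((step 1)^[n] σ) ∉ Y := by
      intro n
      induction n with
      | zero => exact ⟨hr, hl⟩
      | succ n ih =>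
        rw [Function.iterate_succ_apply']
        generalize (step 1)^[n] σ = τ at ih
        obtain ⟨g, j⟩ := τ
        obtain ⟨i, rfl⟩ : ∃ i, j = i + 1 := ⟨j - 1, by simp⟩
        have n1 : i ≠ i + 1 := (add_ne (by decide) i).symm
        have n2 : i ≠ i - 1 := (sub_ne (by decide) i).symm
        have hstep : step 1 (g, i + 1) = (across g i, i - 1) := by
          simp only [step, add_sub_cancel_right, add_add_self]
        by_cases hw : IsWhite g
        · have hb : ¬ IsWhite (across g i) := by rw [isWhite_across]; exact not_not.2 hw
          rw [leftRegion_white (by exact hw), rightRegion_white (by exact hw)] at ih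
          rw [hstep, leftRegion_black (by exact hb), rightRegion_black (by exact hb)]
          simp only at ih ⊢
          rw [cornerOf_across _ n2]
          have := hs g i hw
          simp only [Xor] at this
          tauto
        · have hb : IsWhite (across g i) := by rw [isWhite_across]; exact hw
          rw [leftRegion_black (by exact hw), rightRegion_black (by exact hw)] at ih
          rw [hstep, leftRegion_white (by exact hb), rightRegion_white (by exact hb)]
          simp only at ih ⊢
          have := hs (across g i) i hb
          rw [across_across, cornerOf_across _ n1] at this
          simp only [Xor] at this
          tauto
    obtain ⟨n, hn⟩ := exists_right_notMem hM (e := 1) (by decide) σ hY.finite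
    exact hn (key n).1
  · intro h hb j k hjk hj hk
    obtain ⟨i, hij, hik, hc⟩ : ∃ i : Fin 3, i ≠ j ∧ i ≠ k ∧
        (j = i + 1 ∧ k = i - 1 ∨ j = i - 1 ∧ k = i + 1) := by
      clear hj hk
      revert j k; decide
    have := hs (across h i) i (by rw [isWhite_across]; exact hb)
    rw [across_across] at this
    have n1 : i ≠ i + 1 := (add_ne (by decide) i).symm
    have n2 : i ≠ i - 1 := (sub_ne (by decide) i).symm
    rw [cornerOf_across _ n1, cornerOf_across _ n2] at this
    simp only [Xor] at this
    rcases hc with ⟨rfl, rfl⟩ | ⟨rfl, rfl⟩ <;> tauto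

lemma LeftAdmissible.inter {Y Z : Set (Region M)} (hY : LeftAdmissible Y) (hZ : LeftAdmissible Z) :
    LeftAdmissible (Y ∩ Z) :=
  ⟨fun σ h => ⟨hY.left_mem σ h.1, hZ.left_mem σ h.2⟩,
    fun h hb j k hjk hj hk => ⟨hY.fill h hb j k hjk hj.1 hk.1, hZ.fill h hb j k hjk hj.2 hk.2⟩⟩

lemma leftAdmissible_leftOf (hM : IsNonspherical M) (σ : Segment M) :
    LeftAdmissible (leftOf σ) := by
  constructor
  · intro τ hτ
    by_cases h : SameBranch σ τ
    · exact left_mem_leftOf hM h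
    · exact ((mem_leftOf hM σ τ).2 h).2 hτ
  · intro h hb j k hjk hj hk
    by_contra hm
    have hon : ∀ l, cornerOf h l ∈ leftOf σ → SameBranch σ (h, l) := by
      intro l hl
      by_contra hn
      exact hm ((mem_leftOf_iff hM hn (separates_middle h l)).2 hl)
    have := hM.sameBranch_eq ((hon j hj).symm.trans (hon k hk)) rfl
    exact hjk (congrArg Prod.snd this)

/-- A union of connected components of a left admissible set. -/
lemma LeftAdmissible.of_subset {Y K : Set (Region M)} (hY : LeftAdmissible Y) (hK : K ⊆ Y)
    (hcl : ∀ σ p q, Separates σ p q → p ∈ K → q ∈ Y → q ∈ K) : LeftAdmissible K :=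
  ⟨fun σ h => hcl σ _ _ (separates_right_left σ) h (hY.left_mem σ (hK h)),
    fun h hb j k hjk hj hk => hcl _ _ _ (separates_middle h j).symm hj
      (hY.fill h hb j k hjk (hK hj) (hK hk))⟩

lemma exists_white_cornerOf (h : M.Group) (j : Fin 3) :
    ∃ g, IsWhite g ∧ cornerOf g j = cornerOf h j := by
  by_cases hw : IsWhite h
  · exact ⟨h, hw, rfl⟩
  · exact ⟨across h (j + 1), (isWhite_across _ _).2 hw,
      cornerOf_across h (add_ne (by decide) j)⟩

lemma exists_cornerOf (j : Fin 3) (v : ColoredVertex M j) :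
    ∃ g, Region.corner j v = cornerOf g j := by
  obtain ⟨g, rfl⟩ := QuotientGroup.mk_surjective v
  exact ⟨g, rfl⟩

lemma LeftAdmissible.exists_white {Y : Set (Region M)} (hY : LeftAdmissible Y)
    (hne : Y.Nonempty) : ∃ h, IsWhite h ∧ Region.middle h ∈ Y := by
  have hcor : ∀ h j, cornerOf h j ∈ Y → ∃ h, IsWhite h ∧ Region.middle h ∈ Y := by
    intro h j hj
    obtain ⟨g, hg, hgj⟩ := exists_white_cornerOf h j
    exact ⟨g, hg, hY.middle_mem hg (by rwa [hgj])⟩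
  obtain ⟨r, hr⟩ := hne
  cases r with
  | middle h =>
    by_cases hw : IsWhite h
    · exact ⟨h, hw, hr⟩
    · exact hcor h 0 (hY.corner_mem hw hr 0)
  | corner j v =>
    obtain ⟨h, hh⟩ := exists_cornerOf j v
    exact hcor h j (hh ▸ hr)

/-- The boundary segments of a left admissible union of regions. -/
def boundary (Y : Set (Region M)) : Set (Segment M) := {σ | leftRegion σ ∈ Y ∧ rightRegion σ ∉ Y}

/-- The union of regions `Y` has a convex corner at the midpoint of the side of the white base
triangle `p.1` opposite to its vertex `p.2`. (The pair `p` stands here for a crossing of `L_E`, not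
for a segment. In the direction `e`, the boundary of `Y` arrives at it along the segment
`(p.1, p.2 + e)` and leaves along `(p.1, p.2 - e)`.) -/
def IsCorner (Y : Set (Region M)) (p : Segment M) : Prop :=
  IsWhite p.1 ∧ Region.middle p.1 ∈ Y ∧ ∀ j, j ≠ p.2 → cornerOf p.1 j ∉ Y

lemma IsCorner.mem_boundary {Y : Set (Region M)} {p : Segment M} (hp : IsCorner Y p) {j : Fin 3}
    (hj : j ≠ p.2) : (p.1, j) ∈ boundary Y :=
  ⟨by rw [leftRegion_white (by exact hp.1)]; exact hp.2.1,
    by rw [rightRegion_white (by exact hp.1)]; exact hp.2.2 j hj⟩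

/-- The boundary goes straight along a branch of `L_E` except at the corners. -/
lemma LeftAdmissible.boundary_step {Y : Set (Region M)} (hY : LeftAdmissible Y) {e : Fin 3}
    (he : e ≠ 0) {σ : Segment M} (hσ : σ ∈ boundary Y) :
    step e σ ∈ boundary Y ∨ IsCorner Y (σ.1, σ.2 - e) := by
  obtain ⟨g, j⟩ := σ
  by_cases hw : IsWhite g
  · have hb : ¬ IsWhite (across g (j - e)) := by rw [isWhite_across]; exact not_not.2 hw
    simp only [boundary, Set.mem_ofPred_eq, leftRegion_white (σ := (g, j)) hw,
      rightRegion_white (σ := (g, j)) hw] at hσ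
    by_cases hc : cornerOf g (j + e) ∈ Y
    · left
      simp only [boundary, Set.mem_ofPred_eq, step]
      rw [leftRegion_black (by exact hb), rightRegion_black (by exact hb)]
      simp only
      refine ⟨by rwa [cornerOf_across _ (add_ne_sub he j).symm], fun hm => hσ.2 ?_⟩
      have := hY.corner_mem hb hm j
      rwa [cornerOf_across _ (sub_ne he j)] at this
    · right
      refine ⟨hw, hσ.1, fun k hk => ?_⟩
      simp only at hk ⊢
      obtain rfl | rfl | rfl := eq_of_ne_zero he j k
      · exact absurd rfl hk
      · exact hσ.2
      · exact hc
  · left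
    have hb : IsWhite (across g (j - e)) := by rw [isWhite_across]; exact hw
    simp only [boundary, Set.mem_ofPred_eq, leftRegion_black (σ := (g, j)) hw,
      rightRegion_black (σ := (g, j)) hw] at hσ
    simp only [boundary, Set.mem_ofPred_eq, step]
    rw [leftRegion_white (by exact hb), rightRegion_white (by exact hb)]
    simp only
    rw [cornerOf_across _ (add_ne_sub he j).symm]
    refine ⟨hY.middle_mem hb (j := j) (by rw [cornerOf_across _ (sub_ne he j)]; exact hσ.1),
      fun hc => hσ.2 (hY.fill g hw j (j + e) (add_ne he j).symm hσ.1 hc)⟩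

/-- The straight continuation of the boundary beyond a corner starts outside. -/
lemma IsCorner.left_step_notMem {Y : Set (Region M)} {e : Fin 3}
    {p : Segment M} (hp : IsCorner Y p) (he : e ≠ 0) :
    leftRegion (step e (p.1, p.2 + e)) ∉ Y := by
  have hb : ¬ IsWhite (across p.1 p.2) := by rw [isWhite_across]; exact not_not.2 hp.1
  simp only [step, add_sub_cancel_right, add_add_self]
  rw [leftRegion_black (by exact hb)]
  simp only
  rw [cornerOf_across _ (sub_ne he _).symm]
  exact hp.2.2 _ (sub_ne he _)

/-- In both directions the boundary runs along a branch up to a corner. -/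
lemma LeftAdmissible.exists_corner (hM : IsNonspherical M) {Y : Set (Region M)}
    (hY : LeftAdmissible Y) (hfin : Y.Finite) {e : Fin 3} (he : e ≠ 0) {σ : Segment M}
    (hσ : σ ∈ boundary Y) :
    ∃ m, (∀ k ≤ m, (step e)^[k] σ ∈ boundary Y) ∧
      ∃ p, IsCorner Y p ∧ (p.1, p.2 + e) = (step e)^[m] σ := by
  classical
  have hex : ∃ n, (step e)^[n] σ ∉ boundary Y := by
    obtain ⟨n, hn⟩ := exists_left_notMem hM he σ hfin
    exact ⟨n, fun h => hn h.1⟩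
  have hpos : Nat.find hex ≠ 0 := by
    intro h0
    have := Nat.find_spec hex
    rw [h0] at this
    exact this hσ
  obtain ⟨m, hm⟩ := Nat.exists_eq_succ_of_ne_zero hpos
  refine ⟨m, fun k hk => ?_, (((step e)^[m] σ).1, ((step e)^[m] σ).2 - e), ?_, by simp⟩
  · by_contra hcon
    have := Nat.find_min' hex hcon
    omega
  · have hmem : (step e)^[m] σ ∈ boundary Y := by
      by_contra hcon
      have := Nat.find_min' hex hcon
      omega
    refine (hY.boundary_step he hmem).resolve_left ?_
    have := Nat.find_spec hex
    rwa [hm, Nat.succ_eq_add_one, Function.iterate_succ_apply'] at this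

/-! ### The regions beyond a corner -/

/-- The path in `L_E` that follows, in the direction `e`, the boundary edge that begins at the
corner `p` and its straight continuation, preceded by the straight continuation beyond `p` of the
boundary edge that ends there (traversed backwards). It turns at `p` only. -/
def bentPath (e : Fin 3) (p : Segment M) : Set (Segment M) :=
  {τ | (∃ n, (step e)^[n] (p.1, p.2 - e) = τ) ∨ ∃ n, (step e)^[n + 1] (p.1, p.2 + e) = τ}

lemma bentPath_eq (hM : IsNonspherical M) {e : Fin 3} (he : e ≠ 0) {p τ τ' : Segment M}
    (h : τ ∈ bentPath e p) (h' : τ' ∈ bentPath e p) (heq : τ.1 = τ'.1) : τ = τ' := by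
  rcases h with ⟨n, rfl⟩ | ⟨n, rfl⟩ <;> rcases h' with ⟨m, rfl⟩ | ⟨m, rfl⟩
  · rw [hM.fst_iterate_injective he _ heq]
  · exact absurd heq.symm (hM.fst_rays_ne he _ _ (by omega) _)
  · exact absurd heq (hM.fst_rays_ne he _ _ (by omega) _)
  · rw [hM.fst_iterate_injective he _ heq]

lemma notMem_bentPath (hM : IsNonspherical M) {e : Fin 3} (he : e ≠ 0) {p τ ρ : Segment M}
    (h : τ ∈ bentPath e p) (h1 : ρ.1 = τ.1) (h2 : ρ.2 ≠ τ.2) : ρ ∉ bentPath e p :=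
  fun hρ => h2 (congrArg Prod.snd (bentPath_eq hM he hρ h h1))

lemma step_mem_bentPath {e : Fin 3} {p τ : Segment M} (h : τ ∈ bentPath e p) :
    step e τ ∈ bentPath e p := by
  rcases h with ⟨n, rfl⟩ | ⟨n, rfl⟩
  · exact Or.inl ⟨n + 1, Function.iterate_succ_apply' _ _ _⟩
  · exact Or.inr ⟨n + 1, Function.iterate_succ_apply' _ _ _⟩

lemma mem_bentPath_of_step {e : Fin 3} {p τ : Segment M} (h : step e τ ∈ bentPath e p) :
    τ ∈ bentPath e p ∨ τ = (p.1, p.2 + e) ∨ step e τ = (p.1, p.2 - e) := by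
  rcases h with ⟨_ | n, h⟩ | ⟨n, h⟩
  · exact Or.inr (Or.inr h.symm)
  · rw [Function.iterate_succ_apply'] at h
    exact Or.inl (Or.inl ⟨n, step_injective e h⟩)
  · rw [Function.iterate_succ_apply'] at h
    have h := step_injective e h
    rcases n with _ | n
    · exact Or.inr (Or.inl h.symm)
    · exact Or.inl (Or.inr ⟨n, h⟩)

lemma step_add (e : Fin 3) (h : M.Group) (i : Fin 3) :
    step e (h, i + e) = (across h i, i - e) := by
  simp only [step, add_sub_cancel_right, add_add_self]

lemma step_across_add (e : Fin 3) (h : M.Group) (i : Fin 3) :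
    step e (across h i, i + e) = (h, i - e) := by
  rw [step_add, across_across]

/-- The bent path passes straight through every crossing except for its corner. -/
lemma bentPath_straight {e : Fin 3} {p : Segment M} (hp : IsWhite p.1)
    {h : M.Group} (hw : IsWhite h) {i : Fin 3} (hne : p ≠ (h, i)) :
    ((h, i + e) ∈ bentPath e p ↔ (across h i, i - e) ∈ bentPath e p) ∧
      ((across h i, i + e) ∈ bentPath e p ↔ (h, i - e) ∈ bentPath e p) := by
  have hb : p.1 ≠ across h i := fun heq => by
    rw [heq, isWhite_across] at hp; exact hp hw
  obtain ⟨g, k⟩ := p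
  refine ⟨⟨fun hm => ?_, fun hm => ?_⟩, ⟨fun hm => ?_, fun hm => ?_⟩⟩
  · rw [← step_add]; exact step_mem_bentPath hm
  · rw [← step_add] at hm
    rcases mem_bentPath_of_step hm with h1 | h1 | h1
    · exact h1
    · simp only [Prod.mk.injEq, add_left_inj] at h1
      exact absurd (by rw [h1.1, h1.2]) hne
    · rw [step_add] at h1
      exact absurd (congrArg Prod.fst h1).symm hb
  · rw [← step_across_add]; exact step_mem_bentPath hm
  · rw [← step_across_add] at hm
    rcases mem_bentPath_of_step hm with h1 | h1 | h1
    · exact h1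
    · exact absurd (congrArg Prod.fst h1).symm hb
    · rw [step_across_add] at h1
      simp only [Prod.mk.injEq, sub_left_inj] at h1
      exact absurd (by rw [h1.1, h1.2]) hne

/-- The bent path at a corner `p` of `Y` bounds a part `Q` of the plane, which contains the region
at the end of the side `p` in the direction `e` and lies across the boundary edge from `Y`. -/
structure IsBeyond (e : Fin 3) (p : Segment M) (Q : Set (Region M)) : Prop where
  out_left : ∀ n, leftRegion ((step e)^[n] (p.1, p.2 - e)) ∉ Q
  out_right : ∀ n, rightRegion ((step e)^[n] (p.1, p.2 - e)) ∈ Q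
  in_left : ∀ n, leftRegion ((step e)^[n + 1] (p.1, p.2 + e)) ∈ Q
  in_right : ∀ n, rightRegion ((step e)^[n + 1] (p.1, p.2 + e)) ∉ Q
  off : ∀ τ ∉ bentPath e p, ∀ a b, Separates τ a b → (a ∈ Q ↔ b ∈ Q)

lemma exists_isBeyond (hM : IsNonspherical M) {e : Fin 3} (he : e ≠ 0) {p : Segment M}
    (hp : IsWhite p.1) : ∃ Q, IsBeyond e p Q := by
  obtain ⟨Q, hQ⟩ := exists_frontier_eq (bentPath e p) (fun h i hw => by
    have key : ((h, i + e) ∈ bentPath e p ↔ (across h i, i + e) ∈ bentPath e p) ↔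
        ((h, i - e) ∈ bentPath e p ↔ (across h i, i - e) ∈ bentPath e p) := by
      by_cases hph : p = (h, i)
      · subst hph
        have m1 : (h, i - e) ∈ bentPath e (h, i) := Or.inl ⟨0, rfl⟩
        have m2 : (across h i, i - e) ∈ bentPath e (h, i) := Or.inr ⟨0, step_add e h i⟩
        have m3 : (h, i + e) ∉ bentPath e (h, i) :=
          notMem_bentPath hM he m1 rfl (add_ne_sub he i)
        have m4 : (across h i, i + e) ∉ bentPath e (h, i) :=
          notMem_bentPath hM he m2 rfl (add_ne_sub he i)
        simp only [m1, m2, m3, m4]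
      · have := bentPath_straight (e := e) hp hw hph
        rw [this.1, this.2]
        exact iff_comm
    obtain rfl | rfl := eq_one_or_two he
    · rwa [show i - 1 = i + 2 by rw [sub_eq_add_neg]; rfl] at key
    · rw [show i - 2 = i + 1 by rw [sub_eq_add_neg]; rfl] at key
      exact key.symm)
  wlog h0 : rightRegion (p.1, p.2 - e) ∈ Q generalizing Q
  · refine this Qᶜ (fun τ => ?_) h0
    rw [hQ]; simp only [Set.mem_compl_iff]; tauto
  have hoff : ∀ τ ∉ bentPath e p, ∀ a b, Separates τ a b → (a ∈ Q ↔ b ∈ Q) := by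
    intro τ hτ a b hab
    have := hQ τ
    rcases separates_iff.1 hab with ⟨rfl, rfl⟩ | ⟨rfl, rfl⟩ <;> tauto
  have hside : ∀ τ ρ, τ ∈ bentPath e p →
      (ρ.1 = τ.1 ∧ ρ ≠ τ ∨ ρ.1 = (step e τ).1 ∧ ρ ≠ step e τ) → ρ ∉ bentPath e p := by
    rintro τ ρ hτ (h | h) hρ
    · exact h.2 (bentPath_eq hM he hρ hτ h.1)
    · exact h.2 (bentPath_eq hM he hρ (step_mem_bentPath hτ) h.1)
  have hout : ∀ n, rightRegion ((step e)^[n] (p.1, p.2 - e)) ∈ Q := by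
    intro n
    induction n with
    | zero => exact h0
    | succ n ih =>
      rw [Function.iterate_succ_apply']
      obtain ⟨ρ, -, hρ, hsep⟩ := exists_separates_right he ((step e)^[n] (p.1, p.2 - e))
      exact (hoff ρ (hside _ _ (Or.inl ⟨n, rfl⟩) hρ) _ _ hsep).1 ih
  have hin : ∀ n, leftRegion ((step e)^[n + 1] (p.1, p.2 + e)) ∈ Q := by
    intro n
    induction n with
    | zero =>
      rw [zero_add, Function.iterate_one, step_add, leftRegion_black (by
        rw [isWhite_across]; exact not_not.2 hp)]
      rw [rightRegion_white (by exact hp)] at h0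
      simp only at h0 ⊢
      rwa [cornerOf_across _ (sub_ne he _).symm]
    | succ n ih =>
      rw [Function.iterate_succ_apply']
      obtain ⟨ρ, -, hρ, hsep⟩ := exists_separates_left he ((step e)^[n + 1] (p.1, p.2 + e))
      exact (hoff ρ (hside _ _ (Or.inr ⟨n, rfl⟩) hρ) _ _ hsep).1 ih
  refine ⟨Q, fun n hl => ?_, hout, hin, fun n => ?_, hoff⟩
  · exact ((hQ _).1 (Or.inl ⟨n, rfl⟩)).1 hl (hout n)
  · exact ((hQ _).1 (Or.inr ⟨n, rfl⟩)).1 (hin n)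

/-- The segment `τ` belongs to the boundary edge of `Y` that begins, in the direction `e`, at the
corner `p`. -/
def IsOnEdge (Y : Set (Region M)) (e : Fin 3) (p τ : Segment M) : Prop :=
  ∃ n, (step e)^[n] (p.1, p.2 - e) = τ ∧ ∀ k ≤ n, (step e)^[k] (p.1, p.2 - e) ∈ boundary Y

lemma IsOnEdge.mem_boundary {Y : Set (Region M)} {e : Fin 3} {p τ : Segment M}
    (h : IsOnEdge Y e p τ) : τ ∈ boundary Y := by
  obtain ⟨n, rfl, hn⟩ := h
  exact hn n le_rfl

lemma IsOnEdge.mem_bentPath {Y : Set (Region M)} {e : Fin 3} {p τ : Segment M}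
    (h : IsOnEdge Y e p τ) : τ ∈ bentPath e p := by
  obtain ⟨n, rfl, hn⟩ := h
  exact Or.inl ⟨n, rfl⟩

lemma IsOnEdge.step {Y : Set (Region M)} {e : Fin 3} {p τ : Segment M}
    (h : IsOnEdge Y e p τ) (hτ : step e τ ∈ boundary Y) : IsOnEdge Y e p (step e τ) := by
  obtain ⟨n, rfl, hn⟩ := h
  refine ⟨n + 1, Function.iterate_succ_apply' _ _ _, fun k hk => ?_⟩
  rcases Nat.lt_or_ge k (n + 1) with h | h
  · exact hn k (by omega)
  · obtain rfl : k = n + 1 := by omega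
    rwa [Function.iterate_succ_apply']

lemma IsCorner.isOnEdge {Y : Set (Region M)} {e : Fin 3} (he : e ≠ 0) {p : Segment M}
    (hp : IsCorner Y p) : IsOnEdge Y e p (p.1, p.2 - e) :=
  ⟨0, rfl, fun k hk => by
    obtain rfl : k = 0 := by omega
    exact hp.mem_boundary (sub_ne he _)⟩

lemma LeftAdmissible.exists_isOnEdge (hM : IsNonspherical M) {Y : Set (Region M)}
    (hY : LeftAdmissible Y) (hfin : Y.Finite) {e : Fin 3} (he : e ≠ 0) {σ : Segment M}
    (hσ : σ ∈ boundary Y) : ∃ p, IsCorner Y p ∧ IsOnEdge Y e p σ := by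
  obtain ⟨m, hm, p, hp, hpm⟩ := hY.exists_corner hM hfin (neg_ne_zero.2 he) hσ
  rw [← sub_eq_add_neg] at hpm
  have hback : ∀ k ≤ m, (SeidelDiagram.step e)^[k] (p.1, p.2 - e) =
      (SeidelDiagram.step (-e))^[m - k] σ := by
    intro k hk
    have := iterate_step_neg (-e) k ((SeidelDiagram.step (-e))^[m - k] σ)
    rw [neg_neg, ← Function.iterate_add_apply, show k + (m - k) = m by omega, ← hpm] at this
    exact this
  refine ⟨p, hp, m, by rw [hback m le_rfl]; simp, fun k hk => ?_⟩
  rw [hback k hk]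
  exact hm _ (by omega)

lemma IsOnEdge.unique {Y : Set (Region M)} {e : Fin 3} (he : e ≠ 0) {p p' τ : Segment M}
    (hp : IsCorner Y p) (hp' : IsCorner Y p') (h : IsOnEdge Y e p τ) (h' : IsOnEdge Y e p' τ) :
    p = p' := by
  obtain ⟨n, hn, hn2⟩ := h
  obtain ⟨m, hm, hm2⟩ := h'
  wlog hnm : n ≤ m generalizing p p' n m
  · exact (this hp' hp m hm hm2 n hn hn2 (by omega)).symm
  obtain ⟨d, rfl⟩ := Nat.exists_eq_add_of_le hnm
  rw [← hn, Function.iterate_add_apply] at hm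
  have hd := (step_injective e).iterate n hm
  rcases d with _ | d
  · obtain ⟨g, i⟩ := p
    obtain ⟨g', i'⟩ := p'
    simp only [Function.iterate_zero, id_eq, Prod.mk.injEq, sub_left_inj] at hd
    rw [hd.1, hd.2]
  · rw [Function.iterate_succ_apply'] at hd
    exfalso
    refine hp.left_step_notMem (neg_ne_zero.2 he) ?_
    rw [← sub_eq_add_neg, ← hd, step_neg_step]
    exact (hm2 d (by omega)).1

lemma IsOnEdge.end_unique {Y : Set (Region M)} {e : Fin 3} (he : e ≠ 0) {p q q' : Segment M}
    (hq : IsCorner Y q) (hq' : IsCorner Y q') (h : IsOnEdge Y e p (q.1, q.2 + e))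
    (h' : IsOnEdge Y e p (q'.1, q'.2 + e)) : q = q' := by
  obtain ⟨n, hn, hn2⟩ := h
  obtain ⟨m, hm, hm2⟩ := h'
  wlog hnm : n ≤ m generalizing q q' n m
  · exact (this hq' hq m hm hm2 n hn hn2 (by omega)).symm
  rcases Nat.lt_or_ge n m with hlt | hge
  · exfalso
    refine hq.left_step_notMem he ?_
    rw [← hn, ← Function.iterate_succ_apply' (SeidelDiagram.step e) n]
    exact (hm2 (n + 1) (by omega)).1
  · obtain rfl : n = m := by omega
    obtain ⟨g, i⟩ := q
    obtain ⟨g', i'⟩ := q'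
    have := hn.symm.trans hm
    simp only [Prod.mk.injEq, add_left_inj] at this
    rw [this.1, this.2]

lemma LeftAdmissible.exists_end (hM : IsNonspherical M) {Y : Set (Region M)}
    (hY : LeftAdmissible Y) (hfin : Y.Finite) {e : Fin 3} (he : e ≠ 0) {p : Segment M}
    (hp : IsCorner Y p) : ∃ q, IsCorner Y q ∧ IsOnEdge Y e p (q.1, q.2 + e) := by
  obtain ⟨m, hm, q, hq, hqm⟩ := hY.exists_corner hM hfin he (hp.mem_boundary (sub_ne he p.2))
  exact ⟨q, hq, m, hqm.symm, hm⟩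

/-- The straight continuation of a boundary edge beyond its end does not return to a connected
region. The region and the parts of the plane beyond its boundary edges are glued to a covering of
the plane, in which the region is embedded; this covering has only one sheet, as the plane is simply
connected, and the continuation of the edge lies in a part beyond another edge. -/
theorem LeftAdmissible.left_beyond_corner (hM : IsNonspherical M) {Y : Set (Region M)}
    (hY : LeftAdmissible Y) (hfin : Y.Finite) (hconn : IsConnected Y) {e : Fin 3} (he : e ≠ 0)
    {p : Segment M} (hp : IsCorner Y p) (n : ℕ) :
    leftRegion ((step e)^[n + 1] (p.1, p.2 + e)) ∉ Y := by
  classical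
  have hQ : ∀ p : Segment M, ∃ Q : Set (Region M), IsWhite p.1 → IsBeyond e p Q := fun p => by
    by_cases h : IsWhite p.1
    · obtain ⟨Q, hQ⟩ := exists_isBeyond hM he h
      exact ⟨Q, fun _ => hQ⟩
    · exact ⟨∅, fun h' => absurd h' h⟩
  choose Q hQ using hQ
  have hQ : ∀ p, IsCorner Y p → IsBeyond e p (Q p) := fun p hp => hQ p hp.1
  have hstart : ∀ τ, ∃ p, τ ∈ boundary Y → IsCorner Y p ∧ IsOnEdge Y e p τ := fun τ => by
    by_cases h : τ ∈ boundary Y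
    · obtain ⟨p, hp⟩ := hY.exists_isOnEdge hM hfin he h
      exact ⟨p, fun _ => hp⟩
    · exact ⟨τ, fun h' => absurd h' h⟩
  choose start hstart using hstart
  have hnxt : ∀ p, ∃ q, IsCorner Y p → IsCorner Y q ∧ IsOnEdge Y e p (q.1, q.2 + e) := fun p => by
    by_cases h : IsCorner Y p
    · obtain ⟨p, hp⟩ := hY.exists_end hM hfin he h
      exact ⟨p, fun _ => hp⟩
    · exact ⟨p, fun h' => absurd h' h⟩
  choose nxt hnxt using hnxt
  have hinb : ∀ p, IsCorner Y p → (p.1, p.2 + e) ∈ boundary Y := fun p hp =>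
    hp.mem_boundary (add_ne he _)
  have hnxt_start : ∀ p, IsCorner Y p → nxt (start (p.1, p.2 + e)) = p := fun p hp => by
    have h1 := hstart _ (hinb p hp)
    have h2 := hnxt _ h1.1
    exact h2.2.end_unique he h2.1 hp h1.2
  have hstart_nxt : ∀ p, IsCorner Y p → start ((nxt p).1, (nxt p).2 + e) = p := fun p hp => by
    have h1 := hnxt _ hp
    have h2 := hstart _ (hinb _ h1.1)
    exact h2.2.unique he h2.1 hp h1.2
  -- the covering: the sheet `none` is `Y`, the sheet `some p` is the part beyond the corner `p`
  let In : Region M → Set (Option (Segment M)) := fun r =>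
    {x | (x = none ∧ r ∈ Y) ∨ ∃ p, x = some p ∧ IsCorner Y p ∧ r ∈ Q p}
  let T : Segment M → Option (Segment M) → Option (Segment M) := fun τ x => match x with
    | none => if τ ∈ boundary Y then some (start τ) else none
    | some p => if IsOnEdge Y e p τ then none
      else if ∃ n, (step e)^[n] (p.1, p.2 - e) = τ then some (nxt p)
      else if ∃ n, (step e)^[n + 1] (p.1, p.2 + e) = τ then some (start (p.1, p.2 + e))
      else some p
  have T_none : ∀ τ, τ ∉ boundary Y → T τ none = none := fun τ h => if_neg h
  have T_edge : ∀ τ p, IsCorner Y p → IsOnEdge Y e p τ → T τ none = some p := fun τ p hp h => by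
    have hb := h.mem_boundary
    have : T τ none = some (start τ) := if_pos hb
    rw [this, (hstart τ hb).2.unique he (hstart τ hb).1 hp h]
  have T_edge' : ∀ τ p, IsOnEdge Y e p τ → T τ (some p) = none := fun τ p h => if_pos h
  have T_out : ∀ τ p, ¬ IsOnEdge Y e p τ → (∃ n, (step e)^[n] (p.1, p.2 - e) = τ) →
      T τ (some p) = some (nxt p) := fun τ p h h' => by
    simp only [T]; rw [if_neg h, if_pos h']
  have T_in : ∀ τ p, (∃ n, (step e)^[n + 1] (p.1, p.2 + e) = τ) →
      T τ (some p) = some (start (p.1, p.2 + e)) := fun τ p h => by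
    have h1 : ¬ ∃ n, (step e)^[n] (p.1, p.2 - e) = τ := by
      rintro ⟨m, rfl⟩
      obtain ⟨n, hn⟩ := h
      exact hM.fst_rays_ne he p.1 p.2 (by omega) m (congrArg Prod.fst hn)
    simp only [T]
    rw [if_neg (fun h2 => h1 (by obtain ⟨n, hn, -⟩ := h2; exact ⟨n, hn⟩)), if_neg h1, if_pos h]
  have T_off : ∀ τ p, τ ∉ bentPath e p → T τ (some p) = some p := fun τ p h => by
    simp only [T]
    rw [if_neg (fun h2 => h h2.mem_bentPath), if_neg (fun h2 => h (Or.inl h2)),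
      if_neg (fun h2 => h (Or.inr h2))]
  -- beyond the end of an edge, its straight continuation belongs to the bent path of this end
  have hcont : ∀ p q, IsOnEdge Y e p (q.1, q.2 + e) → ∃ m, ∀ n,
      (step e)^[n + 1] (q.1, q.2 + e) = (step e)^[n + 1 + m] (p.1, p.2 - e) ∧
      (IsCorner Y q → ¬ IsOnEdge Y e p ((step e)^[n + 1] (q.1, q.2 + e))) := by
    rintro p q ⟨m, hm, hm2⟩
    refine ⟨m, fun n => ⟨by rw [Function.iterate_add_apply (step e) (n + 1) m, hm], ?_⟩⟩
    rintro hq ⟨k, hk, hk2⟩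
    rw [← hm, ← Function.iterate_add_apply] at hk
    have hkn := hM.fst_iterate_injective he _ (congrArg Prod.fst hk)
    refine hq.left_step_notMem he ?_
    rw [← hm, ← Function.iterate_succ_apply' (step e) m]
    exact (hk2 (m + 1) (by omega)).1
  have hT : ∀ τ a b, Separates τ a b → ∀ x ∈ In a, T τ x ∈ In b ∧ T τ (T τ x) = x := by
    rintro τ a b hab x (⟨rfl, ha⟩ | ⟨p, rfl, hp, ha⟩)
    · by_cases hb : τ ∈ boundary Y
      · obtain ⟨h1, h2⟩ := hstart τ hb
        rw [T_edge τ _ h1 h2, T_edge' τ _ h2]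
        refine ⟨Or.inr ⟨_, rfl, h1, ?_⟩, rfl⟩
        rcases separates_iff.1 hab with ⟨rfl, rfl⟩ | ⟨rfl, rfl⟩
        · obtain ⟨n, hn, -⟩ := h2
          have := (hQ _ h1).out_right n
          rwa [hn] at this
        · exact absurd ha hb.2
      · rw [T_none τ hb, T_none τ hb]
        refine ⟨Or.inl ⟨rfl, ?_⟩, rfl⟩
        rcases separates_iff.1 hab with ⟨rfl, rfl⟩ | ⟨rfl, rfl⟩
        · by_contra hcon; exact hb ⟨ha, hcon⟩
        · exact hY.left_mem _ ha
    · have hQp := hQ p hp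
      by_cases hτ : τ ∈ bentPath e p
      · rcases hτ with ⟨n, hn⟩ | ⟨n, hn⟩
        · obtain ⟨rfl, rfl⟩ : b = leftRegion τ ∧ a = rightRegion τ := by
            rcases separates_iff.1 hab with ⟨rfl, rfl⟩ | h
            · exact absurd ha (hn ▸ hQp.out_left n)
            · exact h
          by_cases hedge : IsOnEdge Y e p τ
          · rw [T_edge' τ p hedge, T_edge τ p hp hedge]
            exact ⟨Or.inl ⟨rfl, hedge.mem_boundary.1⟩, rfl⟩
          · rw [T_out τ p hedge ⟨n, hn⟩]
            obtain ⟨hq, hpq⟩ := hnxt p hp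
            obtain ⟨m, hm, hm2⟩ := id hpq
            have hmn : m < n := by
              by_contra hcon
              exact hedge ⟨n, hn, fun k hk => hm2 k (by omega)⟩
            have hτ' : (step e)^[n - m - 1 + 1] ((nxt p).1, (nxt p).2 + e) = τ := by
              rw [← hm, ← Function.iterate_add_apply, ← hn]
              congr 2; omega
            rw [T_in τ _ ⟨_, hτ'⟩, hstart_nxt p hp]
            refine ⟨Or.inr ⟨_, rfl, hq, ?_⟩, rfl⟩
            have := (hQ _ hq).in_left (n - m - 1)
            rwa [hτ'] at this
        · obtain ⟨rfl, rfl⟩ : a = leftRegion τ ∧ b = rightRegion τ := by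
            rcases separates_iff.1 hab with h | ⟨rfl, rfl⟩
            · exact h
            · exact absurd ha (hn ▸ hQp.in_right n)
          obtain ⟨hq, hqp⟩ := hstart _ (hinb p hp)
          obtain ⟨m, hm⟩ := hcont _ _ hqp
          obtain ⟨hm1, hm2⟩ := hm n
          rw [hn] at hm1 hm2
          rw [T_in τ p ⟨n, hn⟩, T_out τ _ (hm2 hp) ⟨_, hm1.symm⟩, hnxt_start p hp]
          refine ⟨Or.inr ⟨_, rfl, hq, ?_⟩, rfl⟩
          have := (hQ _ hq).out_right (n + 1 + m)
          rwa [← hm1] at this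
      · rw [T_off τ p hτ, T_off τ p hτ]
        exact ⟨Or.inr ⟨p, rfl, hp, (hQp.off τ hτ a b hab).1 ha⟩, rfl⟩
  -- the edge that ends at a crossing continues in the bent path of its start
  have hpass : ∀ q h i, (h, i + e) ∈ bentPath e q →
      T (across h i, i + e) (some q) = some q := fun q h i hm => by
    refine T_off _ _ (notMem_bentPath hM he (step_mem_bentPath hm) ?_ ?_)
    · rw [step_add]
    · rw [step_add]; exact add_ne_sub he i
  have hpass' : ∀ q h i, (across h i, i + e) ∈ bentPath e q →
      T (across h i, i - e) (some q) = some q := fun q h i hm =>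
    T_off _ _ (notMem_bentPath hM he hm rfl (add_ne_sub he i).symm)
  -- the monodromy around the crossings of `L_E` is trivial
  have hol : ∀ h i, IsWhite h → ∀ x ∈ In (Region.middle h),
      T (across h i, i + e) (T (h, i + e) x) = T (across h i, i - e) (T (h, i - e) x) := by
    rintro h i hw x (⟨rfl, hm⟩ | ⟨p, rfl, hp, hm⟩)
    · have hbl : ¬ IsWhite (across h i) := by rw [isWhite_across]; exact not_not.2 hw
      have n1 : i ≠ i + e := (add_ne he i).symm
      have n2 : i ≠ i - e := (sub_ne he i).symm
      have w : ∀ k, (h, k) ∈ boundary Y ↔ cornerOf h k ∉ Y := fun k => by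
        simp only [boundary, Set.mem_ofPred_eq]
        rw [leftRegion_white (by exact hw), rightRegion_white (by exact hw)]
        simp [hm]
      have b : ∀ k, i ≠ k → ((across h i, k) ∈ boundary Y ↔
          cornerOf h k ∈ Y ∧ Region.middle (across h i) ∉ Y) := fun k hk => by
        simp only [boundary, Set.mem_ofPred_eq]
        rw [leftRegion_black (by exact hbl), rightRegion_black (by exact hbl)]
        simp only [cornerOf_across h hk]
      have bl : Region.middle (across h i) ∈ Y ↔
          cornerOf h (i + e) ∈ Y ∧ cornerOf h (i - e) ∈ Y := by
        rw [← cornerOf_across h n1, ← cornerOf_across h n2]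
        exact ⟨fun h => ⟨hY.corner_mem hbl h _, hY.corner_mem hbl h _⟩,
          fun h => hY.fill _ hbl _ _ (add_ne_sub he i) h.1 h.2⟩
      by_cases c1 : cornerOf h (i + e) ∈ Y <;> by_cases c2 : cornerOf h (i - e) ∈ Y
      · have hbm := bl.2 ⟨c1, c2⟩
        rw [T_none (h, i + e) (by simp [w, c1]), T_none (h, i - e) (by simp [w, c2]),
          T_none _ (by simp [b _ n1, hbm]), T_none _ (by simp [b _ n2, hbm])]
      · have hbm : Region.middle (across h i) ∉ Y := fun h => c2 (bl.1 h).2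
        have hbd : (across h i, i + e) ∈ boundary Y := by simp [b _ n1, hbm, c1]
        obtain ⟨hq, hqe⟩ := hstart _ hbd
        have hqe' := hqe.step (by rw [step_across_add]; simp [w, c2])
        rw [step_across_add] at hqe'
        rw [T_none (h, i + e) (by simp [w, c1]), T_edge _ _ hq hqe, T_edge _ _ hq hqe',
          hpass' _ _ _ hqe.mem_bentPath]
      · have hbm : Region.middle (across h i) ∉ Y := fun h => c1 (bl.1 h).1
        have hbd : (h, i + e) ∈ boundary Y := by simp [w, c1]
        obtain ⟨hq, hqe⟩ := hstart _ hbd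
        have hqe' := hqe.step (by rw [step_add]; simp [b _ n2, c2, hbm])
        rw [step_add] at hqe'
        rw [T_none (h, i - e) (by simp [w, c2]), T_edge _ _ hq hqe, T_edge _ _ hq hqe',
          hpass _ _ _ hqe.mem_bentPath]
      · have hc : IsCorner Y (h, i) := ⟨hw, hm, fun k hk => by
          simp only at hk ⊢
          obtain rfl | rfl | rfl := eq_of_ne_zero he i k
          · exact c2
          · exact absurd rfl hk
          · exact c1⟩
        obtain ⟨hq, hqe⟩ := hstart _ (hinb _ hc)
        rw [T_edge _ _ hc (hc.isOnEdge he), T_edge _ _ hq hqe, hpass _ _ _ hqe.mem_bentPath,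
          T_in _ (h, i) ⟨0, step_add e h i⟩]
    · have hQp := hQ p hp
      have hleft : ∀ k, leftRegion (h, k) ∈ Q p := fun k => by
        rw [leftRegion_white (by exact hw)]; exact hm
      have hph : p ≠ (h, i) := by
        rintro rfl
        exact hQp.out_left 0 (hleft _)
      obtain ⟨s1, s2⟩ := bentPath_straight (e := e) hp.1 hw hph
      -- the region is on the left of the path, so the path runs here along its second half
      have hin : ∀ k, (h, k) ∈ bentPath e p → ∃ n, (step e)^[n + 1] (p.1, p.2 + e) = (h, k) := by
        rintro k (⟨n, hn⟩ | h)
        · exact absurd (hleft k) (hn ▸ hQp.out_left n)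
        · exact h
      obtain ⟨hq, hqp⟩ := hstart _ (hinb p hp)
      obtain ⟨m, hm⟩ := hcont _ _ hqp
      by_cases c1 : (h, i + e) ∈ bentPath e p
      · obtain ⟨n, hn⟩ := hin _ c1
        have hoff : (h, i - e) ∉ bentPath e p :=
          notMem_bentPath hM he c1 rfl (add_ne_sub he i).symm
        rw [T_off _ _ hoff, T_in _ p ⟨n, hn⟩, T_in _ p ⟨n + 1, by
          rw [Function.iterate_succ_apply', hn, step_add]⟩]
        refine hpass _ _ _ (Or.inl ⟨n + 1 + m, ?_⟩)
        rw [← hn, (hm n).1]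
      · by_cases c2 : (h, i - e) ∈ bentPath e p
        · obtain ⟨n, hn⟩ := hin _ c2
          rcases n with _ | n
          · rw [zero_add, Function.iterate_one, step_add] at hn
            have : IsWhite (across p.1 p.2) := by rwa [(Prod.mk.inj hn).1]
            rw [isWhite_across] at this
            exact absurd hp.1 this
          have hn' : (step e)^[n + 1] (p.1, p.2 + e) = (across h i, i + e) := by
            rw [Function.iterate_succ_apply', ← step_across_add] at hn
            exact step_injective e hn
          rw [T_off _ _ c1, T_in _ p ⟨n, hn'⟩, T_in _ p ⟨n + 1, hn⟩]
          refine (hpass' _ _ _ (Or.inl ⟨n + 1 + m, ?_⟩)).symm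
          rw [← hn', (hm n).1]
        · rw [T_off _ _ c1, T_off _ _ c2, T_off _ _ (fun h => c2 (s2.1 h)),
            T_off _ _ (fun h => c1 (s1.2 h))]
  obtain ⟨s, hs1, hs2, hs3⟩ := exists_section In T
    (fun h j x hx => hT _ _ _ (separates_middle h j) x hx)
    (fun h j x hx => hT _ _ _ (separates_middle h j).symm x hx)
    (fun h i hw x hx => by
      have := hol h i hw x hx
      obtain rfl | rfl := eq_one_or_two he
      · rwa [show i - 1 = i + 2 by rw [sub_eq_add_neg]; rfl] at this
      · rw [show i - 2 = i + 1 by rw [sub_eq_add_neg]; rfl] at this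
        exact this.symm) p.1 (x₀ := none) (Or.inl ⟨rfl, hp.2.1⟩)
  have hs : ∀ τ a b, Separates τ a b → s b = T τ (s a) := by
    rintro ⟨h, j⟩ a b (⟨rfl, rfl⟩ | ⟨rfl, rfl⟩)
    · exact hs3 h j
    · simp only
      rw [hs3 h j, (hT (h, j) _ _ (separates_middle h j) _ (hs1 _)).2]
  -- the section is `none` on `Y`, and is constant along the continuation of the edge that
  -- ends at `p`
  have hsY : ∀ r ∈ Y, s r = none := by
    intro r hr
    have := hconn _ hp.2.1 r hr
    induction this with
    | refl => exact hs2
    | tail _ hbc ih =>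
      obtain ⟨hb, hc, τ, hτ⟩ := hbc
      rw [hs τ _ _ hτ, ih hb, T_none]
      rintro ⟨-, hnot⟩
      rcases separates_iff.1 hτ with ⟨-, rfl⟩ | ⟨-, rfl⟩
      · exact hnot hc
      · exact hnot hb
  have hray : s (leftRegion ((step e)^[n + 1] (p.1, p.2 + e))) = some p := by
    induction n with
    | zero =>
      rw [zero_add, Function.iterate_one, step_add, leftRegion_black (by
        rw [isWhite_across]; exact not_not.2 hp.1)]
      simp only
      rw [cornerOf_across _ (sub_ne he _).symm, hs3, hs2]
      exact T_edge _ _ hp (hp.isOnEdge he)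
    | succ n ih =>
      rw [Function.iterate_succ_apply']
      obtain ⟨ρ, -, hρ, hsep⟩ := exists_separates_left he ((step e)^[n + 1] (p.1, p.2 + e))
      rw [hs _ _ _ hsep, ih]
      refine T_off _ _ (fun hmem => ?_)
      have hray : (step e)^[n + 1] (p.1, p.2 + e) ∈ bentPath e p := Or.inr ⟨n, rfl⟩
      rcases hρ with h | h
      · exact h.2 (bentPath_eq hM he hmem hray h.1)
      · exact h.2 (bentPath_eq hM he hmem (step_mem_bentPath hray) h.1)
  intro hmem
  rw [hsY _ hmem] at hray
  exact absurd hray (by simp)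

/-- A branch along a boundary edge of a connected region `Y` follows the edge up to its end and then
stays outside of `Y`. -/
lemma LeftAdmissible.exists_last (hM : IsNonspherical M) {Y : Set (Region M)}
    (hY : LeftAdmissible Y) (hfin : Y.Finite) (hconn : IsConnected Y) {e : Fin 3} (he : e ≠ 0)
    {σ : Segment M} (hσ : σ ∈ boundary Y) :
    ∃ m, (∀ k ≤ m, (step e)^[k] σ ∈ boundary Y) ∧
      ∀ k > m, leftRegion ((step e)^[k] σ) ∉ Y := by
  obtain ⟨m, hm, p, hp, hpm⟩ := hY.exists_corner hM hfin he hσ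
  refine ⟨m, hm, fun k hk => ?_⟩
  have := hY.left_beyond_corner hM hfin hconn he hp (k - m - 1)
  rw [hpm, ← Function.iterate_add_apply] at this
  rwa [show k - m - 1 + 1 + m = k by omega] at this

/-- A branch along the boundary of a connected region does not enter its interior. -/
lemma LeftAdmissible.right_notMem (hM : IsNonspherical M) {Y : Set (Region M)}
    (hY : LeftAdmissible Y) (hfin : Y.Finite) (hconn : IsConnected Y) {σ τ : Segment M}
    (hσ : σ ∈ boundary Y) (h : SameBranch σ τ) : rightRegion τ ∉ Y := by
  obtain ⟨e, he, n, rfl⟩ := h.exists_iterate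
  obtain ⟨m, h1, h2⟩ := hY.exists_last hM hfin hconn he hσ
  rcases Nat.lt_or_ge m n with hlt | hge
  · exact fun h => h2 n hlt (hY.left_mem _ h)
  · exact (h1 n hge).2

/-- A connected region lies on the left of each branch along its boundary. -/
lemma LeftAdmissible.subset_leftOf (hM : IsNonspherical M) {Y : Set (Region M)}
    (hY : LeftAdmissible Y) (hfin : Y.Finite) (hconn : IsConnected Y) {σ : Segment M}
    (hσ : σ ∈ boundary Y) : Y ⊆ leftOf σ := by
  intro r hr
  have := hconn _ hσ.1 r hr
  induction this with
  | refl => exact left_mem_leftOf hM (SameBranch.refl σ)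
  | tail _ hbc ih =>
    obtain ⟨hb, hc, τ, hτ⟩ := hbc
    have hns : ¬ SameBranch σ τ := by
      intro h
      have := hY.right_notMem hM hfin hconn hσ h
      rcases separates_iff.1 hτ with ⟨-, rfl⟩ | ⟨-, rfl⟩
      · exact this hc
      · exact this hb
    exact (mem_leftOf_iff hM hns hτ).1 (ih hb)

/-! ### Connected components of half diagrams -/

/-- The connected component of the region `r` in the set of regions `S`. -/
def component (S : Set (Region M)) (r : Region M) : Set (Region M) :=
  {q | Relation.ReflTransGen (fun p q => p ∈ S ∧ q ∈ S ∧ ∃ σ : Segment M, Separates σ p q) r q}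

lemma mem_component_self (S : Set (Region M)) (r : Region M) : r ∈ component S r := .refl

lemma component_subset {S : Set (Region M)} {r : Region M} (hr : r ∈ S) : component S r ⊆ S := by
  intro q hq
  induction hq with
  | refl => exact hr
  | tail _ hbc _ => exact hbc.2.1

lemma component_closed {S : Set (Region M)} {r : Region M} (hr : r ∈ S) {σ : Segment M}
    {p q : Region M} (h : Separates σ p q) (hp : p ∈ component S r) (hq : q ∈ S) :
    q ∈ component S r :=
  hp.tail ⟨component_subset hr hp, hq, σ, h⟩

lemma mem_component_symm {S : Set (Region M)} {p q : Region M} (h : q ∈ component S p) :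
    p ∈ component S q := by
  induction h with
  | refl => exact .refl
  | tail _ hbc ih =>
    exact Relation.ReflTransGen.head ⟨hbc.2.1, hbc.1, hbc.2.2.imp fun _ h => h.symm⟩ ih

lemma isConnected_of_forall {S : Set (Region M)} (r : Region M)
    (h : ∀ q ∈ S, q ∈ component S r) : IsConnected S :=
  fun p hp q hq => (mem_component_symm (h p hp)).trans (h q hq)

lemma IsConnected.subset_component {K S : Set (Region M)} (hK : IsConnected K) (hKS : K ⊆ S)
    {r : Region M} (hr : r ∈ K) : K ⊆ component S r := by
  intro q hq
  have h := hK r hr q hq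
  clear hq
  induction h with
  | refl => exact .refl
  | tail _ hbc ih => exact Relation.ReflTransGen.tail ih ⟨hKS hbc.1, hKS hbc.2.1, hbc.2.2⟩

lemma isConnected_component (S : Set (Region M)) (r : Region M) :
    IsConnected (component S r) := by
  refine isConnected_of_forall r (fun q hq => ?_)
  induction hq with
  | refl => exact .refl
  | tail hab hbc ih =>
    have hb : _ ∈ component S r := hab
    exact ih.tail ⟨hb, hab.tail hbc, hbc.2.2⟩

/-- The frontier of a finite set of regions is not contained in a single branch. -/
lemma exists_frontier_not_sameBranch (hM : IsNonspherical M) (σ : Segment M) {Z : Set (Region M)}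
    (hfin : Z.Finite) (hne : Z.Nonempty) :
    ∃ ρ p q, Separates ρ p q ∧ p ∈ Z ∧ q ∉ Z ∧ ¬ SameBranch σ ρ := by
  by_contra! hcon
  obtain ⟨ρ, p, q, hsep, hp, hq⟩ : ∃ ρ p q, Separates ρ p q ∧ p ∈ Z ∧ q ∉ Z := by
    by_contra! hall
    obtain ⟨r, hr⟩ := hne
    obtain ⟨n, hn⟩ := exists_left_notMem hM (e := 1) (by decide) σ hfin
    exact hn (region_induction (P := (· ∈ Z)) hr hall _)
  have hσ := hcon ρ p q hsep hp hq
  have hns : ∀ τ, SameBranch ρ τ → ∀ π, SameBranch (crossing 1 τ) π → ¬ SameBranch σ π :=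
    fun τ hτ π hπ h => not_sameBranch_crossing hM (e := 1) (by decide) τ
      ((hτ.symm.trans hσ.symm).trans (h.trans hπ.symm))
  rcases separates_iff.1 hsep with ⟨rfl, -⟩ | ⟨-, rfl⟩
  · obtain ⟨n, hn⟩ := exists_left_notMem hM (e := 1) (by decide) ρ hfin
    refine hn ?_
    clear hn
    induction n with
    | zero => exact hp
    | succ n ih =>
      rw [Function.iterate_succ_apply']
      obtain ⟨π, hπ, -, hs⟩ := exists_separates_left (e := 1) (by decide) ((step 1)^[n] ρ)
      by_contra hnot
      exact hns _ (sameBranch_iterate (by decide) n ρ) π hπ (hcon π _ _ hs ih hnot)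
  · obtain ⟨n, hn⟩ := exists_right_notMem hM (e := 1) (by decide) ρ hfin
    refine hn ?_
    clear hn
    induction n with
    | zero => exact hp
    | succ n ih =>
      rw [Function.iterate_succ_apply']
      obtain ⟨π, hπ, -, hs⟩ := exists_separates_right (e := 1) (by decide) ((step 1)^[n] ρ)
      by_contra hnot
      exact hns _ (sameBranch_iterate (by decide) n ρ) π hπ (hcon π _ _ hs ih hnot)

/-- Cutting a diagram along a branch, the components on the left of the branch are diagrams. Each
piece which is cut off reaches the complement of the diagram without crossing the branch, as its
frontier is not contained in the branch. -/
theorem IsDiagram.component (hM : IsNonspherical M) {X : Set (Region M)} (hX : IsDiagram X)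
    (σ : Segment M) {r : Region M} (hr : r ∈ X ∩ leftOf σ) :
    IsDiagram (component (X ∩ leftOf σ) r) := by
  have hleft : LeftAdmissible (SeidelDiagram.component (X ∩ leftOf σ) r) :=
    ((hX.leftAdmissible hM).inter (leftAdmissible_leftOf hM σ)).of_subset (component_subset hr)
      (fun τ p q hsep hp hq => component_closed hr hsep hp hq)
  set K := SeidelDiagram.component (X ∩ leftOf σ) r with hK
  have hKX : K ⊆ X := fun q hq => (component_subset hr hq).1
  have hXK : Xᶜ ⊆ Kᶜ := Set.compl_subset_compl.2 hKX
  have hout : ∀ q ∈ Kᶜ, ∃ q' ∈ Xᶜ, q' ∈ SeidelDiagram.component Kᶜ q := by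
    intro q hq
    by_cases hqX : q ∈ X
    · set S : Set (Region M) := {x | x ∈ X ∧ (x ∈ leftOf σ ↔ q ∈ leftOf σ)} with hS
      have hqS : q ∈ S := ⟨hqX, Iff.rfl⟩
      have hsub := component_subset hqS
      have hdisj : SeidelDiagram.component S q ⊆ Kᶜ := by
        intro x hx hxK
        by_cases hqL : q ∈ leftOf σ
        · have heq : S = X ∩ leftOf σ := by
            ext y; simp [hS, hqL]
          rw [heq] at hx
          have h1 : SeidelDiagram.component (X ∩ leftOf σ) q ⊆ K := by
            have hxq : x ∈ SeidelDiagram.component (X ∩ leftOf σ) q := hx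
            have hcon := isConnected_component (X ∩ leftOf σ) q
            have := hcon.subset_component (component_subset ⟨hqX, hqL⟩) hxq
            intro y hy
            exact Relation.ReflTransGen.trans hxK (this hy)
          exact hq (h1 (mem_component_self _ _))
        · exact hqL ((hsub hx).2.1 (component_subset hr hxK).2)
      obtain ⟨ρ, p, q', hsep, hp, hq', hρ⟩ := exists_frontier_not_sameBranch hM σ
        (hX.finite.subset (fun x hx => (hsub hx).1)) ⟨q, mem_component_self S q⟩
      have hq'X : q' ∉ X := by
        intro hmem
        refine hq' (component_closed hqS hsep hp ⟨hmem, ?_⟩)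
        rw [← mem_leftOf_iff hM hρ hsep]
        exact (hsub hp).2
      refine ⟨q', hq'X, ?_⟩
      have hpK : p ∈ SeidelDiagram.component Kᶜ q :=
        (isConnected_component S q).subset_component hdisj (mem_component_self S q) hp
      exact component_closed hq hsep hpK (hXK hq'X)
    · exact ⟨q, hqX, mem_component_self _ _⟩
  refine ⟨hX.finite.subset hKX, ⟨r, mem_component_self _ _⟩, isConnected_component _ _, ?_,
    hleft.locallyAdmissible⟩
  intro p hp q hq
  obtain ⟨p', hp', hpp⟩ := hout p hp
  obtain ⟨q', hq', hqq⟩ := hout q hq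
  have hmid : q' ∈ SeidelDiagram.component Kᶜ p' :=
    hX.connected_compl.subset_component hXK hp' hq'
  exact (Relation.ReflTransGen.trans hpp hmid).trans (mem_component_symm hqq)

/-- The middle triangle of a white base triangle is a diagram. -/
lemma isDiagram_middle {h : M.Group} (hw : IsWhite h) :
    IsDiagram {(Region.middle h : Region M)} := by
  have hleft : LeftAdmissible {(Region.middle h : Region M)} := by
    constructor
    · intro σ hσ
      rw [Set.mem_singleton_iff] at hσ
      by_cases hs : IsWhite σ.1
      · rw [rightRegion_white hs] at hσ
        exact absurd hσ (by simp [cornerOf])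
      · rw [rightRegion_black hs, Region.middle.injEq] at hσ
        rw [hσ] at hs
        exact absurd hw hs
    · intro g _ j k _ hj _
      exact absurd hj (by simp [cornerOf])
  refine ⟨Set.finite_singleton _, Set.singleton_nonempty _, ?_, ?_, hleft.locallyAdmissible⟩
  · rintro r rfl s rfl
    exact .refl
  · have hcor : ∀ j, cornerOf h j ∈ ({Region.middle h}ᶜ : Set (Region M)) := fun j => by
      simp [cornerOf]
    have hacr : ∀ i, Region.middle (across h i) ∈ ({Region.middle h}ᶜ : Set (Region M)) := by
      intro i hi
      rw [Set.mem_singleton_iff, Region.middle.injEq] at hi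
      have := isWhite_across h i
      rw [hi] at this
      exact iff_not_self this
    refine isConnected_of_forall (cornerOf h 0) ?_
    refine region_induction (P := fun q => q ∈ ({Region.middle h}ᶜ : Set (Region M)) →
      q ∈ SeidelDiagram.component {Region.middle h}ᶜ (cornerOf h 0)) (r := cornerOf h 0)
      (fun _ => mem_component_self _ _) (fun σ p q hsep hp hq => ?_)
    by_cases hpm : p = Region.middle h
    · subst hpm
      obtain ⟨j, rfl⟩ : ∃ j, q = cornerOf h j := by
        rcases hsep with ⟨h1, h2⟩ | ⟨h1, h2⟩
        · rw [Region.middle.injEq] at h1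
          exact ⟨σ.2, by rw [h1]; exact h2⟩
        · exact absurd h2 (by simp [cornerOf])
      obtain ⟨i, hi0, hij⟩ : ∃ i : Fin 3, i ≠ 0 ∧ i ≠ j := by
        clear hsep hp hq
        revert j; decide
      have h1 := component_closed (hcor 0) (separates_across h hi0)
        (mem_component_self _ _) (hacr i)
      have h2 := (separates_across h hij).symm
      exact component_closed (hcor 0) h2 h1 (hcor j)
    · exact component_closed (hcor 0) hsep (hp hpm) hq

lemma isBasic_middle {h : M.Group} (hw : IsWhite h) :
    IsBasic {(Region.middle h : Region M)} := by
  refine ⟨isDiagram_middle hw, .white h hw, ?_⟩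
  ext v
  cases v with
  | white g hg => simp [interiorVertices, ZVertex.region]
  | colored j v => simp [interiorVertices, ZVertex.region]

/-! ### Diagrams cut along a branch -/

/-- If the branch through an interior segment `τ₀` of `X` cuts the left part of `X` into several
pieces, then the branch leaves `X` and comes back. -/
lemma IsDiagram.exists_reentry (hM : IsNonspherical M) {X : Set (Region M)} (hX : IsDiagram X)
    {τ₀ : Segment M} (hτ₀ : rightRegion τ₀ ∈ X) (hcon : ¬ IsConnected (X ∩ leftOf τ₀)) :
    ∃ e : Fin 3, e ≠ 0 ∧ ∃ m, (∀ k ≤ m, rightRegion ((step e)^[k] τ₀) ∈ X) ∧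
      rightRegion ((step e)^[m + 1] τ₀) ∉ X ∧ ∃ n > m, rightRegion ((step e)^[n] τ₀) ∈ X := by
  classical
  have hL := hX.leftAdmissible hM
  have hex : ∃ e : Fin 3, e ≠ 0 ∧ ∃ n, rightRegion ((step e)^[n] τ₀) ∈ X ∧
      ∃ k ≤ n, rightRegion ((step e)^[k] τ₀) ∉ X := by
    by_contra! hall
    apply hcon
    have hmem : ∀ τ, SameBranch τ₀ τ → rightRegion τ ∈ X → leftRegion τ ∈ X ∩ leftOf τ₀ :=
      fun τ h1 h2 => ⟨hL.left_mem τ h2, left_mem_leftOf hM h1⟩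
    have h0 := hmem τ₀ (SameBranch.refl _) hτ₀
    refine isConnected_of_forall (leftRegion τ₀) ?_
    rintro q ⟨hq, hqL⟩
    have hpath := hX.connected _ (hL.left_mem τ₀ hτ₀) q hq
    induction hpath with
    | refl => exact mem_component_self _ _
    | @tail b c _ hbc ih =>
      obtain ⟨hb, hc, ρ, hρ⟩ := hbc
      by_cases hsb : SameBranch τ₀ ρ
      · obtain ⟨rfl, rfl⟩ : c = leftRegion ρ ∧ b = rightRegion ρ := by
          rcases separates_iff.1 hρ with ⟨-, rfl⟩ | h
          · exact absurd hqL (right_notMem_leftOf hM hsb)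
          · exact h
        obtain ⟨e, he, n, rfl⟩ := hsb.exists_iterate
        have hall' := hall e he n hb
        have key : ∀ k ≤ n, leftRegion ((step e)^[k] τ₀) ∈
            SeidelDiagram.component (X ∩ leftOf τ₀) (leftRegion τ₀) := by
          intro k
          induction k with
          | zero => exact fun _ => mem_component_self _ _
          | succ k ihk =>
            intro hk
            obtain ⟨π, -, -, hsep⟩ := exists_separates_left he ((step e)^[k] τ₀)
            rw [← Function.iterate_succ_apply' (step e) k] at hsep
            exact component_closed h0 hsep (ihk (by omega))
              (hmem _ (sameBranch_iterate he _ _) (hall' _ hk))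
        exact key n le_rfl
      · have hbL := (mem_leftOf_iff hM hsb hρ).2 hqL
        exact component_closed h0 hρ (ih hb hbL) ⟨hc, hqL⟩
  obtain ⟨e, he, n, hn, k, hk, hkX⟩ := hex
  have hex' : ∃ k, rightRegion ((step e)^[k] τ₀) ∉ X := ⟨k, hkX⟩
  obtain ⟨m, hm⟩ : ∃ m, Nat.find hex' = m + 1 := by
    refine Nat.exists_eq_succ_of_ne_zero fun h0 => ?_
    have := Nat.find_spec hex'
    rw [h0] at this
    exact this hτ₀
  refine ⟨e, he, m, fun j hj => ?_, hm ▸ Nat.find_spec hex', n, ?_, hn⟩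
  · by_contra hcon
    have := Nat.find_min' hex' hcon
    omega
  · have := Nat.find_min' hex' hkX
    omega

/-- If a branch leaves a diagram and comes back, then it crosses twice the branch along which it
leaves; so the cone order of the side where it leaves is two. -/
lemma IsDiagram.exists_boundary_crossing (hM : IsNonspherical M) {X : Set (Region M)}
    (hX : IsDiagram X) {e : Fin 3} (he : e ≠ 0) {σ : Segment M} (hσ : rightRegion σ ∈ X)
    (hstep : rightRegion (step e σ) ∉ X) {n : ℕ} (hn : rightRegion ((step e)^[n + 1] σ) ∈ X) :
    coneOrder M (σ.2 - e) = 2 ∧ ∃ ρ ∈ boundary X, SameBranch (crossing e σ) ρ := by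
  have hL := hX.leftAdmissible hM
  have hleft : leftRegion (step e σ) ∉ X := by
    intro h
    exact hL.right_notMem hM hX.finite hX.connected ⟨h, hstep⟩ (sameBranch_step he σ).symm hσ
  obtain ⟨ρ, hρ, -, hsep⟩ := exists_separates_left he σ
  have hρX : ρ ∈ boundary X := by
    rcases separates_iff.1 hsep with ⟨h1, h2⟩ | ⟨h1, h2⟩
    · exact ⟨h1 ▸ hL.left_mem σ hσ, h2 ▸ hleft⟩
    · exact absurd (hL.left_mem ρ (h2 ▸ hL.left_mem σ hσ)) (h1 ▸ hleft)
  have hsub := hL.subset_leftOf hM hX.finite hX.connected hρX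
  refine ⟨?_, ρ, hρX, hρ⟩
  -- the branch has to return to the left side of the boundary branch
  obtain ⟨k, hk1, hk2⟩ : ∃ k, leftRegion ((step e)^[k + 1] σ) ∉ leftOf ρ ∧
      leftRegion ((step e)^[k + 1 + 1] σ) ∈ leftOf ρ := by
    by_contra! hall
    have : ∀ k, leftRegion ((step e)^[k + 1] σ) ∉ leftOf ρ := by
      intro k
      induction k with
      | zero =>
        intro h
        rcases separates_iff.1 hsep with ⟨-, h2⟩ | ⟨h1, h2⟩
        · rw [zero_add, Function.iterate_one, h2] at h
          exact right_notMem_leftOf hM (SameBranch.refl ρ) h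
        · rw [h1] at hleft
          exact hleft hρX.1
      | succ k ih => exact hall k ih
    exact this n (hsub (hL.left_mem _ hn))
  obtain ⟨π, hπ, -, hsep'⟩ := exists_separates_left he ((step e)^[k + 1] σ)
  rw [← Function.iterate_succ_apply' (step e)] at hsep'
  have hρπ : SameBranch ρ π := by
    by_contra hnot
    exact hk1 ((mem_leftOf_iff hM hnot hsep').2 hk2)
  exact hM.coneOrder_eq_two he σ (by omega) ((hρ.trans hρπ).trans hπ.symm)

/-! ### Two branches which cross at a side of cone order two -/

lemma across_comm {i e : Fin 3} (he : e ≠ 0) (h2 : coneOrder M i = 2) (g : M.Group) :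
    across (across g (i + e)) (i - e) = across (across g (i - e)) (i + e) := by
  have hord : M (i + e) (i - e) = 2 := by
    obtain rfl | rfl := eq_one_or_two he
    · rw [show i - 1 = i + 2 by rw [sub_eq_add_neg]; rfl]; exact h2
    · rw [show i - 2 = i + 1 by rw [sub_eq_add_neg]; rfl, M.symmetric]; exact h2
  have h := M.toCoxeterSystem.simple_mul_simple_pow (i + e) (i - e)
  rw [hord, pow_two, M.toCoxeterSystem_simple] at h
  have h' := eq_inv_of_mul_eq_one_left h
  have hinv : ∀ k, (M.simple k)⁻¹ = M.simple k := fun k => by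
    rw [← M.toCoxeterSystem_simple]; exact M.toCoxeterSystem.inv_simple k
  rw [mul_inv_rev, hinv, hinv] at h'
  simp only [across, mul_assoc, h']

lemma step_neg_sub (e : Fin 3) (h : M.Group) (i : Fin 3) :
    step (-e) (h, i - e) = (across h i, i + e) := by
  simp only [step, sub_neg_eq_add, sub_add_cancel, ← sub_eq_add_neg, sub_sub_self']

lemma step_sub (e : Fin 3) (h : M.Group) (i : Fin 3) :
    step e (h, i - e) = (across h (i + e), i) := by
  simp only [step, sub_add_cancel, sub_sub_self']

lemma step_mid (e : Fin 3) (h : M.Group) (i : Fin 3) :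
    step e (h, i) = (across h (i - e), i + e) := rfl

lemma step_neg_add (e : Fin 3) (h : M.Group) (i : Fin 3) :
    step (-e) (h, i + e) = (across h (i - e), i) := by
  simp only [step, sub_neg_eq_add, ← sub_eq_add_neg, add_sub_cancel_right, add_add_self]

lemma step_neg_mid (e : Fin 3) (h : M.Group) (i : Fin 3) :
    step (-e) (h, i) = (across h (i + e), i - e) := by
  simp only [step, sub_neg_eq_add, ← sub_eq_add_neg]

/-- Two branches which cross at a side opposite to a vertex of cone order two cross again and again,
and bound bigons which lie alternately on the left of both and on the right of both. -/
lemma left_eq_or_right_eq {i e : Fin 3} (he : e ≠ 0) (h2 : coneOrder M i = 2) (n : ℕ)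
    (g : M.Group) :
    leftRegion ((step e)^[n] (g, i + e)) = leftRegion ((step (-e))^[n] (g, i - e)) ∨
      rightRegion ((step e)^[n] (g, i + e)) = rightRegion ((step (-e))^[n] (g, i - e)) := by
  have hsame : ∀ (g : M.Group) (j k : Fin 3), leftRegion (g, j) = leftRegion (g, k) ∨
      rightRegion (g, j) = rightRegion (g, k) := by
    intro g j k
    by_cases hw : IsWhite g
    · left; rw [leftRegion_white (by exact hw), leftRegion_white (by exact hw)]
    · right; rw [rightRegion_black (by exact hw), rightRegion_black (by exact hw)]
  induction n using Nat.strong_induction_on generalizing g with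
  | _ n ih =>
    match n with
    | 0 => exact hsame _ _ _
    | 1 =>
      rw [Function.iterate_one, Function.iterate_one, step_add, step_neg_sub]
      exact hsame _ _ _
    | 2 =>
      simp only [Function.iterate_succ_apply, Function.iterate_zero, id_eq]
      rw [step_add, step_neg_sub, step_sub, step_neg_add]
      have hc : cornerOf (across (across g i) (i + e)) i =
          cornerOf (across (across g i) (i - e)) i := by
        rw [cornerOf_across _ (add_ne he i), cornerOf_across _ (sub_ne he i)]
      by_cases hw : IsWhite g
      · right
        rw [rightRegion_white (by simp only [isWhite_across]; tauto),
          rightRegion_white (by simp only [isWhite_across]; tauto)]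
        exact hc
      · left
        rw [leftRegion_black (by simp only [isWhite_across]; tauto),
          leftRegion_black (by simp only [isWhite_across]; tauto)]
        exact hc
    | n + 3 =>
      rw [Function.iterate_succ_apply, Function.iterate_succ_apply, Function.iterate_succ_apply,
        Function.iterate_succ_apply, Function.iterate_succ_apply, Function.iterate_succ_apply,
        step_add, step_neg_sub, step_sub, step_neg_add, step_mid, step_neg_mid,
        across_comm he h2]
      exact ih n (by omega) _

/-- Around a vertex of cone order two there are four base triangles. -/
lemma eq_of_cornerOf_eq {i e : Fin 3} (he : e ≠ 0) (h2 : coneOrder M i = 2) {g u : M.Group}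
    (h : cornerOf u i = cornerOf g i) : g = u ∨ g = across u (i + e) ∨ g = across u (i - e) ∨
      g = across (across u (i + e)) (i - e) := by
  refine cornerOf_induction (P := fun g => g = u ∨ g = across u (i + e) ∨ g = across u (i - e) ∨
      g = across (across u (i + e)) (i - e)) h (Or.inl rfl) (fun g k hk hg => ?_)
  have hk : k = i + e ∨ k = i - e := by
    rcases eq_of_ne_zero he i k with h | h | h
    · exact Or.inr h
    · exact absurd h hk
    · exact Or.inl h
  rcases hg with rfl | rfl | rfl | rfl <;> rcases hk with rfl | rfl
  · simp
  · simp
  · simp [across_across]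
  · simp
  · simp [across_comm he h2]
  · simp [across_across]
  · simp [across_comm he h2, across_across]
  · simp [across_across]

/-- Suppose that the branch through `(u, i + e)` leaves the diagram `X` at the side `i` of `u` by
crossing the branch of `(u, i - e)`, and comes back later. Then a component of the left part of `X`
is contained in one bigon of the two branches, and is not a maximal subdiagram: a branch crossing
the second one along the neighboring bigon cuts `X` into smaller pieces one of which contains this
component properly. -/
lemma IsDiagram.exists_between (hM : IsNonspherical M) {X : Set (Region M)} (hX : IsDiagram X)
    {i e : Fin 3} (he : e ≠ 0) (h2 : coneOrder M i = 2) {u : M.Group} (hu : IsWhite u)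
    (hν : (u, i - e) ∈ boundary X) {n : ℕ} (hn : 1 ≤ n)
    (hre : rightRegion ((step e)^[n] (u, i + e)) ∈ X) {m : ℕ}
    (hint : ∀ k ≤ m, rightRegion ((step (-e))^[k] (u, i + e)) ∈ X) {τ₀ : Segment M}
    (hτ₀ : (step (-e))^[m] (u, i + e) = τ₀) :
    ∃ Z, IsDiagram Z ∧ SeidelDiagram.component (X ∩ leftOf τ₀) (leftRegion τ₀) ⊂ Z ∧ Z ⊂ X := by
  have hL := hX.leftAdmissible hM
  have he' : -e ≠ 0 := neg_ne_zero.2 he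
  have nadd : i + e ≠ i := add_ne he i
  have nsub : i - e ≠ i := sub_ne he i
  have hN : ∀ τ, SameBranch (u, i - e) τ → rightRegion τ ∉ X := fun τ h =>
    hL.right_notMem hM hX.finite hX.connected hν h
  have hNback : ∀ k, rightRegion ((step (-e))^[k] (u, i - e)) ∉ X := fun k =>
    hN _ (sameBranch_iterate he' _ _)
  have hNforw : ∀ k, rightRegion ((step e)^[k] (u, i - e)) ∉ X := fun k =>
    hN _ (sameBranch_iterate he _ _)
  set ur := across (across u (i + e)) (i - e) with hur
  have hur_white : IsWhite ur := by rw [hur, isWhite_across, isWhite_across]; exact not_not.2 hu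
  -- the segments of the two branches along the bigon of `u`, in the direction of `(u, i - e)`
  have ν1 : step e (u, i - e) = (across u (i + e), i) := step_sub e u i
  have ν2 : step e (across u (i + e), i) = (ur, i + e) := rfl
  have l1 : step (-e) (u, i + e) = (across u (i - e), i) := step_neg_add e u i
  have l2 : step (-e) (across u (i - e), i) = (ur, i - e) := by
    rw [step_neg_mid, hur, across_comm he h2]
  have hm : m ≤ 2 := by
    by_contra hm
    have h3 := hint 3 (by omega)
    have h3' := hNforw 3
    simp only [Function.iterate_succ_apply, Function.iterate_zero, id_eq] at h3 h3'
    rw [l1, l2, step_neg_sub] at h3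
    rw [ν1, ν2, step_add] at h3'
    have hb : ¬ IsWhite (across ur i) := by rw [isWhite_across]; exact not_not.2 hur_white
    rw [rightRegion_black (by exact hb)] at h3 h3'
    exact h3' h3
  -- in the other direction, the re-entry of the branch forces a long boundary edge
  set v := across (across u i) (i - e) with hv
  set w := across v (i + e) with hw
  have hv_white : IsWhite v := by rw [hv, isWhite_across, isWhite_across]; exact not_not.2 hu
  have hw_black : ¬ IsWhite w := by rw [hw, isWhite_across]; exact not_not.2 hv_white
  have ν1' : step (-e) (u, i - e) = (across u i, i + e) := step_neg_sub e u i
  have ν2' : step (-e) (across u i, i + e) = (v, i) := step_neg_add e _ i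
  have ν3' : step (-e) (v, i) = (w, i - e) := step_neg_mid e v i
  have hn3 : 3 ≤ n := by
    by_contra hlt
    have hb : ¬ IsWhite (across u i) := by rw [isWhite_across]; exact not_not.2 hu
    obtain rfl | rfl : n = 1 ∨ n = 2 := by omega
    · have h1 := hNback 1
      rw [Function.iterate_one, ν1', rightRegion_black (by exact hb)] at h1
      rw [Function.iterate_one, step_add, rightRegion_black (by exact hb)] at hre
      exact h1 hre
    · have h1 := hNback 2
      simp only [Function.iterate_succ_apply, Function.iterate_zero, id_eq] at h1 hre
      rw [ν1', ν2', rightRegion_white (by exact hv_white)] at h1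
      rw [step_add, step_sub, rightRegion_white (by
        simp only [isWhite_across]; exact not_not.2 hu)] at hre
      simp only at h1 hre
      rw [hv, cornerOf_across _ nsub] at h1
      rw [cornerOf_across _ nadd] at hre
      exact h1 hre
  have hνn : leftRegion ((step (-e))^[n] (u, i - e)) ∈ X := by
    rcases left_eq_or_right_eq he h2 n u with h | h
    · rw [← h]; exact hL.left_mem _ hre
    · rw [h] at hre; exact absurd hre (hNback n)
  obtain ⟨m', hm1, hm2⟩ := hL.exists_last hM hX.finite hX.connected he' hν
  have hm' : n ≤ m' := by
    by_contra hlt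
    exact hm2 n (by omega) hνn
  have b2 := hm1 2 (by omega)
  have b3 := hm1 3 (by omega)
  simp only [Function.iterate_succ_apply, Function.iterate_zero, id_eq] at b2 b3
  rw [ν1', ν2'] at b2
  rw [ν1', ν2', ν3'] at b3
  -- the branch through `(v, i - e)`, which crosses the edge at its segment `(w, i - e)`
  have hvX : Region.middle v ∈ X := by
    have := b2.1
    rwa [leftRegion_white (by exact hv_white)] at this
  have hvX' : rightRegion (v, i - e) ∈ X := by
    have := b3.1
    rw [leftRegion_black (by exact hw_black)] at this
    rw [rightRegion_white (by exact hv_white)]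
    simp only at this ⊢
    rwa [hw, cornerOf_across _ (add_ne_sub he i)] at this
  have hcr : SameBranch (w, i) (v, i - e) := by
    have := sameBranch_crossing' he (w, i - e)
    simp only [crossing, sub_add_cancel, sub_sub_self'] at this
    rwa [hw, across_across] at this
  have hforw : ∀ k, (step e)^[k + 1] (w, i - e) = (step e)^[k] (v, i) := fun k => by
    rw [Function.iterate_succ_apply, step_sub, hw, across_across]
  have hnotcr : ∀ k, ¬ SameBranch (v, i - e) (crossing e ((step e)^[k] (v, i))) := by
    intro k h
    have hc : crossing e (w, i - e) = (w, i) := by simp [crossing]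
    have := hM.coneOrder_eq_two he (w, i - e) (n := k + 1) (by omega)
      (by rw [hc, hforw]; exact hcr.trans h)
    rw [show ((w, i - e) : Segment M).2 - e = i + e from sub_sub_self' e i] at this
    exact hM.ne_two nadd this h2
  have hside : ∀ k, leftRegion ((step e)^[k] (v, i)) ∈ leftOf (v, i - e) := by
    intro k
    induction k with
    | zero =>
      have := left_mem_leftOf hM (SameBranch.refl (v, i - e))
      rw [leftRegion_white (by exact hv_white)] at this
      rw [Function.iterate_zero, id_eq, leftRegion_white (by exact hv_white)]
      exact this
    | succ k ih =>
      rw [Function.iterate_succ_apply']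
      obtain ⟨π, hπ, -, hsep⟩ := exists_separates_left he ((step e)^[k] (v, i))
      exact (mem_leftOf_iff hM (fun h => hnotcr k (h.trans hπ.symm)) hsep).1 ih
  have hν0 : (step e)^[2] (v, i) = (u, i - e) := by
    have hν1 : step e (v, i) = (across u i, i + e) := by rw [step_mid, hv, across_across]
    simp only [Function.iterate_succ_apply, Function.iterate_zero, id_eq]
    rw [hν1, step_across_add]
  have hside0 : Region.middle u ∈ leftOf (v, i - e) := by
    have := hside 2
    rwa [hν0, leftRegion_white (by exact hu)] at this
  have hside1 : cornerOf u i ∈ leftOf (v, i - e) := by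
    have := hside 3
    rw [Function.iterate_succ_apply', hν0, ν1, leftRegion_black (by
      rw [isWhite_across]; exact not_not.2 hu)] at this
    simp only at this
    rwa [cornerOf_across _ nadd] at this
  have hside2 : Region.middle ur ∈ leftOf (v, i - e) := by
    have := hside 4
    rwa [Function.iterate_succ_apply', Function.iterate_succ_apply', hν0, ν1, ν2,
      leftRegion_white (by exact hur_white)] at this
  -- the component of `τ₀` lies in the bigon of `u`
  set K := SeidelDiagram.component (X ∩ leftOf τ₀) (leftRegion τ₀) with hK
  have hτX : rightRegion τ₀ ∈ X := hτ₀ ▸ hint m le_rfl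
  have hτmem : leftRegion τ₀ ∈ X ∩ leftOf τ₀ :=
    ⟨hL.left_mem _ hτX, left_mem_leftOf hM (SameBranch.refl _)⟩
  have hτl : SameBranch τ₀ (u, i + e) := hτ₀ ▸ (sameBranch_iterate he' m _).symm
  have hτl1 : SameBranch τ₀ (across u (i - e), i) := by
    have := sameBranch_step he' (u, i + e)
    rw [l1] at this
    exact hτl.trans this
  have hτl2 : SameBranch τ₀ (ur, i - e) := by
    have := sameBranch_step he' (across u (i - e), i)
    rw [l2] at this
    exact hτl1.trans this
  have hcur : cornerOf ur i = cornerOf u i := by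
    rw [hur, cornerOf_across _ nsub, cornerOf_across _ nadd]
  have hbase : leftRegion τ₀ = Region.middle u ∨ leftRegion τ₀ = cornerOf u i ∨
      leftRegion τ₀ = Region.middle ur := by
    rw [← hτ₀]
    obtain rfl | rfl | rfl : m = 0 ∨ m = 1 ∨ m = 2 := by omega
    · left; exact leftRegion_white hu
    · right; left
      rw [Function.iterate_one, l1, leftRegion_black (by rw [isWhite_across]; exact not_not.2 hu)]
      exact cornerOf_across _ nsub
    · right; right
      rw [Function.iterate_succ_apply, Function.iterate_one, l1, l2]
      exact leftRegion_white hur_white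
  have hbigon : ∀ q ∈ K, q = Region.middle u ∨ q = cornerOf u i ∨ q = Region.middle ur := by
    intro q hq
    induction hq with
    | refl => exact hbase
    | @tail b c _ hbc ih =>
      obtain ⟨-, ⟨hcX, hcL⟩, ρ, hρ⟩ := hbc
      have hsb : ∀ π : Segment M, SameBranch τ₀ π → c ≠ rightRegion π := by
        rintro π hπ rfl
        exact right_notMem_leftOf hM hπ hcL
      have hsb' : ∀ π : Segment M, SameBranch (u, i - e) π → c ≠ rightRegion π := by
        rintro π hπ rfl
        exact hN π hπ hcX
      have hν1 : SameBranch (u, i - e) (across u (i + e), i) := ν1 ▸ sameBranch_step he _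
      have hν2 : SameBranch (u, i - e) (ur, i + e) := hν1.trans (ν2 ▸ sameBranch_step he _)
      -- the neighbors of the middle triangle of a white base triangle
      have hmid : ∀ g, IsWhite g → b = Region.middle g → ∃ j, c = rightRegion (g, j) ∧
          c = cornerOf g j := by
        rintro g hg rfl
        rcases hρ with ⟨h1, h2⟩ | ⟨h1, h2⟩
        · rw [Region.middle.injEq] at h1
          subst h1
          exact ⟨ρ.2, by rw [rightRegion_white (by exact hg)]; exact h2, h2⟩
        · exact absurd h2 (by simp [cornerOf])
      rcases ih with hb | hb | hb
      · obtain ⟨j, hj1, hj2⟩ := hmid u hu hb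
        obtain rfl | rfl | rfl := eq_of_ne_zero he i j
        · exact absurd hj1 (hsb' _ (SameBranch.refl _))
        · exact Or.inr (Or.inl hj2)
        · exact absurd hj1 (hsb _ hτl)
      · subst hb
        obtain ⟨g, hg, rfl, hρg⟩ : ∃ g, cornerOf u i = cornerOf g i ∧ c = Region.middle g ∧
            ρ = (g, i) := by
          rcases hρ with ⟨h1, -⟩ | ⟨h1, h2⟩
          · exact absurd h1 (by simp [cornerOf])
          · have hi : ρ.2 = i := by
              have := h2
              simp only [cornerOf, Region.corner.injEq] at this
              exact this.1.symm
            refine ⟨ρ.1, ?_, h1, Prod.ext rfl hi⟩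
            rw [h2, hi]
        have hblack : ∀ k, ¬ IsWhite (across u k) := fun k => by
          rw [isWhite_across]; exact not_not.2 hu
        rcases eq_of_cornerOf_eq he h2 hg with rfl | rfl | rfl | rfl
        · exact Or.inl rfl
        · exact absurd (rightRegion_black (σ := (_, i)) (hblack _)).symm (hsb' _ hν1)
        · exact absurd (rightRegion_black (σ := (_, i)) (hblack _)).symm (hsb _ hτl1)
        · exact Or.inr (Or.inr rfl)
      · obtain ⟨j, hj1, hj2⟩ := hmid ur hur_white hb
        obtain rfl | rfl | rfl := eq_of_ne_zero he i j
        · exact absurd hj1 (hsb _ hτl2)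
        · exact Or.inr (Or.inl (hj2.trans hcur))
        · exact absurd hj1 (hsb' _ hν2)
  have hKside : K ⊆ X ∩ leftOf (v, i - e) := by
    intro q hq
    refine ⟨(component_subset hτmem hq).1, ?_⟩
    rcases hbigon q hq with rfl | rfl | rfl
    · exact hside0
    · exact hside1
    · exact hside2
  have hKτ : leftRegion τ₀ ∈ K := mem_component_self _ _
  -- the branch of `τ₀` crosses the edge later, so it does not cut the new piece from `τ₀`
  have hdiff : ¬ SameBranch (v, i - e) τ₀ := by
    intro h
    refine hnotcr 1 (h.trans (hτl.trans ?_))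
    have hν1 : step e (v, i) = (across u i, i + e) := by rw [step_mid, hv, across_across]
    rw [Function.iterate_one, hν1, crossing]
    simp only [add_add_self]
    rw [← step_add e u i]
    exact sameBranch_step he _
  refine ⟨SeidelDiagram.component (X ∩ leftOf (v, i - e)) (leftRegion τ₀),
    hX.component hM _ (hKside hKτ), ?_, ?_⟩
  · refine ⟨(isConnected_component _ _).subset_component hKside hKτ, fun hsub => ?_⟩
    have hmem := component_closed (hKside hKτ) (separates_left_right τ₀) (mem_component_self _ _)
      ⟨hτX, (mem_leftOf_iff hM hdiff (separates_left_right τ₀)).1 (hKside hKτ).2⟩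
    exact right_notMem_leftOf hM (SameBranch.refl τ₀) (component_subset hτmem (hsub hmem)).2
  · refine ⟨fun q hq => (component_subset (hKside hKτ) hq).1, fun hsub => ?_⟩
    exact right_notMem_leftOf hM (SameBranch.refl _)
      (component_subset (hKside hKτ) (hsub hvX')).2

/-! ### Elementary moves -/

/-- Every diagram which is not a single middle triangle is obtained by an elementary move from a
smaller diagram, namely from any maximal one, cut off by a branch along its boundary. -/
theorem IsDiagram.exists_elementaryMove (hM : IsNonspherical M) {X : Set (Region M)}
    (hX : IsDiagram X) {h : M.Group} (hw : IsWhite h) (hh : Region.middle h ∈ X)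
    (hne : X ≠ {Region.middle h}) : ∃ Y, IsDiagram Y ∧ Y ⊂ X ∧ ElementaryMove Y X := by
  have hL := hX.leftAdmissible hM
  have hfin : {Y | IsDiagram Y ∧ Y ⊂ X}.Finite :=
    hX.finite.finite_subsets.subset fun Y hY => hY.2.subset
  obtain ⟨Y, ⟨hY, hYX⟩, hmax⟩ := hfin.exists_maximal ⟨{Region.middle h}, isDiagram_middle hw,
    Set.singleton_subset_iff.2 hh |>.ssubset_of_ne hne.symm⟩
  have hmax : ∀ Z, IsDiagram Z → Y ⊂ Z → ¬ Z ⊂ X := fun Z hZ hYZ hZX =>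
    hYZ.2 (hmax ⟨hZ, hZX⟩ hYZ.1)
  have hYL := hY.leftAdmissible hM
  obtain ⟨τ₀, hτ₀, hτX⟩ : ∃ τ₀ ∈ boundary Y, rightRegion τ₀ ∈ X := by
    by_contra! hall
    obtain ⟨y, hy⟩ := hY.nonempty
    refine hYX.2 fun x hx => ?_
    have hpath := hX.connected y (hYX.1 hy) x hx
    clear hx
    induction hpath with
    | refl => exact hy
    | @tail b c _ hbc ih =>
      obtain ⟨hb, hc, ρ, hρ⟩ := hbc
      rcases separates_iff.1 hρ with ⟨rfl, rfl⟩ | ⟨rfl, rfl⟩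
      · by_contra hcon
        exact hall ρ ⟨ih, hcon⟩ hc
      · exact hYL.left_mem ρ ih
  have hsub := hYL.subset_leftOf hM hY.finite hY.connected hτ₀
  have hYs : Y ⊆ X ∩ leftOf τ₀ := fun y hy => ⟨hYX.1 hy, hsub hy⟩
  have hmem : leftRegion τ₀ ∈ X ∩ leftOf τ₀ := hYs hτ₀.1
  have hYK : Y ⊆ SeidelDiagram.component (X ∩ leftOf τ₀) (leftRegion τ₀) :=
    hY.connected.subset_component hYs hτ₀.1
  have hKX : SeidelDiagram.component (X ∩ leftOf τ₀) (leftRegion τ₀) ⊂ X :=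
    ⟨fun q hq => (component_subset hmem hq).1, fun hcon =>
      right_notMem_leftOf hM (SameBranch.refl _) (component_subset hmem (hcon hτX)).2⟩
  have hYeq : Y = SeidelDiagram.component (X ∩ leftOf τ₀) (leftRegion τ₀) := by
    by_contra hcon
    exact hmax _ (hX.component hM τ₀ hmem) (hYK.ssubset_of_ne hcon) hKX
  have hcon : IsConnected (X ∩ leftOf τ₀) := by
    by_contra hcon
    obtain ⟨e, he, m, hm1, hm2, n, hmn, hn⟩ := hX.exists_reentry hM hτX hcon
    obtain ⟨⟨u, j⟩, hσ⟩ : ∃ σ, σ = (step e)^[m] τ₀ := ⟨_, rfl⟩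
    obtain ⟨i, rfl⟩ : ∃ i, j = i + e := ⟨j - e, by simp⟩
    have hσX : rightRegion (u, i + e) ∈ X := hσ ▸ hm1 m le_rfl
    rw [Function.iterate_succ_apply', ← hσ] at hm2
    have hre : rightRegion ((step e)^[n - m - 1 + 1] (u, i + e)) ∈ X := by
      rw [hσ, ← Function.iterate_add_apply, show n - m - 1 + 1 + m = n by omega]
      exact hn
    obtain ⟨h2, ρ, hρ, hcr⟩ := hX.exists_boundary_crossing hM he hσX hm2 hre
    simp only [crossing, add_sub_cancel_right, add_add_self] at h2 hcr
    have hνX : rightRegion (u, i - e) ∉ X :=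
      hL.right_notMem hM hX.finite hX.connected hρ hcr.symm
    have hu : IsWhite u := by
      by_contra hb
      rw [rightRegion_black (by exact hb)] at hσX hνX
      exact hνX hσX
    have hν : (u, i - e) ∈ boundary X := by
      refine ⟨?_, hνX⟩
      have := hL.left_mem _ hσX
      rw [leftRegion_white (by exact hu)] at this ⊢
      exact this
    have hback : ∀ k ≤ m, (step (-e))^[k] (u, i + e) = (step e)^[m - k] τ₀ := by
      intro k hk
      have := iterate_step_neg e k ((step e)^[m - k] τ₀)
      rwa [← Function.iterate_add_apply, show k + (m - k) = m by omega, ← hσ] at this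
    obtain ⟨Z, hZ, hZ1, hZ2⟩ := hX.exists_between hM he h2 hu hν (by omega) hre (m := m)
      (fun k hk => by rw [hback k hk]; exact hm1 _ (by omega))
      (τ₀ := τ₀) (by rw [hback m le_rfl]; simp)
    exact hmax Z hZ (hYeq ▸ hZ1) hZ2
  have hYinter : Y = X ∩ leftOf τ₀ := Set.Subset.antisymm hYs fun q hq => by
    rw [hYeq]; exact hcon _ hmem q hq
  refine ⟨Y, hY, hYX, {τ | SameBranch τ₀ τ}, hY, hX, ⟨τ₀, rfl⟩, ⟨τ₀, SameBranch.refl _, ?_⟩,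
    hYinter, fun ⟨Z, hZ, hYZ, hZX⟩ => hmax Z hZ hYZ hZX⟩
  have hl := hL.left_mem _ hτX
  by_cases hw : IsWhite τ₀.1
  · rw [leftRegion_white hw] at hl
    rw [rightRegion_white hw] at hτX
    exact ⟨hl, hτX⟩
  · rw [leftRegion_black hw] at hl
    rw [rightRegion_black hw] at hτX
    exact ⟨hτX, hl⟩

/-- Every diagram arises from the middle triangle of a white base triangle by elementary moves. -/
theorem IsDiagram.exists_reflTransGen (hM : IsNonspherical M) {X : Set (Region M)}
    (hX : IsDiagram X) : ∃ h : M.Group, IsWhite h ∧ IsBasic {(Region.middle h : Region M)} ∧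
      Relation.ReflTransGen ElementaryMove {Region.middle h} X := by
  obtain ⟨k, hk⟩ : ∃ k, X.ncard = k := ⟨_, rfl⟩
  induction k using Nat.strong_induction_on generalizing X with
  | _ k ih =>
    obtain ⟨h, hw, hh⟩ := (hX.leftAdmissible hM).exists_white hX.nonempty
    by_cases hne : X = {Region.middle h}
    · exact ⟨h, hw, isBasic_middle hw, hne ▸ .refl⟩
    · obtain ⟨Y, hY, hYX, hmove⟩ := hX.exists_elementaryMove hM hw hh hne
      obtain ⟨g, hg, hb, hpath⟩ := ih _ (hk ▸ Set.ncard_lt_ncard hYX hX.finite) hY rfl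
      exact ⟨g, hg, hb, hpath.tail hmove⟩

end SeidelDiagram

theorem mainTheorem4 (a b c : ℕ) (ha : 2 ≤ a) (hb : 2 ≤ b) (hc : 2 ≤ c)
    (habc : (1 : ℚ) / a + 1 / b + 1 / c ≤ 1)
    (X : Set (SeidelDiagram.Region (triangleMatrix a b c ha hb hc)))
    (hX : SeidelDiagram.IsDiagram X) :
    ∃ h : (triangleMatrix a b c ha hb hc).Group,
      SeidelDiagram.IsWhite h ∧
      SeidelDiagram.IsBasic {SeidelDiagram.Region.middle h} ∧
      Relation.ReflTransGen SeidelDiagram.ElementaryMove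
        {SeidelDiagram.Region.middle h} X := by
  have h0 : SeidelDiagram.coneOrder (triangleMatrix a b c ha hb hc) 0 = a := rfl
  have h1 : SeidelDiagram.coneOrder (triangleMatrix a b c ha hb hc) 1 = b := rfl
  have h2 : SeidelDiagram.coneOrder (triangleMatrix a b c ha hb hc) 2 = c := rfl
  refine SeidelDiagram.IsDiagram.exists_reflTransGen ⟨fun i => ?_, ?_⟩ hX
  · obtain rfl | rfl | rfl : i = 0 ∨ i = 1 ∨ i = 2 := by
      revert i; decide
    · rwa [h0]
    · rwa [h1]
    · rwa [h2]
  · rwa [h0, h1, h2]
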